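/- Let $q,t$ be indeterminates, $\mathbb{F}=\mathbb{Q}(q,t)$, and let $\Lambda_{\mathbb{F}}$ be the ring of symmetric functions over $\mathbb{F}$ with power sums $p_n$ ($n\ge 1$) and monomial symmetric functions $m_\lambda$. Equip $\Lambda_{\mathbb{F}}$ with the Macdonald inner product, the bilinear form given by $$\langle p_\lambda,p_\mu\rangle_{q,t}=\delta_{\lambda\mu}\,z_\lambda\prod_{i=1}^{\ell(\lambda)}\frac{1-q^{\lambda_i}}{1-t^{\lambda_i}},\qquad z_\lambda=\prod_{i\ge1} i^{m_i}\,m_i!,$$ where $m_i$ is the number of parts of $\lambda$ equal to $i$. Let $P_\lambda(q,t)$ be the Macdonald symmetric functions, i.e. the unique family with $P_\lambda\in m_\lambda+\sum_{\mu<\lambda}\mathbb{F}\,m_\mu$ (dominance order) and $\langle P_\lambda,P_\mu\rangle_{q,t}=0$ for $\lambda\neq\mu$, and let $$J_\lambda(q,t)=\prod_{s\in\lambda}\bigl(1-q^{a_\lambda(s)}t^{l_\lambda(s)+1}\bigr)\,P_\lambda(q,t)$$ be their integral forms, where for a box $s=(i,j)$ of the Young diagram of $\lambda$, with $\lambda'$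 the conjugate partition, $a_\lambda(s)=\lambda_i-j$ and $l_\lambda(s)=\lambda'_j-i$. For $n,r\ge0$ put $$v_n^{(r)}:=\sum_{\lambda\vdash n}J_\lambda(q,t)\,\frac{q^{n(\lambda')}}{\langle J_\lambda(q,t),J_\lambda(q,t)\rangle_{q,t}}\,h_r[B_\lambda],$$ where $n(\lambda)=\sum_i(i-1)\lambda_i$, $B_\lambda=\{q^{j-1}t^{1-i}\mid(i,j)\in\lambda\}$, and $h_r[B_\lambda]$ is the complete homogeneous symmetric polynomial of degree $r$ evaluated at the alphabet $B_\lambda$ (so $h_0[B_\lambda]=1$). Then the generating function $v^{(0)}(w):=\sum_{n\ge0}(-w)^n v_n^{(0)}$ satisfies, in the ring $\Lambda_{\mathbb{F}}[[w]]$ of formal power series in $w$, $$v^{(0)}(w)=\exp\Bigl(-\sum_{n>0}\frac{1}{1-q^n}\,\frac{p_n}{n}\,w^n\Bigr).$$ -/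

import Mathlib

noncomputable section

set_option linter.unusedSectionVars false

namespace Macdonald

/-- The ring of symmetric functions over `R` in the countably many variables `x_0, x_1, x_2, ...`:
formal power series of bounded degree that are invariant under all permutations of the variables. -/
def SymFun (R : Type*) [CommRing R] : Subalgebra R (MvPowerSeries ℕ R) where
  carrier := {f | (∀ σ : Equiv.Perm ℕ, MvPowerSeries.renameEquiv R σ f = f) ∧
    ∃ d : ℕ, ∀ e : ℕ →₀ ℕ, MvPowerSeries.coeff e f ≠ 0 → e.degree ≤ d}
  mul_mem' := by
    rintro f g ⟨hf, a, ha⟩ ⟨hg, b, hb⟩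
    refine ⟨fun σ => by rw [map_mul, hf, hg], a + b, fun e he => ?_⟩
    rw [MvPowerSeries.coeff_mul] at he
    obtain ⟨x, hx, hne⟩ := Finset.exists_ne_zero_of_sum_ne_zero he
    rw [← Finset.HasAntidiagonal.mem_antidiagonal.mp hx, map_add]
    exact add_le_add (ha _ (left_ne_zero_of_mul hne)) (hb _ (right_ne_zero_of_mul hne))
  add_mem' := by
    rintro f g ⟨hf, a, ha⟩ ⟨hg, b, hb⟩
    refine ⟨fun σ => by rw [map_add, hf, hg], max a b, fun e he => ?_⟩
    rw [map_add] at he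
    by_cases h : MvPowerSeries.coeff e f = 0
    · exact le_max_of_le_right (hb e (fun h' => he (by rw [h, h', add_zero])))
    · exact le_max_of_le_left (ha e h)
  algebraMap_mem' r := by
    refine ⟨fun σ => AlgEquiv.commutes _ r, 0, fun e he => ?_⟩
    rw [MvPowerSeries.algebraMap_apply, Algebra.algebraMap_self_apply,
      MvPowerSeries.coeff_C] at he
    by_cases h : e = 0
    · simp [h]
    · exact absurd (if_neg h) he

theorem mem_SymFun_of_coeff {R : Type*} [CommRing R] {f : MvPowerSeries ℕ R}
    (h : ∀ (σ : Equiv.Perm ℕ) (e : ℕ →₀ ℕ),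
      MvPowerSeries.coeff (e.embDomain σ.toEmbedding) f = MvPowerSeries.coeff e f)
    (d : ℕ) (hd : ∀ e : ℕ →₀ ℕ, MvPowerSeries.coeff e f ≠ 0 → e.degree ≤ d) :
    f ∈ SymFun R := by
  refine ⟨fun σ => ?_, d, hd⟩
  ext e
  obtain ⟨e', rfl⟩ : ∃ e' : ℕ →₀ ℕ, e'.embDomain σ.toEmbedding = e :=
    ⟨e.embDomain σ.symm.toEmbedding, by ext i; simp [Finsupp.embDomain_eq_mapDomain, ← Finsupp.mapDomain_comp]⟩
  rw [h, MvPowerSeries.renameEquiv_apply]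
  exact MvPowerSeries.coeff_embDomain_rename σ.toEmbedding f e'

theorem coeff_embDomain_of_mem_SymFun {R : Type*} [CommRing R] {f : MvPowerSeries ℕ R}
    (hf : f ∈ SymFun R) (σ : Equiv.Perm ℕ) (e : ℕ →₀ ℕ) :
    MvPowerSeries.coeff (e.embDomain σ.toEmbedding) f = MvPowerSeries.coeff e f := by
  conv_lhs => rw [← hf.1 σ, MvPowerSeries.renameEquiv_apply]
  exact MvPowerSeries.coeff_embDomain_rename σ.toEmbedding f e

open Classical in
/-- The monomial symmetric function `m_λ`: the sum of all distinct monomials whose multiset of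
nonzero exponents is `λ`. -/
def msymm (R : Type*) [CommRing R] {n : ℕ} (lam : n.Partition) : SymFun R :=
  ⟨fun e => if e.support.val.map e = lam.parts then 1 else 0, by
    refine mem_SymFun_of_coeff (fun σ e => ?_) n (fun e he => ?_)
    · change (if _ then (1 : R) else 0) = if _ then (1 : R) else 0
      simp only [Finsupp.support_embDomain, Finset.map_val,
        Multiset.map_map, Function.comp_def, Finsupp.embDomain_apply_self]
    · have h : e.support.val.map e = lam.parts := by
        by_contra h
        exact he (if_neg h)
      have := congrArg Multiset.sum h
      rw [lam.parts_sum] at this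
      exact this.le⟩

open Classical in
/-- The power sum `p_n = ∑ i, x_i ^ n`, for `n ≥ 1`. -/
def psum (R : Type*) [CommRing R] (n : ℕ+) : SymFun R :=
  ⟨fun e => if ∃ i, e = Finsupp.single i (n : ℕ) then 1 else 0, by
    refine mem_SymFun_of_coeff (fun σ e => ?_) n (fun e he => ?_)
    · change (if _ then (1 : R) else 0) = if _ then (1 : R) else 0
      congr 1
      refine propext ⟨?_, ?_⟩
      · rintro ⟨i, hi⟩
        refine ⟨σ.symm i, Finsupp.embDomain_injective σ.toEmbedding ?_⟩
        rw [hi, Finsupp.embDomain_single]; simp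
      · rintro ⟨i, rfl⟩
        exact ⟨σ i, by rw [Finsupp.embDomain_single]; rfl⟩
    · have h : ∃ i, e = Finsupp.single i (n : ℕ) := by
        by_contra h
        exact he (if_neg h)
      obtain ⟨i, rfl⟩ := h
      simp⟩

/-- The algebra homomorphism `K[X_1, X_2, ...] → SymFun K` with `X_n ↦ p_n`. -/
def psumHom (K : Type*) [CommRing K] : MvPolynomial ℕ+ K →ₐ[K] SymFun K :=
  MvPolynomial.aeval (psum K)

/-! The power sums are algebraically independent and generate the ring of symmetric functions over
a field of characteristic zero, so that the products `p_λ` form a basis. -/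

section PowerSumBasis

variable {K : Type*} [Field K] [CharZero K]

theorem surj_endo {A : Type*} [CommRing A] [IsNoetherianRing A] (f : A →+* A)
    (hf : Function.Surjective f) : Function.Injective f := by
  rw [RingHom.injective_iff_ker_eq_bot, eq_bot_iff]
  let c : ℕ →o Ideal A := ⟨fun n => RingHom.ker (f ^ n), monotone_nat_of_le_succ fun n x hx => by
    rw [RingHom.mem_ker] at hx ⊢
    rw [pow_succ', RingHom.mul_def, RingHom.comp_apply, hx, map_zero]⟩
  obtain ⟨n, hn⟩ := monotone_stabilizes_iff_noetherian.mpr ‹_› c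
  intro x hx
  obtain ⟨y, rfl⟩ : ∃ y, (f ^ n) y = x := by
    rw [RingHom.coe_pow]
    exact hf.iterate n x
  have h1 : y ∈ c (n + 1) := by
    change y ∈ RingHom.ker (f ^ (n + 1))
    rw [RingHom.mem_ker, pow_succ', RingHom.mul_def, RingHom.comp_apply]
    exact hx
  rw [← hn (n + 1) (Nat.le_succ n)] at h1
  exact h1

variable (K) in
/-- The finite-variable analogue: `X_i ↦ p_{i+1}(x_0, ..., x_{N-1})`. -/
def psumFin (N : ℕ) :
    MvPolynomial (Fin N) K →ₐ[K] MvPolynomial.symmetricSubalgebra (Fin N) K :=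
  MvPolynomial.aeval fun i => ⟨MvPolynomial.psum (Fin N) K (i + 1),
    MvPolynomial.psum_isSymmetric _ _ _⟩

theorem esymm_mem_psumFin (N k : ℕ) (hk : k ≤ N) :
    (⟨MvPolynomial.esymm (Fin N) K k, MvPolynomial.esymm_isSymmetric _ _ _⟩ :
      MvPolynomial.symmetricSubalgebra (Fin N) K) ∈ (psumFin K N).range := by
  induction k using Nat.strong_induction_on with
  | _ k ih =>
  rcases Nat.eq_zero_or_pos k with rfl | hk0
  · have h0 : (⟨MvPolynomial.esymm (Fin N) K 0, MvPolynomial.esymm_isSymmetric _ _ _⟩ :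
      MvPolynomial.symmetricSubalgebra (Fin N) K) = 1 := by
      apply Subtype.ext
      change MvPolynomial.esymm (Fin N) K 0 = 1
      simp
    rw [h0]
    exact one_mem _
  · have hkK : (k : K) ≠ 0 := by exact_mod_cast hk0.ne'
    have key : (⟨MvPolynomial.esymm (Fin N) K k, MvPolynomial.esymm_isSymmetric _ _ _⟩ :
      MvPolynomial.symmetricSubalgebra (Fin N) K) = (k : K)⁻¹ • ((-1) ^ (k + 1) *
        ∑ a ∈ Finset.HasAntidiagonal.antidiagonal k with a.1 < k, (-1) ^ a.1 *
          (⟨MvPolynomial.esymm (Fin N) K a.1, MvPolynomial.esymm_isSymmetric _ _ _⟩ :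
      MvPolynomial.symmetricSubalgebra (Fin N) K) *
          (⟨MvPolynomial.psum (Fin N) K a.2, MvPolynomial.psum_isSymmetric _ _ _⟩ :
      MvPolynomial.symmetricSubalgebra (Fin N) K)) := by
      apply Subtype.ext
      have := MvPolynomial.mul_esymm_eq_sum (Fin N) K k
      push_cast
      rw [← this, ← nsmul_eq_mul, ← Nat.cast_smul_eq_nsmul K, smul_smul, inv_mul_cancel₀ hkK,
        one_smul]
    rw [key]
    refine Subalgebra.smul_mem _ (mul_mem (pow_mem (neg_mem (one_mem _)) _)
      (sum_mem fun a ha => ?_)) _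
    rw [Finset.mem_filter, Finset.HasAntidiagonal.mem_antidiagonal] at ha
    refine mul_mem (mul_mem (pow_mem (neg_mem (one_mem _)) _) (ih a.1 ha.2 (by omega))) ?_
    refine ⟨MvPolynomial.X ⟨a.2 - 1, by omega⟩, ?_⟩
    change psumFin K N (MvPolynomial.X _) = _
    rw [psumFin, MvPolynomial.aeval_X]
    apply Subtype.ext
    have : a.2 - 1 + 1 = a.2 := by omega
    simp [this]

theorem psumFin_surjective (N : ℕ) : Function.Surjective (psumFin K N) := by
  intro x
  obtain ⟨y, rfl⟩ := MvPolynomial.esymmAlgHom_surjective (σ := Fin N) K (n := N) (by simp) x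
  change _ ∈ (psumFin K N).range
  induction y using MvPolynomial.induction_on with
  | C a => 
    rw [MvPolynomial.algHom_C]
    exact Subalgebra.algebraMap_mem _ _
  | add p q hp hq => rw [map_add]; exact add_mem hp hq
  | mul_X p i hp =>
    rw [map_mul]
    refine mul_mem hp ?_
    rw [MvPolynomial.esymmAlgHom, MvPolynomial.aeval_X]
    exact esymm_mem_psumFin N _ i.2

theorem psumFin_injective (N : ℕ) : Function.Injective (psumFin K N) := by
  let E := MvPolynomial.esymmAlgEquiv (Fin N) K (n := N) (by simp)
  have h : Function.Injective ((E.symm.toRingEquiv.toRingHom).comp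
      (psumFin K N).toRingHom) := by
    apply surj_endo
    exact E.symm.surjective.comp (psumFin_surjective N)
  exact Function.Injective.of_comp (f := E.symm) h

variable (K) in
/-- Setting the variables `x_i` with `i ≥ N` to zero. -/
def restr (N : ℕ) : MvPowerSeries ℕ K →ₐ[K] MvPowerSeries (Fin N) K :=
  MvPowerSeries.killCompl Fin.valEmbedding

theorem restr_psum (N : ℕ) (n : ℕ+) :
    restr K N (psum K n) = (MvPolynomial.psum (Fin N) K n : MvPowerSeries (Fin N) K) := by
  classical
  ext e
  rw [restr, MvPowerSeries.coeff_killCompl, MvPolynomial.coeff_coe, MvPolynomial.psum,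
    MvPolynomial.coeff_sum]
  simp only [MvPolynomial.coeff_X_pow]
  change (if ∃ i, Finsupp.embDomain Fin.valEmbedding e = Finsupp.single i (n : ℕ) then (1 : K)
    else 0) = _
  split_ifs with h
  · obtain ⟨i, hi⟩ := h
    obtain ⟨j, hj, rfl⟩ := Finsupp.single_of_embDomain_single e Fin.valEmbedding i n n.ne_zero hi
    subst hj
    rw [Finset.sum_eq_single j]
    · simp
    · intro b _ hb
      rw [if_neg]
      intro h
      exact hb ((Finsupp.single_left_inj n.ne_zero).mp h)
    · simp
  · symm
    apply Finset.sum_eq_zero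
    intro i _
    rw [if_neg]
    rintro rfl
    exact h ⟨i, by rw [Finsupp.embDomain_single]; rfl⟩

/-- The index shift `i ↦ i + 1`. -/
def idx (N : ℕ) (i : Fin N) : ℕ+ := ⟨i + 1, Nat.succ_pos _⟩

theorem restr_psumHom (N : ℕ) (g : MvPolynomial (Fin N) K) :
    restr K N (psumHom K (MvPolynomial.rename (idx N) g)) =
      ((psumFin K N g : MvPolynomial (Fin N) K) : MvPowerSeries (Fin N) K) := by
  induction g using MvPolynomial.induction_on with
  | C a =>
    rw [MvPolynomial.rename_C, MvPolynomial.algHom_C, MvPolynomial.algHom_C]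
    simp only [Subalgebra.coe_algebraMap, AlgHom.commutes]
    simp [MvPowerSeries.algebraMap_apply, MvPolynomial.algebraMap_eq]
  | add p q hp hq => simp [hp, hq]
  | mul_X p i hp =>
    simp only [map_mul, MulMemClass.coe_mul, hp, MvPolynomial.coe_mul, MvPolynomial.rename_X]
    congr 1
    rw [psumHom, psumFin, MvPolynomial.aeval_X, MvPolynomial.aeval_X, restr_psum]
    rfl

theorem psumHom_injective : Function.Injective (psumHom K) := by
  rw [injective_iff_map_eq_zero]
  intro f hf
  obtain ⟨N, hN⟩ : ∃ N : ℕ, ∀ n ∈ f.vars, (n : ℕ) ≤ N :=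
    ⟨f.vars.sup (fun n => (n : ℕ)), fun n hn => Finset.le_sup (f := fun n : ℕ+ => (n : ℕ)) hn⟩
  have hinj : Function.Injective (idx N) := fun i j h => by
    have := congrArg PNat.val h
    simp only [idx, PNat.mk_coe] at this
    exact Fin.ext (by omega)
  obtain ⟨g, rfl⟩ := MvPolynomial.exists_rename_eq_of_vars_subset_range f (idx N) hinj (by
    intro n hn
    have h1 := hN n hn
    have h2 := n.pos
    exact ⟨⟨n - 1, by omega⟩, PNat.eq (by simp [idx]; omega)⟩)
  have h := restr_psumHom N g
  rw [hf, ZeroMemClass.coe_zero, map_zero] at h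
  have h0 : psumFin K N g = 0 := by
    apply Subtype.ext
    apply MvPolynomial.coe_injective
    rw [← h]; simp
  rw [(injective_iff_map_eq_zero _).mp (psumFin_injective N) g h0, map_zero]

/-- `f` is homogeneous of degree `k`. -/
def IsHom (k : ℕ) (f : MvPowerSeries ℕ K) : Prop :=
  ∀ e : ℕ →₀ ℕ, MvPowerSeries.coeff e f ≠ 0 → e.degree = k

theorem IsHom.mul {a b : ℕ} {f g : MvPowerSeries ℕ K} (hf : IsHom a f) (hg : IsHom b g) :
    IsHom (a + b) (f * g) := by
  classical
  intro e he
  rw [MvPowerSeries.coeff_mul] at he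
  obtain ⟨x, hx, hne⟩ := Finset.exists_ne_zero_of_sum_ne_zero he
  rw [← Finset.HasAntidiagonal.mem_antidiagonal.mp hx, map_add, hf _ (left_ne_zero_of_mul hne),
    hg _ (right_ne_zero_of_mul hne)]

theorem isHom_psum (n : ℕ+) : IsHom n (psum K n : MvPowerSeries ℕ K) := by
  intro e he
  have h : ∃ i, e = Finsupp.single i (n : ℕ) := by
    by_contra h
    exact he (if_neg h)
  obtain ⟨i, rfl⟩ := h
  simp

theorem isHom_monomial (m : ℕ+ →₀ ℕ) (c : K) :
    IsHom (m.sum fun n k => k * n) (psumHom K (MvPolynomial.monomial m c) : MvPowerSeries ℕ K) := by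
  induction m using Finsupp.induction_linear generalizing c with
  | zero =>
    rw [← MvPolynomial.C_apply, MvPolynomial.algHom_C]
    intro e he
    rw [Subalgebra.coe_algebraMap, MvPowerSeries.algebraMap_apply, Algebra.algebraMap_self_apply, MvPowerSeries.coeff_C] at he
    by_cases h : e = 0
    · simp [h]
    · exact absurd (if_neg h) he
  | add f g hf hg =>
    have : MvPolynomial.monomial (f + g) c =
        MvPolynomial.monomial f c * MvPolynomial.monomial g 1 := by simp
    rw [this, map_mul, Finsupp.sum_add_index' (by simp) (by intros; ring)]
    exact (hf c).mul (hg 1)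
  | single n k =>
    rw [Finsupp.sum_single_index (by simp)]
    induction k generalizing c with
    | zero =>
      intro e he
      rw [Finsupp.single_zero, ← MvPolynomial.C_apply, MvPolynomial.algHom_C, Subalgebra.coe_algebraMap, MvPowerSeries.algebraMap_apply, Algebra.algebraMap_self_apply, MvPowerSeries.coeff_C] at he
      by_cases h : e = 0
      · simp [h]
      · exact absurd (if_neg h) he
    | succ k ih =>
      have : MvPolynomial.monomial (Finsupp.single n (k + 1)) c =
          MvPolynomial.monomial (Finsupp.single n k) c * MvPolynomial.X n := by
        rw [MvPolynomial.X, MvPolynomial.monomial_mul, mul_one, ← Finsupp.single_add]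
      rw [this, map_mul, add_mul, one_mul]
      refine (ih c).mul ?_
      rw [psumHom, MvPolynomial.aeval_X]
      exact isHom_psum n

theorem exists_trunc (d : ℕ) (G : MvPolynomial ℕ+ K) : ∃ G' : MvPolynomial ℕ+ K,
    ∀ e : ℕ →₀ ℕ, MvPowerSeries.coeff e (psumHom K G' : MvPowerSeries ℕ K) =
      if e.degree ≤ d then MvPowerSeries.coeff e (psumHom K G : MvPowerSeries ℕ K) else 0 := by
  induction G using MvPolynomial.induction_on' with
  | monomial m c =>
    by_cases hm : (m.sum fun n k => k * (n : ℕ)) ≤ d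
    · refine ⟨MvPolynomial.monomial m c, fun e => ?_⟩
      split_ifs with he
      · rfl
      · by_contra h
        exact he ((isHom_monomial m c e h).le.trans hm)
    · refine ⟨0, fun e => ?_⟩
      rw [map_zero]
      split_ifs with he
      · by_contra h
        exact hm ((isHom_monomial m c e (fun h' => h (by rw [h']; simp))) ▸ he)
      · simp
  | add p q hp hq =>
    obtain ⟨p', hp⟩ := hp
    obtain ⟨q', hq⟩ := hq
    refine ⟨p' + q', fun e => ?_⟩
    simp only [map_add, AddMemClass.coe_add, hp, hq]
    split_ifs <;> simp

theorem exists_perm (N : ℕ) (e : ℕ →₀ ℕ) (he : e.degree ≤ N) :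
    ∃ (σ : Equiv.Perm ℕ) (e' : Fin N →₀ ℕ),
      e.embDomain σ.toEmbedding = e'.embDomain Fin.valEmbedding := by
  have hcard : e.support.card ≤ N := by
    refine le_trans ?_ he
    rw [Finsupp.degree_apply, Finset.card_eq_sum_ones]
    exact Finset.sum_le_sum fun i hi => Nat.one_le_iff_ne_zero.mpr (Finsupp.mem_support_iff.mp hi)
  have := Equiv.Perm.isMultiplyPretransitive ℕ e.support.card
  let x : Fin e.support.card ↪ ℕ :=
    (e.support.equivFin.symm.toEmbedding).trans (Function.Embedding.subtype _)
  let y : Fin e.support.card ↪ ℕ := Fin.valEmbedding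
  obtain ⟨σ, hσ⟩ := MulAction.exists_smul_eq (Equiv.Perm ℕ) x y
  refine ⟨σ, ?_⟩
  have hmem : e.embDomain σ.toEmbedding ∈ Set.range (Finsupp.embDomain (M := ℕ) (Fin.valEmbedding (n := N))) := by
    rw [Finsupp.mem_range_embDomain_iff]
    intro i hi
    rw [Finsupp.support_embDomain, Finset.mem_coe, Finset.mem_map] at hi
    obtain ⟨j, hj, rfl⟩ := hi
    have h1 : (σ • x) (e.support.equivFin ⟨j, hj⟩) = y (e.support.equivFin ⟨j, hj⟩) := by rw [hσ]
    have h2 : σ j = (e.support.equivFin ⟨j, hj⟩ : ℕ) := by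
      simpa [x, y] using! h1
    refine ⟨⟨σ j, ?_⟩, rfl⟩
    rw [h2]
    exact (Fin.is_lt _).trans_le hcard
  obtain ⟨e', he'⟩ := hmem
  exact ⟨e', he'.symm⟩

theorem psumHom_surjective : Function.Surjective (psumHom K) := by
  rintro ⟨f, hf⟩
  obtain ⟨d, hd⟩ := hf.2
  have hfin : {e : Fin d →₀ ℕ | MvPowerSeries.coeff e (restr K d f) ≠ 0}.Finite := by
    refine (Finsupp.finite_of_degree_le d).subset fun e he => ?_
    have := hd _ he
    rwa [Finsupp.embDomain_eq_mapDomain, Finsupp.degree_mapDomain] at this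
  let h : MvPolynomial (Fin d) K := ∑ e ∈ hfin.toFinset,
    MvPolynomial.monomial e (MvPowerSeries.coeff e (restr K d f))
  have hh : (h : MvPowerSeries (Fin d) K) = restr K d f := by
    ext e
    rw [MvPolynomial.coeff_coe, MvPolynomial.coeff_sum]
    simp only [MvPolynomial.coeff_monomial, Finset.sum_ite_eq']
    split_ifs with h'
    · rfl
    · by_contra h0
      exact h' ((Set.Finite.mem_toFinset _).mpr (Ne.symm h0))
  have hsymm : h.IsSymmetric := by
    intro τ
    ext e
    obtain ⟨x, rfl⟩ : ∃ x : Fin d →₀ ℕ, x.mapDomain τ = e :=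
      ⟨e.mapDomain τ.symm, by simp [← Finsupp.mapDomain_comp]⟩
    rw [MvPolynomial.coeff_rename_mapDomain _ τ.injective, ← MvPolynomial.coeff_coe,
      ← MvPolynomial.coeff_coe, hh, restr, MvPowerSeries.coeff_killCompl,
      MvPowerSeries.coeff_killCompl]
    rw [← coeff_embDomain_of_mem_SymFun hf (τ.extendDomain Fin.equivSubtype)]
    congr 2
    simp only [Finsupp.embDomain_eq_mapDomain, ← Finsupp.mapDomain_comp]
    congr 1
    ext i
    exact Equiv.Perm.extendDomain_apply_image τ Fin.equivSubtype i
  obtain ⟨g, hg⟩ := psumFin_surjective d ⟨h, hsymm⟩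
  obtain ⟨G, hG⟩ := exists_trunc d (MvPolynomial.rename (idx d) g)
  refine ⟨G, Subtype.ext ?_⟩
  ext e
  rw [hG e]
  split_ifs with he
  · obtain ⟨σ, e', hσ⟩ := exists_perm d e he
    rw [← coeff_embDomain_of_mem_SymFun (Subtype.prop _) σ e,
      ← coeff_embDomain_of_mem_SymFun hf σ e, hσ]
    have h1 := congrArg (MvPowerSeries.coeff e') (restr_psumHom d g)
    rw [hg] at h1
    change _ = MvPowerSeries.coeff e' (h : MvPowerSeries (Fin d) K) at h1
    rw [hh] at h1
    exact h1
  · by_contra h'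
    exact he (hd e (Ne.symm h'))
end PowerSumBasis

/-- The ring of symmetric functions over a field of characteristic zero is the polynomial ring in the
power sums: `X_n ↦ p_n` is an isomorphism. -/
def psumEquiv (K : Type*) [Field K] [CharZero K] : MvPolynomial ℕ+ K ≃ₐ[K] SymFun K :=
  AlgEquiv.ofBijective (psumHom K) ⟨psumHom_injective, psumHom_surjective⟩

/-- The field `ℚ(q, t)` of rational functions in two indeterminates. -/
abbrev QT : Type := FractionRing (MvPolynomial (Fin 2) ℚ)

/-- The indeterminate `q`. -/
def q : QT := algebraMap (MvPolynomial (Fin 2) ℚ) QT (MvPolynomial.X 0)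

/-- The indeterminate `t`. -/
def t : QT := algebraMap (MvPolynomial (Fin 2) ℚ) QT (MvPolynomial.X 1)

/-- The ring of symmetric functions over `ℚ(q, t)`. -/
abbrev Sym : Type := SymFun QT

/-- For a partition `λ = (1^{m_1} 2^{m_2} ...)`, the scalar
`z_λ ∏_i (1 - q^{λ_i}) / (1 - t^{λ_i})`, where `z_λ = ∏_n n^{m_n} m_n!`. -/
def zqt (m : ℕ+ →₀ ℕ) : QT :=
  m.prod fun n k => (n : QT) ^ k * (k.factorial : QT) * ((1 - q ^ (n : ℕ)) / (1 - t ^ (n : ℕ))) ^ k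

/-- The Macdonald inner product: the bilinear form on symmetric functions with
`⟨p_λ, p_μ⟩ = δ_{λμ} z_λ ∏_i (1 - q^{λ_i}) / (1 - t^{λ_i})`. The coefficient of `p_λ` in the
expansion of `f` in power sums is the coefficient of `X^m`, `m` the multiplicities of `λ`, in the
polynomial that represents `f`. -/
def innerQT (f g : Sym) : QT :=
  ∑ m ∈ ((psumEquiv QT).symm f).support,
    zqt m * ((psumEquiv QT).symm f).coeff m * ((psumEquiv QT).symm g).coeff m

/-- The Young diagram of a partition. The box in row `i` and column `j` (both counted from `1`) is
the pair `(i - 1, j - 1)`. -/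
def diagram {n : ℕ} (lam : n.Partition) : YoungDiagram :=
  YoungDiagram.ofRowLens (lam.parts.sort (· ≥ ·)) (lam.parts.pairwise_sort (· ≥ ·)).sortedGE

/-- The dominance order `μ ≤ λ`: `μ_1 + ... + μ_k ≤ λ_1 + ... + λ_k` for all `k`. -/
def DomLE {n : ℕ} (mu lam : n.Partition) : Prop :=
  ∀ k : ℕ, ∑ i ∈ Finset.range k, (diagram mu).rowLen i ≤
    ∑ i ∈ Finset.range k, (diagram lam).rowLen i

/-- The defining properties of the Macdonald symmetric functions `P_λ(q, t)`, `λ ⊢ n`: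
`P_λ = m_λ + (a linear combination of the m_μ with μ < λ)` for the dominance order, and
`⟨P_λ, P_μ⟩ = 0` for `λ ≠ μ`. -/
structure IsMacdonald (n : ℕ) (P : n.Partition → Sym) : Prop where
  triangular : ∀ lam, P lam - msymm QT lam ∈
    Submodule.span QT {f : Sym | ∃ mu, DomLE mu lam ∧ mu ≠ lam ∧ f = msymm QT mu}
  orthogonal : ∀ lam mu, lam ≠ mu → innerQT (P lam) (P mu) = 0

/-- The Macdonald symmetric functions `P_λ(q, t)`, `λ ⊢ n`: the family with the defining
properties (there is exactly one, by a theorem of Macdonald). -/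
def macdonaldP (n : ℕ) : n.Partition → Sym :=
  Classical.epsilon (IsMacdonald n)

/-- The arm length `a(s) = λ_i - j` of the box `s = (i, j)`. -/
def arm (d : YoungDiagram) (s : ℕ × ℕ) : ℕ := d.rowLen s.1 - (s.2 + 1)

/-- The leg length `l(s) = λ'_j - i` of the box `s = (i, j)`. -/
def leg (d : YoungDiagram) (s : ℕ × ℕ) : ℕ := d.colLen s.2 - (s.1 + 1)

/-- `c_λ(q, t) = ∏_{s ∈ λ} (1 - q^{a(s)} t^{l(s) + 1})`. -/
def cCoeff (d : YoungDiagram) : QT :=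
  ∏ s ∈ d.cells, (1 - q ^ arm d s * t ^ (leg d s + 1))

/-- The integral form `J_λ(q, t) = c_λ(q, t) P_λ(q, t)`. -/
def macdonaldJ {n : ℕ} (lam : n.Partition) : Sym :=
  cCoeff (diagram lam) • macdonaldP n lam

/-- `n(λ) = ∑_i (i - 1) λ_i`. -/
def nStat (d : YoungDiagram) : ℕ := ∑ i ∈ Finset.range (d.colLen 0), i * d.rowLen i

/-- `h_r[B_λ]`: the complete homogeneous symmetric polynomial of degree `r` evaluated at the
alphabet `B_λ = {q^{j-1} t^{1-i} : (i, j) ∈ λ}`. -/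
def hB (r : ℕ) (d : YoungDiagram) : QT :=
  MvPolynomial.aeval
    (fun s : {s : ℕ × ℕ // s ∈ d.cells} => q ^ (s : ℕ × ℕ).2 * t⁻¹ ^ (s : ℕ × ℕ).1)
    (MvPolynomial.hsymm {s : ℕ × ℕ // s ∈ d.cells} QT r)

/-- `v_n^{(r)} = ∑_{λ ⊢ n} J_λ q^{n(λ')} / ⟨J_λ, J_λ⟩ h_r[B_λ]`. -/
def v (r n : ℕ) : Sym :=
  ∑ lam : n.Partition,
    (q ^ nStat (diagram lam).transpose / innerQT (macdonaldJ lam) (macdonaldJ lam) *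
      hB r (diagram lam)) • macdonaldJ lam

/-- The generating function `v^{(0)}(w) = ∑_{n ≥ 0} (-w)^n v_n^{(0)}`. -/
def vZero : PowerSeries Sym := PowerSeries.mk fun n => (-1) ^ n * v 0 n

/-- The series `∑_{n > 0} (1 / (1 - q^n)) (p_n / n) w^n`. -/
def powerSumSeries : PowerSeries Sym :=
  PowerSeries.mk fun n =>
    if h : 0 < n then ((1 / (1 - q ^ n)) * (1 / (n : QT))) • psum QT ⟨n, h⟩ else 0

end Macdonald

end

noncomputable section
set_option linter.unusedSectionVars false
namespace Macdonald

/-! Work in the polynomial ring in the power sums and let `kernelCoeff α β n` be the degree n part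
of exp(∑ (α^k - β^k)/(1 - q^k) p_k/k). For α = 0, β = 1 this is the right-hand side of the theorem,
so everything reduces to expanding it in the Macdonald basis. The key statement is the factorisation
⟨`kernelCoeff α β n`, P_λ⟩ = Y_λ ∏_{c ∈ λ} (α - β·content(c)), with Y_λ independent of α and β
(`exists_pform_kernelCoeff`), together with the value Y_λ c_λ = ∏ t^(i-1) over the boxes
(`kernelFactor_mul_cCoeff`). At α = 0, β = 1 the product is (-1)^n q^{n(λ')} t^{-n(λ)}, the powers
of t cancel, and the expansion coefficients are those of (-1)^n v_n.

The tools are the modes D_k = `macOp q t⁻¹ k` and D*_k = `macOp q⁻¹ t k` of two vertex operators.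
The zero modes are self-adjoint (`pform_macOp`, `pform_macOp_inv`). In finitely many variables they
become Macdonald's q-difference operators, hence are triangular on monomial functions with
eigenvalue 1 - (1-Q)(1-s)∑ Q^{j-1}s^{i-1} (`macOp_pmono_sub_mem`). For D_0 these eigenvalues are
distinct, so its eigenvectors give the P_λ; self-adjointness then makes every P_λ an eigenvector of
D*_0 as well (`eigenvector_macPoly`).

The factorisation comes from two relations. First, [D*_0, [D_0, p_1]] is a scalar multiple of p_1
(`double_commutator_macOp`); comparing eigenvalues shows that p_1 P_μ involves only P_λ with λ
obtained from μ by adding one box (`exists_cells_eq_insert`). Second, (D_0 - 1) k_{n+1} = β D_1 k_n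
- α(1-t⁻¹) p_1 k_n, where D_1 is proportional to [D_0, p_1] (`macOp_kernelCoeff`,
`one_sub_q_mul_macOp_one`). Paired with P_λ, this is a recursion over the boxes of λ in which the
added box s contributes exactly α - β·content(s).

To find Y_λ, put α = 1, β = t^N: the pairing becomes the specialisation P_λ(1, t, ..., t^{N-1}). If
N is the number of rows, P_λ in N variables is x_1⋯x_N times P of λ without its first column
(`toVars_macPoly_eq`), which gives a recursion over columns matched by that of c_λ. -/

/-- `F = exp (∑ n > 0, g n * z ^ n / n)`, expressed by the differential equation. -/
structure IsExpSeries {A : Type*} [CommRing A] (F : PowerSeries A) (g : ℕ → A) : Prop where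
  const : PowerSeries.coeff 0 F = 1
  step : ∀ n : ℕ, (n + 1 : A) * PowerSeries.coeff (n + 1) F =
    ∑ x ∈ Finset.HasAntidiagonal.antidiagonal n, g (x.1 + 1) * PowerSeries.coeff x.2 F

/-! ### Exponential power series through their logarithmic derivative -/

section ExpSeries

variable {A B : Type*} [CommRing A] [CommRing B]

/-- The recursion on coefficients is the equation F' = (∑ g_{n+1} z^n) F, so products of
exponentials can be handled by the Leibniz rule instead of by convolutions. -/
theorem isExpSeries_iff {F : PowerSeries A} {g : ℕ → A} :
    IsExpSeries F g ↔ PowerSeries.coeff 0 F = 1 ∧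
      PowerSeries.derivative A F = PowerSeries.mk (fun n => g (n + 1)) * F := by
  refine ⟨fun h => ⟨h.const, ?_⟩, fun h => ⟨h.1, fun n => ?_⟩⟩
  · ext n
    rw [PowerSeries.coeff_derivative, mul_comm, h.step, PowerSeries.coeff_mul]
    simp
  · have := congrArg (PowerSeries.coeff n) h.2
    rw [PowerSeries.coeff_derivative, mul_comm, PowerSeries.coeff_mul] at this
    simpa using this

theorem IsExpSeries.congr {F : PowerSeries A} {g g' : ℕ → A} (h : IsExpSeries F g)
    (hg : ∀ n, 0 < n → g n = g' n) : IsExpSeries F g' :=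
  ⟨h.const, fun n => by
    rw [h.step]
    exact Finset.sum_congr rfl fun x _ => by rw [hg _ (Nat.succ_pos _)]⟩

theorem IsExpSeries.mul {F G : PowerSeries A} {f g : ℕ → A} (hF : IsExpSeries F f)
    (hG : IsExpSeries G g) : IsExpSeries (F * G) (fun n => f n + g n) := by
  rw [isExpSeries_iff] at *
  refine ⟨by simp_all [PowerSeries.coeff_zero_eq_constantCoeff], ?_⟩
  have : PowerSeries.mk (fun n => f (n + 1) + g (n + 1)) =
      PowerSeries.mk (fun n => f (n + 1)) + PowerSeries.mk (fun n => g (n + 1)) := by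
    ext; simp
  rw [this, Derivation.leibniz, hF.2, hG.2, smul_eq_mul, smul_eq_mul]
  ring

theorem IsExpSeries.map {F : PowerSeries A} {g : ℕ → A} (h : IsExpSeries F g) (φ : A →+* B) :
    IsExpSeries (PowerSeries.map φ F) (fun n => φ (g n)) := by
  refine ⟨by rw [PowerSeries.coeff_map, h.const, map_one], fun n => ?_⟩
  simp only [PowerSeries.coeff_map]
  have := congrArg φ (h.step n)
  simpa using this

theorem IsExpSeries.rescale {F : PowerSeries A} {g : ℕ → A} (h : IsExpSeries F g) (c : A) :
    IsExpSeries (PowerSeries.rescale c F) (fun n => c ^ n * g n) := by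
  refine ⟨by simp [PowerSeries.coeff_rescale, h.const], fun n => ?_⟩
  simp only [PowerSeries.coeff_rescale]
  rw [mul_left_comm, h.step, Finset.mul_sum]
  refine Finset.sum_congr rfl fun x hx => ?_
  rw [← Finset.HasAntidiagonal.mem_antidiagonal.mp hx]
  ring

theorem isExpSeries_one : IsExpSeries (1 : PowerSeries A) (fun _ => 0) :=
  ⟨by simp, fun n => by simp [PowerSeries.coeff_one]⟩

/-- This is log(1 - z) = -∑ z^n/n. With g = -1 the recursion involves only the partial sums of the
coefficients 1, -1, 0, 0, .... -/
theorem isExpSeries_one_sub : IsExpSeries (1 - PowerSeries.X : PowerSeries A) (fun _ => -1) := by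
  refine ⟨by simp, fun n => ?_⟩
  rw [← Finset.mul_sum, Finset.Nat.sum_antidiagonal_eq_sum_range_succ_mk]
  have h : ∑ k ∈ Finset.range n.succ, PowerSeries.coeff (n - k) (1 - PowerSeries.X : PowerSeries A)
      = ∑ k ∈ Finset.range (n + 1), PowerSeries.coeff k (1 - PowerSeries.X : PowerSeries A) :=
    Finset.sum_flip fun k => PowerSeries.coeff k (1 - PowerSeries.X : PowerSeries A)
  rw [h]
  rcases n with _ | n
  · simp [PowerSeries.coeff_one, PowerSeries.coeff_X]
  · rw [Finset.sum_range_succ', Finset.sum_range_succ']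
    simp [PowerSeries.coeff_one, PowerSeries.coeff_X]

theorem isExpSeries_one_sub_mul (c : A) :
    IsExpSeries (1 - PowerSeries.C c * PowerSeries.X) (fun n => -c ^ n) := by
  have h := (isExpSeries_one_sub (A := A)).rescale c
  have h1 : PowerSeries.rescale c (1 - PowerSeries.X) =
      1 - PowerSeries.C c * (PowerSeries.X : PowerSeries A) := by
    rw [map_sub, map_one, PowerSeries.rescale_X]
  rw [h1] at h
  exact h.congr fun n _ => by ring

theorem isExpSeries_prod {ι : Type*} (s : Finset ι) (F : ι → PowerSeries A) (g : ι → ℕ → A)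
    (h : ∀ i ∈ s, IsExpSeries (F i) (g i)) :
    IsExpSeries (∏ i ∈ s, F i) (fun n => ∑ i ∈ s, g i n) := by
  classical
  induction s using Finset.induction_on with
  | empty => simpa using isExpSeries_one
  | insert a s ha ih =>
    simp only [Finset.prod_insert ha, Finset.sum_insert ha]
    exact (h a (Finset.mem_insert_self a s)).mul
      (ih fun i hi => h i (Finset.mem_insert_of_mem hi))

variable {K : Type*} [Field K] [CharZero K] [Algebra K A] [Algebra K B]

theorem isUnit_natCast_succ (K : Type*) [Field K] [CharZero K] [Algebra K A] (n : ℕ) : IsUnit (n + 1 : A) := by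
  have h : IsUnit (algebraMap K A (n + 1)) :=
    (IsUnit.mk0 _ (Nat.cast_add_one_ne_zero n)).map (algebraMap K A)
  simpa using h

/-- Since n + 1 is invertible, the recursion determines all coefficients. Identities between
exponentials, or between rational functions and exponentials, are thereby reduced to identities
between the terms of their logarithms for n > 0. -/
theorem IsExpSeries.unique (K : Type*) [Field K] [CharZero K] [Algebra K A] {F G : PowerSeries A} {g : ℕ → A} (hF : IsExpSeries F g)
    (hG : IsExpSeries G g) : F = G := by
  ext n
  induction n using Nat.strong_induction_on with
  | _ n ih =>
    rcases n with _ | n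
    · rw [hF.const, hG.const]
    · apply (isUnit_natCast_succ K n).mul_left_cancel
      rw [hF.step, hG.step]
      refine Finset.sum_congr rfl fun x hx => ?_
      rw [ih _ (by have := Finset.HasAntidiagonal.mem_antidiagonal.mp hx; omega)]

/-- The chain rule is applied to the exponential with coefficients in A, whereas `expSeries`
substitutes into the one over K; both have coefficients inverse to d! in A. -/
theorem coeff_exp_subst_eq (a : PowerSeries A) (ha : PowerSeries.HasSubst a) [Algebra ℚ A] :
    (PowerSeries.exp K).subst a = (PowerSeries.exp A).subst a := by
  ext n
  rw [PowerSeries.coeff_subst' ha, PowerSeries.coeff_subst' ha]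
  refine finsum_congr fun d => ?_
  rw [PowerSeries.coeff_exp, PowerSeries.coeff_exp, smul_eq_mul, Algebra.smul_def]
  rw [map_div₀, map_one, map_natCast]
  congr 1
  have h1 : algebraMap K A (1 / d.factorial) * d.factorial = 1 := by
    rw [← map_natCast (algebraMap K A), ← map_mul,
      one_div_mul_cancel (Nat.cast_ne_zero.mpr d.factorial_ne_zero), map_one]
  have h2 : (d.factorial : A) * algebraMap ℚ A (1 / d.factorial) = 1 := by
    rw [← map_natCast (algebraMap ℚ A), ← map_mul,
      mul_one_div_cancel (Nat.cast_ne_zero.mpr d.factorial_ne_zero), map_one]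
  exact left_inv_eq_right_inv h1 h2

variable (K) in
/-- The power series `exp (∑ n > 0, g n * z ^ n / n)`. -/
def expSeries (g : ℕ → A) : PowerSeries A :=
  (PowerSeries.exp K).subst (PowerSeries.mk fun n => (n : K)⁻¹ • g n)

theorem expSeries_isExpSeries (g : ℕ → A) : IsExpSeries (expSeries K g) g := by
  let _ : Algebra ℚ A := Algebra.compHom A (algebraMap ℚ K)
  have hs : PowerSeries.HasSubst (PowerSeries.mk fun n => (n : K)⁻¹ • g n) :=
    PowerSeries.HasSubst.of_constantCoeff_zero' (by
      rw [← PowerSeries.coeff_zero_eq_constantCoeff_apply]; simp)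
  rw [isExpSeries_iff]
  unfold expSeries
  constructor
  · rw [PowerSeries.coeff_zero_eq_constantCoeff_apply]
    have h := PowerSeries.constantCoeff_subst_eq_zero (a := PowerSeries.mk fun n => (n : K)⁻¹ • g n)
      (by change PowerSeries.constantCoeff _ = 0
          rw [← PowerSeries.coeff_zero_eq_constantCoeff_apply]; simp) (PowerSeries.exp K - 1) (by simp)
    rw [PowerSeries.subst_sub hs, map_sub, sub_eq_zero] at h
    refine h.trans ?_
    rw [← PowerSeries.coe_substAlgHom hs, map_one, map_one]
  · rw [coeff_exp_subst_eq _ hs, PowerSeries.derivative_subst hs, PowerSeries.derivative_exp,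
      mul_comm]
    congr 1
    ext n
    rw [PowerSeries.coeff_derivative]
    simp only [PowerSeries.coeff_mk]
    rw [mul_comm, ← Nat.cast_succ, ← nsmul_eq_mul, ← Nat.cast_smul_eq_nsmul K, smul_smul,
      mul_inv_cancel₀ (Nat.cast_ne_zero.mpr n.succ_ne_zero), one_smul]

end ExpSeries

/-! ### Exponentials of power sums, translations and vertex operators -/

section VertexOperators

variable {K : Type*} [Field K] [CharZero K]

/-- Symmetric functions as polynomials in the power sums. -/
abbrev PowerSumPoly (K : Type*) [CommRing K] : Type _ := MvPolynomial ℕ+ K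

/-- The power sum variable `p_n`, for `n ≥ 1`. -/
def pvar (K : Type*) [CommRing K] (n : ℕ) : PowerSumPoly K := MvPolynomial.X n.toPNat'

theorem pvar_coe (n : ℕ+) : pvar K n = MvPolynomial.X n := by
  rw [pvar, PNat.coe_toPNat']

/-- The series `exp (∑ n > 0, b n * p_n * z ^ n / n)`. -/
def pexp (b : ℕ → K) : PowerSeries (PowerSumPoly K) :=
  expSeries K fun n => MvPolynomial.C (b n) * pvar K n

/-- The coefficient of `z ^ n` in `pexp b`. -/
def pexpCoeff (b : ℕ → K) (n : ℕ) : PowerSumPoly K := PowerSeries.coeff n (pexp b)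

theorem pexp_isExpSeries (b : ℕ → K) :
    IsExpSeries (pexp b) fun n => MvPolynomial.C (b n) * pvar K n :=
  expSeries_isExpSeries _

theorem pexpCoeff_zero (b : ℕ → K) : pexpCoeff b 0 = 1 := (pexp_isExpSeries b).const

theorem pexpCoeff_step (b : ℕ → K) (n : ℕ) : ((n : PowerSumPoly K) + 1) * pexpCoeff b (n + 1) =
    ∑ x ∈ Finset.HasAntidiagonal.antidiagonal n,
      MvPolynomial.C (b (x.1 + 1)) * pvar K (x.1 + 1) * pexpCoeff b x.2 :=
  (pexp_isExpSeries b).step n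

theorem pexpCoeff_one (b : ℕ → K) : pexpCoeff b 1 = MvPolynomial.C (b 1) * pvar K 1 := by
  have := pexpCoeff_step b 0
  simpa [pexpCoeff_zero] using this

/-- The translation `p_n ↦ p_n + v n * y ^ n`. -/
def shiftHom (v : ℕ → K) : PowerSumPoly K →ₐ[K] Polynomial (PowerSumPoly K) :=
  MvPolynomial.aeval fun n =>
    Polynomial.C (MvPolynomial.X n) + Polynomial.monomial (n : ℕ) (MvPolynomial.C (v n))

/-- The coefficient of `y ^ j` in the translation by `p_n ↦ p_n + v n * y ^ n`. -/
def shiftCoeff (v : ℕ → K) (j : ℕ) : PowerSumPoly K →ₗ[K] PowerSumPoly K :=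
  ((Polynomial.lcoeff (PowerSumPoly K) j).restrictScalars K).comp (shiftHom v).toLinearMap

theorem shiftCoeff_apply (v : ℕ → K) (j : ℕ) (f : PowerSumPoly K) :
    shiftCoeff v j f = (shiftHom v f).coeff j := rfl

theorem shiftHom_X (v : ℕ → K) (n : ℕ+) : shiftHom v (MvPolynomial.X n) =
    Polynomial.C (MvPolynomial.X n) + Polynomial.monomial (n : ℕ) (MvPolynomial.C (v n)) := by
  rw [shiftHom, MvPolynomial.aeval_X]

theorem shiftHom_pvar (v : ℕ → K) (n : ℕ) (hn : 0 < n) : shiftHom v (pvar K n) =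
    Polynomial.C (pvar K n) + Polynomial.monomial n (MvPolynomial.C (v n)) := by
  lift n to ℕ+ using hn
  rw [pvar_coe, shiftHom_X]

theorem shiftHom_C (v : ℕ → K) (c : K) :
    shiftHom v (MvPolynomial.C c) = Polynomial.C (MvPolynomial.C c) := by
  rw [← MvPolynomial.algebraMap_eq, AlgHom.commutes]
  rfl

/-- The scalar series by which a translation multiplies an exponential of power sums. -/
def shiftFactor (b v : ℕ → K) : PowerSeries K := expSeries K fun n => b n * v n

/-- The translation adds ∑ b_n v_n (yz)^n/n to the exponent, which is free of power sums, so the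
exponential is multiplied by a scalar series in yz. -/
theorem map_shiftHom_pexp (b v : ℕ → K) :
    PowerSeries.map (shiftHom v).toRingHom (pexp b) =
      PowerSeries.map Polynomial.C (pexp b) *
        PowerSeries.rescale (Polynomial.X : Polynomial (PowerSumPoly K))
          (PowerSeries.map (Polynomial.C.comp MvPolynomial.C) (shiftFactor b v)) := by
  have h1 := (pexp_isExpSeries b).map (shiftHom v).toRingHom
  have h2 := ((pexp_isExpSeries b).map
    (Polynomial.C : PowerSumPoly K →+* Polynomial (PowerSumPoly K))).mul
    (((expSeries_isExpSeries (K := K) fun n => b n * v n).map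
    ((Polynomial.C : PowerSumPoly K →+* Polynomial (PowerSumPoly K)).comp
      MvPolynomial.C)).rescale Polynomial.X)
  refine h1.unique K (h2.congr fun n hn => ?_)
  change _ = shiftHom v (MvPolynomial.C (b n) * pvar K n)
  rw [map_mul (shiftHom v), shiftHom_C, shiftHom_pvar v n hn]
  simp only [map_mul, RingHom.comp_apply, ← Polynomial.C_mul_X_pow_eq_monomial]
  ring

theorem shiftCoeff_pexpCoeff (b v : ℕ → K) (j n : ℕ) :
    shiftCoeff v j (pexpCoeff b n) = if j ≤ n then
      MvPolynomial.C (PowerSeries.coeff j (shiftFactor b v)) * pexpCoeff b (n - j) else 0 := by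
  have h := congrArg (fun F => (PowerSeries.coeff n F).coeff j) (map_shiftHom_pexp b v)
  simp only [PowerSeries.coeff_map, PowerSeries.coeff_mul, PowerSeries.coeff_rescale,
    Polynomial.finsetSum_coeff, Polynomial.coeff_C_mul, RingHom.comp_apply,
    Polynomial.coeff_mul_C, Polynomial.coeff_X_pow] at h
  change shiftCoeff v j (pexpCoeff b n) = _ at h
  rw [h]
  split_ifs with hj
  · rw [Finset.sum_eq_single (n - j, j)]
    · simp [pexpCoeff, mul_comm]
    · intro x hx hne
      have hx' := Finset.HasAntidiagonal.mem_antidiagonal.mp hx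
      rw [if_neg]
      · simp
      · rintro rfl
        exact hne (Prod.ext (by simp; omega) rfl)
    · intro hx
      exact absurd (Finset.HasAntidiagonal.mem_antidiagonal.mpr (by simp; omega)) hx
  · refine Finset.sum_eq_zero fun x hx => ?_
    have hx' := Finset.HasAntidiagonal.mem_antidiagonal.mp hx
    rw [if_neg (by omega)]
    simp

/-- The functional `P ↦ ∑ j, a (k + j) * P_j` on polynomials. -/
def pairing (a : ℕ → PowerSumPoly K) (k : ℕ) :
    Polynomial (PowerSumPoly K) →ₗ[K] PowerSumPoly K :=
  Polynomial.lsum fun j => LinearMap.mulLeft K (a (k + j))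

theorem pairing_monomial (a : ℕ → PowerSumPoly K) (k j : ℕ) (c : PowerSumPoly K) :
    pairing a k (Polynomial.monomial j c) = a (k + j) * c := by
  simp [pairing, Polynomial.lsum]

theorem pairing_eq_sum (a : ℕ → PowerSumPoly K) (k M : ℕ) (P : Polynomial (PowerSumPoly K))
    (hM : P.natDegree < M) : pairing a k P = ∑ j ∈ Finset.range M, a (k + j) * P.coeff j := by
  conv_lhs => rw [P.as_sum_range' M hM]
  rw [map_sum]
  exact Finset.sum_congr rfl fun j _ => pairing_monomial a k j _

theorem pairing_mul_C (a : ℕ → PowerSumPoly K) (k : ℕ) (P : Polynomial (PowerSumPoly K))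
    (c : PowerSumPoly K) : pairing a k (P * Polynomial.C c) = pairing a k P * c := by
  induction P using Polynomial.induction_on' with
  | add p r hp hr => rw [add_mul, map_add, map_add, hp, hr, add_mul]
  | monomial n d => rw [Polynomial.monomial_mul_C, pairing_monomial, pairing_monomial, mul_assoc]

theorem pairing_mul_monomial (a : ℕ → PowerSumPoly K) (k n : ℕ)
    (P : Polynomial (PowerSumPoly K)) (c : PowerSumPoly K) :
    pairing a k (P * Polynomial.monomial n c) = pairing a (k + n) P * c := by
  induction P using Polynomial.induction_on' with
  | add p r hp hr => rw [add_mul, map_add, map_add, hp, hr, add_mul]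
  | monomial m d =>
    rw [Polynomial.monomial_mul_monomial, pairing_monomial, pairing_monomial, mul_assoc]
    congr 2
    ring

/-- The modes `f ↦ ∑ j, E_{k + j} * θ_j f` of a vertex operator, where `E = pexp b` and `θ` is the
translation by `v`. -/
def vertexOp (b v : ℕ → K) (k : ℕ) : PowerSumPoly K →ₗ[K] PowerSumPoly K :=
  (pairing (pexpCoeff b) k).comp (shiftHom v).toLinearMap

theorem vertexOp_apply (b v : ℕ → K) (k : ℕ) (f : PowerSumPoly K) :
    vertexOp b v k f = pairing (pexpCoeff b) k (shiftHom v f) := rfl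

theorem vertexOp_eq_sum (b v : ℕ → K) (k : ℕ) (f : PowerSumPoly K) (M : ℕ)
    (hM : (shiftHom v f).natDegree < M) : vertexOp b v k f =
      ∑ j ∈ Finset.range M, pexpCoeff b (k + j) * shiftCoeff v j f :=
  pairing_eq_sum _ _ _ _ hM

/-- The translation is multiplicative, and the term v_n y^n of the translated p_n shifts the mode
from k to k + n. This is the commutator of a mode with p_n, and it allows inductions on monomials.
-/
theorem vertexOp_mul_X (b v : ℕ → K) (k : ℕ) (f : PowerSumPoly K) (n : ℕ+) :
    vertexOp b v k (f * MvPolynomial.X n) = vertexOp b v k f * MvPolynomial.X n +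
      MvPolynomial.C (v n) * vertexOp b v (k + n) f := by
  rw [vertexOp_apply, map_mul, shiftHom_X, mul_add, map_add, pairing_mul_C, pairing_mul_monomial,
    vertexOp_apply, vertexOp_apply, mul_comm (MvPolynomial.C _)]

theorem vertexOp_one (b v : ℕ → K) (k : ℕ) : vertexOp b v k 1 = pexpCoeff b k := by
  rw [vertexOp_apply, map_one, ← Polynomial.monomial_zero_one, pairing_monomial]
  simp

theorem vertexOp_C_mul (b v : ℕ → K) (k : ℕ) (c : K) (f : PowerSumPoly K) :
    vertexOp b v k (MvPolynomial.C c * f) = MvPolynomial.C c * vertexOp b v k f := by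
  rw [← MvPolynomial.smul_eq_C_mul, map_smul, MvPolynomial.smul_eq_C_mul]

/-- Normal ordering: moving the translation past the second exponential costs the scalar series
`shiftFactor b' v`, and only j ≤ n survive. -/
theorem vertexOp_pexpCoeff (b v b' : ℕ → K) (k n : ℕ) :
    vertexOp b v k (pexpCoeff b' n) = ∑ j ∈ Finset.range (n + 1),
      MvPolynomial.C (PowerSeries.coeff j (shiftFactor b' v)) *
        (pexpCoeff b (k + j) * pexpCoeff b' (n - j)) := by
  have hdeg : (shiftHom v (pexpCoeff b' n)).natDegree < n + 1 := by
    rw [Nat.lt_succ_iff, Polynomial.natDegree_le_iff_coeff_eq_zero]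
    intro j hj
    rw [← shiftCoeff_apply, shiftCoeff_pexpCoeff, if_neg (by omega)]
  rw [vertexOp_eq_sum b v k _ _ hdeg]
  refine Finset.sum_congr rfl fun j hj => ?_
  rw [shiftCoeff_pexpCoeff, if_pos (by rw [Finset.mem_range] at hj; omega)]
  ring

/-- The chain rule for d/dy of f(p_n + v_n y^n). A polynomial involves finitely many p_n, so all
large truncations M of the sum over n agree. -/
theorem derivative_shiftHom (v : ℕ → K) (f : PowerSumPoly K) : ∃ M₀ : ℕ, ∀ M, M₀ ≤ M →
    Polynomial.derivative (shiftHom v f) = ∑ n ∈ Finset.range M,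
      Polynomial.monomial n (MvPolynomial.C ((n + 1) * v (n + 1))) *
        shiftHom v (MvPolynomial.pderiv n.succPNat f) := by
  induction f using MvPolynomial.induction_on with
  | C a => exact ⟨0, fun M _ => by simp⟩
  | add p r hp hr =>
    obtain ⟨a, ha⟩ := hp
    obtain ⟨b, hb⟩ := hr
    refine ⟨max a b, fun M hM => ?_⟩
    simp only [map_add, mul_add, Finset.sum_add_distrib]
    rw [← ha M (le_trans (le_max_left _ _) hM), ← hb M (le_trans (le_max_right _ _) hM)]
  | mul_X p m hp =>
    obtain ⟨a, ha⟩ := hp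
    refine ⟨max a m, fun M hM => ?_⟩
    have h1 := ha M (le_trans (le_max_left _ _) hM)
    have hm : (m : ℕ) ≤ M := le_trans (le_max_right _ _) hM
    have e : ∀ n : ℕ, shiftHom v (MvPolynomial.pderiv n.succPNat (p * MvPolynomial.X m)) =
        shiftHom v p * shiftHom v (MvPolynomial.pderiv n.succPNat (MvPolynomial.X m)) +
        shiftHom v (MvPolynomial.pderiv n.succPNat p) * shiftHom v (MvPolynomial.X m) := by
      intro n
      rw [Derivation.leibniz, smul_eq_mul, smul_eq_mul, map_add, map_mul, map_mul,
        mul_comm (shiftHom v (MvPolynomial.X m))]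
    have e2 : ∑ n ∈ Finset.range M, Polynomial.monomial n (MvPolynomial.C ((n + 1) * v (n + 1))) *
        shiftHom v (MvPolynomial.pderiv n.succPNat (MvPolynomial.X m)) =
        Polynomial.derivative (shiftHom v (MvPolynomial.X m)) := by
      have h2 : m.natPred + 1 = (m : ℕ) := PNat.natPred_add_one m
      rw [Finset.sum_eq_single (m.natPred)]
      · rw [PNat.succPNat_natPred, MvPolynomial.pderiv_X_self, map_one, shiftHom_X, map_add,
          Polynomial.derivative_C, zero_add, Polynomial.derivative_monomial, mul_one]
        have h3 : (m : ℕ) - 1 = m.natPred := by omega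
        have h4 : ((m.natPred : K) + 1) = (m : ℕ) := by
          rw [← h2, Nat.cast_succ]
        rw [h3, h4, h2, MvPolynomial.C_mul, mul_comm, map_natCast]
      · intro n _ hn
        rw [MvPolynomial.pderiv_X_of_ne, map_zero, mul_zero]
        rintro rfl
        exact hn (by simp)
      · intro h
        exact absurd (Finset.mem_range.mpr (by omega)) h
    rw [map_mul, Polynomial.derivative_mul, h1, ← e2, Finset.sum_mul, Finset.mul_sum,
      ← Finset.sum_add_distrib]
    refine Finset.sum_congr rfl fun n _ => ?_
    rw [e n]
    ring

/-- The recursion dual to `pexpCoeff_step`: multiplication by p_n is replaced by a multiple of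
∂/∂p_n. Matching the two recursions gives adjointness. -/
theorem shiftCoeff_step (v : ℕ → K) (i : ℕ) (f : PowerSumPoly K) :
    ((i : K) + 1) • shiftCoeff v (i + 1) f =
      ∑ x ∈ Finset.HasAntidiagonal.antidiagonal i, ((x.1 + 1 : K) * v (x.1 + 1)) •
        shiftCoeff v x.2 (MvPolynomial.pderiv x.1.succPNat f) := by
  obtain ⟨M₀, h⟩ := derivative_shiftHom v f
  have h1 := congrArg (fun P => Polynomial.coeff P i) (h (max M₀ (i + 1)) (le_max_left _ _))
  simp only [Polynomial.coeff_derivative, Polynomial.finsetSum_coeff] at h1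
  rw [Finset.Nat.sum_antidiagonal_eq_sum_range_succ_mk]
  have h2 : ((i : K) + 1) • shiftCoeff v (i + 1) f = (shiftHom v f).coeff (i + 1) * ((i : PowerSumPoly K) + 1) := by
    rw [shiftCoeff_apply, MvPolynomial.smul_eq_C_mul, mul_comm]
    simp
  rw [h2, h1, ← Finset.sum_subset (Finset.range_subset_range.mpr (le_max_right M₀ (i + 1)))]
  · refine Finset.sum_congr rfl fun n hn => ?_
    rw [Finset.mem_range] at hn
    have : i = i - n + n := by omega
    conv_lhs => rw [this]
    rw [mul_comm, Polynomial.coeff_mul_monomial, shiftCoeff_apply, MvPolynomial.smul_eq_C_mul, mul_comm]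
  · intro n _ hn
    rw [Finset.mem_range] at hn
    rw [← Polynomial.C_mul_X_pow_eq_monomial, mul_assoc, Polynomial.coeff_C_mul,
      mul_comm (Polynomial.X ^ n), Polynomial.coeff_mul_X_pow', if_neg (by omega), mul_zero]

end VertexOperators

/-! ### Scaling and constant terms of translations -/

section ShiftCoeff

variable {K : Type*} [Field K] [CharZero K]

theorem shiftCoeff_zero (v : ℕ → K) (f : PowerSumPoly K) : shiftCoeff v 0 f = f := by
  have h : ((Polynomial.aeval (0 : PowerSumPoly K)).restrictScalars K).comp (shiftHom v) =
      AlgHom.id K (PowerSumPoly K) := by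
    refine MvPolynomial.algHom_ext fun n => ?_
    simp [shiftHom_X, Polynomial.eval_monomial]
  rw [shiftCoeff_apply, Polynomial.coeff_zero_eq_eval_zero, ← Polynomial.coe_aeval_eq_eval]
  exact DFunLike.congr_fun h f

/-- Replacing v_n by r^n v_n amounts to substituting r y for y. -/
theorem shiftCoeff_scale (v v' : ℕ → K) (r : K) (h : ∀ n, 0 < n → v n = r ^ n * v' n) (j : ℕ)
    (f : PowerSumPoly K) : shiftCoeff v j f = r ^ j • shiftCoeff v' j f := by
  have h : shiftHom v = ((Polynomial.aeval (R := PowerSumPoly K)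
      (Polynomial.C (MvPolynomial.C r : PowerSumPoly K) * Polynomial.X : Polynomial (PowerSumPoly K))).restrictScalars
        K).comp (shiftHom v') := by
    refine MvPolynomial.algHom_ext fun n => ?_
    simp only [shiftHom_X, AlgHom.comp_apply, map_add, AlgHom.restrictScalars_apply,
      Polynomial.aeval_C, Polynomial.aeval_monomial, Polynomial.algebraMap_eq]
    rw [h n n.pos, ← Polynomial.C_mul_X_pow_eq_monomial, mul_pow]
    simp only [map_mul, map_pow]
    ring
  rw [shiftCoeff_apply, h]
  change (Polynomial.aeval (Polynomial.C (MvPolynomial.C r : PowerSumPoly K) * Polynomial.X) (shiftHom v' f)).coeff j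
    = _
  rw [shiftCoeff_apply, MvPolynomial.smul_eq_C_mul]
  generalize shiftHom v' f = P
  induction P using Polynomial.induction_on' with
  | add p s hp hs => rw [map_add, Polynomial.coeff_add, hp, hs, Polynomial.coeff_add, mul_add]
  | monomial n a =>
    rw [Polynomial.aeval_monomial, mul_pow, ← Polynomial.C_pow, Polynomial.algebraMap_eq,
      Polynomial.coeff_C_mul, Polynomial.coeff_C_mul, Polynomial.coeff_X_pow,
      Polynomial.coeff_monomial]
    by_cases hj : j = n
    · subst hj
      simp [mul_comm]
    · rw [if_neg hj, if_neg (Ne.symm hj)]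
      simp

/-- The weight of a monomial in the power sums. -/
def pweight : ℕ+ → ℕ := fun n => n

/-- Setting all p_j to 0 after the translation substitutes v_j y^j for p_j, and an f of weight n
then yields a single power y^n. -/
theorem constantCoeff_shiftCoeff (v : ℕ → K) (n : ℕ) (f : PowerSumPoly K)
    (hf : f.IsWeightedHomogeneous pweight n) :
    MvPolynomial.constantCoeff (shiftCoeff v n f) =
      MvPolynomial.aeval (fun j : ℕ+ => v j) f := by
  have h : (Polynomial.mapAlgHom (MvPolynomial.aeval (fun _ => (0 : K)))).comp (shiftHom v) =
      MvPolynomial.aeval (fun j : ℕ+ => Polynomial.monomial (j : ℕ) (v j)) := by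
    refine MvPolynomial.algHom_ext fun n => ?_
    simp [shiftHom_X]
  have h1 : MvPolynomial.constantCoeff (shiftCoeff v n f) =
      (MvPolynomial.aeval (fun j : ℕ+ => Polynomial.monomial (j : ℕ) (v j)) f).coeff n := by
    rw [← h]
    change _ = (Polynomial.map _ (shiftHom v f)).coeff n
    rw [Polynomial.coeff_map, shiftCoeff_apply]
    exact (MvPolynomial.aeval_zero' (shiftHom v f |>.coeff n)).symm
  rw [h1, MvPolynomial.aeval_def, MvPolynomial.aeval_def, MvPolynomial.eval₂_eq,
    MvPolynomial.eval₂_eq, Polynomial.finsetSum_coeff]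
  refine Finset.sum_congr rfl fun d hd => ?_
  have hw := hf (MvPolynomial.mem_support_iff.mp hd)
  have h2 : ∏ i ∈ d.support, (Polynomial.monomial (i : ℕ) (v i)) ^ d i =
      Polynomial.monomial n (∏ i ∈ d.support, v i ^ d i) := by
    rw [← hw, Finsupp.weight_apply, Finsupp.sum, ← Polynomial.C_mul_X_pow_eq_monomial,
      map_prod, ← Finset.prod_pow_eq_pow_sum, ← Finset.prod_mul_distrib]
    refine Finset.prod_congr rfl fun i _ => ?_
    rw [← Polynomial.C_mul_X_pow_eq_monomial, mul_pow, map_pow, ← pow_mul, smul_eq_mul, mul_comm (d i)]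
    rfl
  rw [h2]
  change (Polynomial.C _ * _ : Polynomial K).coeff n = _
  rw [Polynomial.coeff_C_mul, Polynomial.coeff_monomial, if_pos rfl]
  rfl

end ShiftCoeff

/-! ### Nonvanishing in ℚ(q, t) -/

section Parameters

theorem one_sub_monomial_ne_zero (a b : ℕ) (h : a + b ≠ 0) : 1 - q ^ a * t ^ b ≠ 0 := by
  have h1 : (1 - q ^ a * t ^ b : QT) = algebraMap (MvPolynomial (Fin 2) ℚ) QT
      (1 - MvPolynomial.X 0 ^ a * MvPolynomial.X 1 ^ b) := by
    simp [q, t]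
  rw [h1, Ne, FaithfulSMul.algebraMap_eq_zero_iff]
  intro h2
  -- At q = t = 2 the monomial takes the value 2^(a+b) > 1.
  have h3 := congrArg (MvPolynomial.eval fun _ => (2 : ℚ)) h2
  simp only [map_sub, map_one, map_mul, map_pow, MvPolynomial.eval_X, map_zero] at h3
  rw [← pow_add, sub_eq_zero] at h3
  have h4 : (1 : ℚ) < 2 ^ (a + b) := one_lt_pow₀ (by norm_num) h
  exact h4.ne h3

theorem one_sub_q_pow_ne_zero (n : ℕ) (h : n ≠ 0) : 1 - q ^ n ≠ 0 := by
  simpa using one_sub_monomial_ne_zero n 0 (by omega)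

theorem one_sub_t_pow_ne_zero (n : ℕ) (h : n ≠ 0) : 1 - t ^ n ≠ 0 := by
  simpa using one_sub_monomial_ne_zero 0 n (by omega)

theorem q_ne_zero : q ≠ 0 := by
  rw [q, Ne, FaithfulSMul.algebraMap_eq_zero_iff]
  exact MvPolynomial.X_ne_zero 0

theorem t_ne_zero : t ≠ 0 := by
  rw [t, Ne, FaithfulSMul.algebraMap_eq_zero_iff]
  exact MvPolynomial.X_ne_zero 1

/-- The scalar `(1 - q ^ n) / (1 - t ^ n)`. -/
def qtRatio (n : ℕ) : QT := (1 - q ^ n) / (1 - t ^ n)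

theorem qtRatio_ne_zero (n : ℕ) (h : n ≠ 0) : qtRatio n ≠ 0 :=
  div_ne_zero (one_sub_q_pow_ne_zero n h) (one_sub_t_pow_ne_zero n h)

end Parameters

/-! ### The Macdonald form and adjoint operators -/

section InnerProduct

theorem zqt_ne_zero (m : ℕ+ →₀ ℕ) : zqt m ≠ 0 := by
  refine Finset.prod_ne_zero_iff.mpr fun n _ => ?_
  refine mul_ne_zero (mul_ne_zero (pow_ne_zero _ (Nat.cast_ne_zero.mpr n.ne_zero))
    (Nat.cast_ne_zero.mpr (Nat.factorial_ne_zero _))) (pow_ne_zero _ (qtRatio_ne_zero n n.ne_zero))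

theorem zqt_add_single (m : ℕ+ →₀ ℕ) (n : ℕ+) :
    zqt (m + Finsupp.single n 1) = zqt m * ((n : QT) * (m n + 1 : QT) * qtRatio n) := by
  have key : ∀ m : ℕ+ →₀ ℕ, zqt m = ((n : QT) ^ m n * ((m n).factorial : QT) * qtRatio n ^ m n) *
      zqt (m.erase n) := fun m => (Finsupp.mul_prod_erase' m n _ (by intro i; simp)).symm
  have he : (m + Finsupp.single n 1).erase n = m.erase n := by
    rw [Finsupp.erase_add, Finsupp.erase_single, add_zero]
  rw [key (m + Finsupp.single n 1), he, key m, Finsupp.add_apply, Finsupp.single_eq_same, Nat.factorial_succ]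
  push_cast
  ring

/-- The Macdonald inner product on polynomials in the power sums. -/
def pinner (f g : PowerSumPoly QT) : QT :=
  ∑ m ∈ f.support, zqt m * f.coeff m * g.coeff m

theorem innerQT_eq (f g : Sym) :
    innerQT f g = pinner ((psumEquiv QT).symm f) ((psumEquiv QT).symm g) := rfl

theorem pinner_eq_sum (f g : PowerSumPoly QT) (s : Finset (ℕ+ →₀ ℕ)) (hs : f.support ⊆ s) :
    pinner f g = ∑ m ∈ s, zqt m * f.coeff m * g.coeff m := by
  refine Finset.sum_subset hs fun m _ hm => ?_
  rw [MvPolynomial.notMem_support_iff.mp hm, mul_zero, zero_mul]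

/-- The Macdonald inner product as a bilinear form. -/
def pform : LinearMap.BilinForm QT (PowerSumPoly QT) :=
  LinearMap.mk₂ QT pinner
    (fun f₁ f₂ g => by
      classical
      rw [pinner_eq_sum _ _ _ (MvPolynomial.support_add (p := f₁) (q := f₂)),
        pinner_eq_sum f₁ _ _ Finset.subset_union_left,
        pinner_eq_sum f₂ _ _ Finset.subset_union_right, ← Finset.sum_add_distrib]
      refine Finset.sum_congr rfl fun m _ => ?_
      rw [MvPolynomial.coeff_add]
      ring)
    (fun c f g => by
      rw [pinner_eq_sum _ _ _ (MvPolynomial.support_smul (a := c) (f := f)), pinner, smul_eq_mul,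
        Finset.mul_sum]
      refine Finset.sum_congr rfl fun m _ => ?_
      rw [MvPolynomial.coeff_smul, smul_eq_mul]
      ring)
    (fun f g₁ g₂ => by
      rw [pinner, pinner, pinner, ← Finset.sum_add_distrib]
      refine Finset.sum_congr rfl fun m _ => ?_
      rw [MvPolynomial.coeff_add]
      ring)
    (fun c f g => by
      rw [pinner, pinner, smul_eq_mul, Finset.mul_sum]
      refine Finset.sum_congr rfl fun m _ => ?_
      rw [MvPolynomial.coeff_smul, smul_eq_mul]
      ring)

theorem pform_apply (f g : PowerSumPoly QT) : pform f g = pinner f g := rfl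

theorem pform_symm (f g : PowerSumPoly QT) : pform f g = pform g f := by
  classical
  rw [pform_apply, pform_apply, pinner_eq_sum _ _ _ (Finset.subset_union_left (s₂ := g.support)),
    pinner_eq_sum g f _ (Finset.subset_union_right (s₁ := f.support))]
  refine Finset.sum_congr rfl fun m _ => ?_
  ring

theorem pform_monomial (m : ℕ+ →₀ ℕ) (a : QT) (g : PowerSumPoly QT) :
    pform (MvPolynomial.monomial m a) g = zqt m * a * g.coeff m := by
  classical
  rw [pform_apply, pinner_eq_sum _ _ _ MvPolynomial.support_monomial_subset, Finset.sum_singleton,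
    MvPolynomial.coeff_monomial, if_pos rfl]

theorem pform_one (g : PowerSumPoly QT) : pform 1 g = MvPolynomial.constantCoeff g := by
  rw [← MvPolynomial.C_1, MvPolynomial.C_apply, pform_monomial, zqt, Finsupp.prod_zero_index]
  simp [MvPolynomial.constantCoeff_eq]

/-- The adjoint of multiplication by p_n is n(1-q^n)/(1-t^n) ∂/∂p_n: raising a multiplicity m_n by
one multiplies z_λ(q,t) by exactly n(m_n + 1) times this ratio. -/
theorem pform_X_mul (n : ℕ+) (f g : PowerSumPoly QT) : pform (MvPolynomial.X n * f) g =
    (n * qtRatio n) * pform f (MvPolynomial.pderiv n g) := by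
  induction f using MvPolynomial.induction_on' with
  | add p r hp hr => rw [mul_add, map_add, map_add, LinearMap.add_apply, LinearMap.add_apply, hp, hr, mul_add]
  | monomial m a =>
    rw [mul_comm, MvPolynomial.X, MvPolynomial.monomial_mul, mul_one, pform_monomial,
      pform_monomial, zqt_add_single, MvPolynomial.coeff_pderiv]
    ring

theorem pform_pexpCoeff_mul (b v : ℕ → QT) (hv : ∀ n, 0 < n → v n = b n * qtRatio n) (i : ℕ)
    (f g : PowerSumPoly QT) :
    pform (pexpCoeff b i * f) g = pform f (shiftCoeff v i g) := by
  induction i using Nat.strong_induction_on generalizing g with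
  | _ i ih =>
  rcases i with _ | i
  · rw [pexpCoeff_zero, one_mul, shiftCoeff_zero]
  · have h0 : (i + 1 : QT) ≠ 0 := Nat.cast_add_one_ne_zero i
    apply mul_left_cancel₀ h0
    have h1 : (i + 1 : QT) * pform (pexpCoeff b (i + 1) * f) g =
        pform (((i : PowerSumPoly QT) + 1) * pexpCoeff b (i + 1) * f) g := by
      have : ((i : PowerSumPoly QT) + 1) * pexpCoeff b (i + 1) * f =
          (i + 1 : QT) • (pexpCoeff b (i + 1) * f) := by
        rw [MvPolynomial.smul_eq_C_mul, mul_assoc]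
        simp
      rw [this, map_smul, LinearMap.smul_apply, smul_eq_mul]
    have h2 : (i + 1 : QT) * pform f (shiftCoeff v (i + 1) g) =
        pform f ((i + 1 : QT) • shiftCoeff v (i + 1) g) := by
      rw [map_smul, smul_eq_mul]
    rw [h1, h2, pexpCoeff_step, shiftCoeff_step, Finset.sum_mul, map_sum, map_sum,
      LinearMap.sum_apply]
    refine Finset.sum_congr rfl fun x hx => ?_
    have hx' := Finset.HasAntidiagonal.mem_antidiagonal.mp hx
    have h3 : MvPolynomial.C (b (x.1 + 1)) * pvar QT (x.1 + 1) * pexpCoeff b x.2 * f =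
        b (x.1 + 1) • (MvPolynomial.X x.1.succPNat * (pexpCoeff b x.2 * f)) := by
      rw [MvPolynomial.smul_eq_C_mul]
      change _ * MvPolynomial.X x.1.succPNat * _ * _ = _
      ring
    rw [h3, map_smul, LinearMap.smul_apply, pform_X_mul, ih x.2 (by omega), map_smul, smul_eq_mul,
      smul_eq_mul, hv _ (Nat.succ_pos _), Nat.succPNat_coe]
    push_cast
    ring

/-- The hypothesis makes the adjoint of multiplication by E_j equal to r^j θ_j. Hence ⟨∑ E_j θ_j f,
g⟩ = ∑ r^j ⟨θ_j f, θ_j g⟩, which is symmetric in f and g. -/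
theorem pform_vertexOp_symm (b v : ℕ → QT) (r : QT)
    (h : ∀ n, 0 < n → b n * qtRatio n = r ^ n * v n) (f g : PowerSumPoly QT) :
    pform (vertexOp b v 0 f) g = pform f (vertexOp b v 0 g) := by
  have key : ∀ j f g, pform (pexpCoeff b j * f) g = r ^ j * pform f (shiftCoeff v j g) := by
    intro j f g
    rw [pform_pexpCoeff_mul b (fun n => b n * qtRatio n) (fun _ _ => rfl),
      shiftCoeff_scale _ v r h, map_smul, smul_eq_mul]
  set M := max (shiftHom v f).natDegree (shiftHom v g).natDegree + 1 with hM
  rw [vertexOp_eq_sum b v 0 f M (by omega), vertexOp_eq_sum b v 0 g M (by omega), map_sum, map_sum,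
    LinearMap.sum_apply]
  refine Finset.sum_congr rfl fun j _ => ?_
  rw [zero_add, key, pform_symm f, key, pform_symm]

/-- The reproducing property: pairing with an exponential of power sums is evaluation at p_j = v_j.
-/
theorem pform_pexpCoeff (b v : ℕ → QT) (hv : ∀ n, 0 < n → v n = b n * qtRatio n) (n : ℕ)
    (f : PowerSumPoly QT) (hf : f.IsWeightedHomogeneous pweight n) :
    pform (pexpCoeff b n) f = MvPolynomial.aeval (fun j : ℕ+ => v j) f := by
  rw [← mul_one (pexpCoeff b n), pform_pexpCoeff_mul b v hv, pform_one,
    constantCoeff_shiftCoeff v n f hf]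

end InnerProduct

/-- The modes of the Macdonald vertex operator with parameters `Q` and `s`. -/
def macOp {K : Type*} [Field K] [CharZero K] (Q s : K) (k : ℕ) :
    PowerSumPoly K →ₗ[K] PowerSumPoly K :=
  vertexOp (fun n => 1 - s ^ n) (fun n => -(1 - Q ^ n)) k

theorem pform_macOp (f g : PowerSumPoly QT) :
    pform (macOp q t⁻¹ 0 f) g = pform f (macOp q t⁻¹ 0 g) := by
  refine pform_vertexOp_symm _ _ t⁻¹ (fun n hn => ?_) f g
  have h1 := one_sub_t_pow_ne_zero n hn.ne'
  have h2 := pow_ne_zero n t_ne_zero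
  rw [qtRatio, inv_pow]
  field_simp
  ring

theorem pform_macOp_inv (f g : PowerSumPoly QT) :
    pform (macOp q⁻¹ t 0 f) g = pform f (macOp q⁻¹ t 0 g) := by
  refine pform_vertexOp_symm _ _ q (fun n hn => ?_) f g
  have h1 := one_sub_t_pow_ne_zero n hn.ne'
  have h2 := pow_ne_zero n q_ne_zero
  rw [qtRatio, inv_pow]
  field_simp
  ring


/-! ### Commutation relations of the two vertex operators -/

section Commutator

variable {K : Type*} [Field K] [CharZero K]

theorem one_sub_mul_mk_pow (c : K) : (1 - PowerSeries.C c * PowerSeries.X) *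
    PowerSeries.mk (fun n => c ^ n) = 1 := by
  ext n
  rw [sub_mul, one_mul, mul_assoc]
  rcases n with _ | n
  · simp
  · rw [map_sub, PowerSeries.coeff_C_mul, PowerSeries.coeff_succ_X_mul]
    simp [PowerSeries.coeff_one, pow_succ']

/-- Since -(1-S^n)(1-Q^n) = -1 + Q^n + S^n - (QS)^n, the series is (1-z)(1-QSz)/((1-Qz)(1-Sz)); the
formula is its partial fraction expansion. -/
theorem coeff_shiftFactor (Q S : K) (h : Q ≠ S) (j : ℕ) :
    PowerSeries.coeff j (shiftFactor (fun n => 1 - S ^ n) (fun n => -(1 - Q ^ n))) =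
      if j = 0 then 1 else (Q - 1) * (1 - S) / (Q - S) * (Q ^ j - S ^ j) := by
  set P := (Q - 1) * (1 - S) / (Q - S) with hP
  have hP' : P * (Q - S) = (Q - 1) * (1 - S) := div_mul_cancel₀ _ (sub_ne_zero.mpr h)
  set ψ : PowerSeries K := 1 + PowerSeries.C P *
    (PowerSeries.mk (fun n => Q ^ n) - PowerSeries.mk (fun n => S ^ n)) with hψ
  have h1 : (1 - PowerSeries.C Q * PowerSeries.X) * (1 - PowerSeries.C S * PowerSeries.X) * ψ =
      (1 - PowerSeries.C (1 : K) * PowerSeries.X) *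
        (1 - PowerSeries.C (Q * S) * PowerSeries.X) := by
    have hQ := one_sub_mul_mk_pow Q
    have hS := one_sub_mul_mk_pow S
    have hP2 := congrArg (PowerSeries.C (R := K)) hP'
    simp only [map_mul, map_sub, map_one] at hP2 ⊢
    linear_combination (PowerSeries.C P) * (1 - PowerSeries.C S * PowerSeries.X) * hQ -
      (PowerSeries.C P) * (1 - PowerSeries.C Q * PowerSeries.X) * hS + PowerSeries.X * hP2
  have h2 : (1 - PowerSeries.C Q * PowerSeries.X) * (1 - PowerSeries.C S * PowerSeries.X) *
      shiftFactor (fun n => 1 - S ^ n) (fun n => -(1 - Q ^ n)) =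
      (1 - PowerSeries.C (1 : K) * PowerSeries.X) *
        (1 - PowerSeries.C (Q * S) * PowerSeries.X) := by
    have e1 := ((isExpSeries_one_sub_mul Q).mul (isExpSeries_one_sub_mul S)).mul
      (expSeries_isExpSeries (K := K) fun n => (1 - S ^ n) * -(1 - Q ^ n))
    refine e1.unique K (((isExpSeries_one_sub_mul (1 : K)).mul
      (isExpSeries_one_sub_mul (Q * S))).congr fun n _ => ?_)
    rw [one_pow, mul_pow]
    ring
  have h3 : shiftFactor (fun n => 1 - S ^ n) (fun n => -(1 - Q ^ n)) = ψ := by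
    have hne : (1 - PowerSeries.C Q * PowerSeries.X) * (1 - PowerSeries.C S * PowerSeries.X) ≠ 0 :=
      mul_ne_zero (left_ne_zero_of_mul_eq_one (one_sub_mul_mk_pow Q))
        (left_ne_zero_of_mul_eq_one (one_sub_mul_mk_pow S))
    exact mul_left_cancel₀ hne (h2.trans h1.symm)
  rw [h3, hψ, map_add, PowerSeries.coeff_C_mul, PowerSeries.coeff_one]
  split_ifs with hj
  · subst hj; simp
  · simp

/-- The two orders of composition expand one rational function in opposite directions. Their
difference is therefore a sum over all k of P(q^{k-a} - t^{k-a}) A_k A'_{a+b-k}, of which the q-part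
is the asserted coefficient and the t-part vanishes. -/
theorem commutator_macOp_one (q t : K) (hq : q ≠ 0) (ht : t ≠ 0) (hqt : q ≠ t) (a b : ℕ)
    (hab : 0 < a + b) :
    macOp q t⁻¹ a (macOp q⁻¹ t b 1) - macOp q⁻¹ t b (macOp q t⁻¹ a 1) =
      MvPolynomial.C ((q - 1) * (1 - t) / (q - t) * q⁻¹ ^ a) *
        PowerSeries.coeff (a + b) (PowerSeries.rescale (MvPolynomial.C q)
          (pexp fun n => 1 - t⁻¹ ^ n) * pexp fun n => 1 - t ^ n) := by
  set A := pexpCoeff (fun n : ℕ => 1 - t⁻¹ ^ n) with hA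
  set A' := pexpCoeff (fun n : ℕ => 1 - t ^ n) with hA'
  set P := (q - 1) * (1 - t) / (q - t) with hP
  have hP' : (q⁻¹ - 1) * (1 - t⁻¹) / (q⁻¹ - t⁻¹) = -P := by
    have h1 : q - t ≠ 0 := sub_ne_zero.mpr hqt
    have h2 : t - q ≠ 0 := sub_ne_zero.mpr hqt.symm
    have h3 : q⁻¹ - t⁻¹ = (t - q) / (q * t) := by field_simp
    rw [h3, hP]
    field_simp
    ring
  -- After rescaling by t the two exponents cancel, t^n(1 - t^{-n}) + (1 - t^n) = 0, so the product
  -- of the exponentials is 1. Its coefficient in the positive degree a + b is 0.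
  have hone : ∑ x ∈ Finset.HasAntidiagonal.antidiagonal (a + b),
      MvPolynomial.C (t ^ x.1) * (A x.1 * A' x.2) = 0 := by
    have h1 : PowerSeries.rescale (MvPolynomial.C t) (pexp fun n => 1 - t⁻¹ ^ n) *
        (pexp fun n => 1 - t ^ n) = 1 := by
      refine (((pexp_isExpSeries fun n => 1 - t⁻¹ ^ n).rescale (MvPolynomial.C t)).mul
        (pexp_isExpSeries fun n => 1 - t ^ n)).unique K
        (isExpSeries_one.congr fun n _ => ?_)
      rw [← mul_assoc, ← map_pow, ← map_mul, ← add_mul, ← map_add]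
      have : t ^ n * (1 - t⁻¹ ^ n) + (1 - t ^ n) = 0 := by
        rw [inv_pow]; field_simp; ring
      rw [this, map_zero, zero_mul]
    have h2 := congrArg (PowerSeries.coeff (a + b)) h1
    rw [PowerSeries.coeff_mul, PowerSeries.coeff_one, if_neg hab.ne'] at h2
    rw [← h2]
    refine Finset.sum_congr rfl fun x _ => ?_
    rw [PowerSeries.coeff_rescale, map_pow, mul_assoc]
    rfl
  set F : ℕ → PowerSumPoly K := fun k =>
    MvPolynomial.C (P * (q ^ k * q⁻¹ ^ a - t ^ k * t⁻¹ ^ a)) * (A k * A' (a + b - k)) with hF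
  have hsum : MvPolynomial.C (P * q⁻¹ ^ a) *
        PowerSeries.coeff (a + b) (PowerSeries.rescale (MvPolynomial.C q)
          (pexp fun n => 1 - t⁻¹ ^ n) * pexp fun n => 1 - t ^ n) =
      ∑ k ∈ Finset.range (a + b + 1), F k := by
    have h2 : MvPolynomial.C (P * q⁻¹ ^ a) *
        PowerSeries.coeff (a + b) (PowerSeries.rescale (MvPolynomial.C q)
          (pexp fun n => 1 - t⁻¹ ^ n) * pexp fun n => 1 - t ^ n) =
        MvPolynomial.C (P * q⁻¹ ^ a) *
        PowerSeries.coeff (a + b) (PowerSeries.rescale (MvPolynomial.C q)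
          (pexp fun n => 1 - t⁻¹ ^ n) * pexp fun n => 1 - t ^ n) -
        MvPolynomial.C (P * t⁻¹ ^ a) * ∑ x ∈ Finset.HasAntidiagonal.antidiagonal (a + b),
          MvPolynomial.C (t ^ x.1) * (A x.1 * A' x.2) := by
      rw [hone, mul_zero, sub_zero]
    rw [h2, PowerSeries.coeff_mul, Finset.mul_sum, Finset.mul_sum, ← Finset.sum_sub_distrib,
      Finset.Nat.sum_antidiagonal_eq_sum_range_succ_mk]
    refine Finset.sum_congr rfl fun k _ => ?_
    rw [PowerSeries.coeff_rescale]
    change _ * (_ * A k * A' (a + b - k)) - _ = MvPolynomial.C _ * _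
    simp only [mul_sub, map_sub, map_mul, map_pow]
    ring
  have h1 : macOp q t⁻¹ a (macOp q⁻¹ t b 1) = A a * A' b + ∑ j ∈ Finset.range b, F (a + 1 + j) := by
    rw [macOp, macOp, vertexOp_one, vertexOp_pexpCoeff, Finset.sum_range_succ', add_comm,
      coeff_shiftFactor q t hqt, if_pos rfl, map_one, one_mul, add_zero, Nat.sub_zero]
    congr 1
    refine Finset.sum_congr rfl fun j hj => ?_
    rw [coeff_shiftFactor q t hqt, if_neg (Nat.succ_ne_zero j)]
    have e1 : a + (j + 1) = a + 1 + j := by ring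
    have e2 : b - (j + 1) = a + b - (a + 1 + j) := by omega
    have e3 : P * (q ^ (j + 1) - t ^ (j + 1)) =
        P * (q ^ (a + 1 + j) * q⁻¹ ^ a - t ^ (a + 1 + j) * t⁻¹ ^ a) := by
      have hqa : q ^ a * q⁻¹ ^ a = 1 := by rw [← mul_pow, mul_inv_cancel₀ hq, one_pow]
      have hta : t ^ a * t⁻¹ ^ a = 1 := by rw [← mul_pow, mul_inv_cancel₀ ht, one_pow]
      rw [← e1, pow_add q a, pow_add t a]
      linear_combination -P * q ^ (j + 1) * hqa + P * t ^ (j + 1) * hta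
    rw [hF, e1, e2, ← hP, e3]
  have h2 : macOp q⁻¹ t b (macOp q t⁻¹ a 1) = A a * A' b - ∑ j ∈ Finset.range a, F j := by
    rw [macOp, macOp, vertexOp_one, vertexOp_pexpCoeff, Finset.sum_range_succ', add_comm,
      coeff_shiftFactor q⁻¹ t⁻¹ (by simpa using hqt), if_pos rfl, map_one, one_mul, add_zero,
      Nat.sub_zero, sub_eq_add_neg, mul_comm (A a)]
    congr 1
    rw [← Finset.sum_range_reflect F, ← Finset.sum_neg_distrib]
    refine Finset.sum_congr rfl fun j hj => ?_
    rw [Finset.mem_range] at hj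
    rw [coeff_shiftFactor q⁻¹ t⁻¹ (by simpa using hqt), if_neg (Nat.succ_ne_zero j), hP']
    have e1 : a - 1 - j = a - (j + 1) := by omega
    have e2 : a + b - (a - (j + 1)) = b + (j + 1) := by omega
    have e3 : -P * (q⁻¹ ^ (j + 1) - t⁻¹ ^ (j + 1)) =
        -(P * (q ^ (a - (j + 1)) * q⁻¹ ^ a - t ^ (a - (j + 1)) * t⁻¹ ^ a)) := by
      have e4 : a = a - (j + 1) + (j + 1) := by omega
      have e5 : ∀ c : K, c ≠ 0 → c ^ (a - (j + 1)) * c⁻¹ ^ a = c⁻¹ ^ (j + 1) := by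
        intro c hc
        conv_lhs => rw [e4, pow_add c⁻¹, Nat.add_sub_cancel, ← mul_assoc, ← mul_pow,
          mul_inv_cancel₀ hc, one_pow, one_mul]
      rw [e5 q hq, e5 t ht]
      ring
    rw [hF, e1]
    dsimp only
    rw [e2, e3, map_neg]
    ring
  -- The first composition supplies the terms k > a and the second those with k < a, with A_a A'_b
  -- common to both; the missing middle term is zero anyway.
  have h3 : F a = 0 := by
    have hqa : q ^ a * q⁻¹ ^ a = 1 := by rw [← mul_pow, mul_inv_cancel₀ hq, one_pow]
    have hta : t ^ a * t⁻¹ ^ a = 1 := by rw [← mul_pow, mul_inv_cancel₀ ht, one_pow]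
    simp only [hF]
    rw [hqa, hta, sub_self, mul_zero, map_zero, zero_mul]
  have h4 : a + b + 1 = a + 1 + b := by ring
  rw [h1, h2, hsum, h4, Finset.sum_range_add, Finset.sum_range_succ, h3]
  ring

theorem macOp_mul_X (Q s : K) (k : ℕ) (f : PowerSumPoly K) (n : ℕ+) :
    macOp Q s k (f * MvPolynomial.X n) = macOp Q s k f * MvPolynomial.X n -
      MvPolynomial.C (1 - Q ^ (n : ℕ)) * macOp Q s (k + n) f := by
  rw [macOp, vertexOp_mul_X, macOp]
  simp only [map_neg]
  ring

/-- The commutator commutes with every p_n: passing p_n through it leaves contributions of the modes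
(a+n, b) and (a, b+n), which cancel because (1-q^n)q^{-n} + (1-q^{-n}) = 0. It is thus
multiplication by its value at 1. -/
theorem commutator_macOp (q t : K) (hq : q ≠ 0) (ht : t ≠ 0) (hqt : q ≠ t) (f : PowerSumPoly K)
    (a b : ℕ) (hab : 0 < a + b) :
    macOp q t⁻¹ a (macOp q⁻¹ t b f) - macOp q⁻¹ t b (macOp q t⁻¹ a f) =
      MvPolynomial.C ((q - 1) * (1 - t) / (q - t) * q⁻¹ ^ a) *
        PowerSeries.coeff (a + b) (PowerSeries.rescale (MvPolynomial.C q)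
          (pexp fun n => 1 - t⁻¹ ^ n) * pexp fun n => 1 - t ^ n) * f := by
  induction f using MvPolynomial.induction_on generalizing a b with
  | C c =>
    have h : (MvPolynomial.C c : PowerSumPoly K) = c • 1 := by
      rw [MvPolynomial.smul_eq_C_mul, mul_one]
    rw [h]
    simp only [map_smul]
    rw [← smul_sub, commutator_macOp_one q t hq ht hqt a b hab, mul_smul_comm, mul_one]
  | add p r hp hr =>
    simp only [map_add, mul_add]
    rw [← hp a b hab, ← hr a b hab]
    ring
  | mul_X p n hp =>
    have hC : ∀ (Q s : K) (k : ℕ) (c : K) (g : PowerSumPoly K),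
        macOp Q s k (MvPolynomial.C c * g) = MvPolynomial.C c * macOp Q s k g :=
      fun Q s k c g => vertexOp_C_mul _ _ k c g
    simp only [macOp_mul_X, LinearMap.map_sub, hC]
    have h1 := hp a b hab
    have h2 := hp (a + n) b (by omega)
    have h3 := hp a (b + n) (by omega)
    have e1 : a + (n : ℕ) + b = a + b + n := by ring
    have e2 : a + (b + (n : ℕ)) = a + b + n := by ring
    rw [e1] at h2
    rw [e2] at h3
    have hc : MvPolynomial.C (1 - q ^ (n : ℕ)) * MvPolynomial.C ((q - 1) * (1 - t) / (q - t) * q⁻¹ ^ (a + (n : ℕ))) +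
        MvPolynomial.C (1 - q⁻¹ ^ (n : ℕ)) * MvPolynomial.C ((q - 1) * (1 - t) / (q - t) * q⁻¹ ^ a)
        = (0 : PowerSumPoly K) := by
      rw [← map_mul, ← map_mul, ← map_add]
      have : (1 - q ^ (n : ℕ)) * ((q - 1) * (1 - t) / (q - t) * q⁻¹ ^ (a + (n : ℕ))) +
        (1 - q⁻¹ ^ (n : ℕ)) * ((q - 1) * (1 - t) / (q - t) * q⁻¹ ^ a) = 0 := by
        have h4 : q ^ (n : ℕ) * q⁻¹ ^ (n : ℕ) = 1 := by rw [← mul_pow, mul_inv_cancel₀ hq, one_pow]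
        rw [pow_add]
        linear_combination -((q - 1) * (1 - t) / (q - t) * q⁻¹ ^ a) * h4
      rw [this, map_zero]
    linear_combination (MvPolynomial.X n) * h1 - MvPolynomial.C (1 - q ^ (n : ℕ)) * h2 -
      MvPolynomial.C (1 - q⁻¹ ^ (n : ℕ)) * h3 - p * PowerSeries.coeff (a + b + n) (PowerSeries.rescale (MvPolynomial.C q)
          (pexp fun n => 1 - t⁻¹ ^ n) * pexp fun n => 1 - t ^ n) * hc

/-- As [D_0, p_1] = -(1-q) D_1, the double commutator is (1-q)[D_1, D*_0]. That is multiplication by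
a series coefficient of degree 1, hence by a multiple of p_1. -/
theorem double_commutator_macOp (q t : K) (hq : q ≠ 0) (ht : t ≠ 0) (hqt : q ≠ t)
    (f : PowerSumPoly K) :
    macOp q⁻¹ t 0 (macOp q t⁻¹ 0 (f * MvPolynomial.X 1) - macOp q t⁻¹ 0 f * MvPolynomial.X 1) -
      (macOp q t⁻¹ 0 (macOp q⁻¹ t 0 f * MvPolynomial.X 1) -
        macOp q t⁻¹ 0 (macOp q⁻¹ t 0 f) * MvPolynomial.X 1) =
      ((1 - q) * (1 - t⁻¹) * ((1 - q⁻¹) * (1 - t))) • (f * MvPolynomial.X 1) := by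
  have hC : ∀ (Q s : K) (k : ℕ) (c : K) (g : PowerSumPoly K),
      macOp Q s k (MvPolynomial.C c * g) = MvPolynomial.C c * macOp Q s k g :=
    fun Q s k c g => vertexOp_C_mul _ _ k c g
  have h := commutator_macOp q t hq ht hqt f 1 0 (by norm_num)
  have hB : PowerSeries.coeff (1 + 0) (PowerSeries.rescale (MvPolynomial.C q)
      (pexp fun n => 1 - t⁻¹ ^ n) * pexp fun n => 1 - t ^ n) =
      MvPolynomial.C (q * (1 - t⁻¹) + (1 - t)) * MvPolynomial.X 1 := by
    have h0 := fun b : ℕ → K => pexpCoeff_zero b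
    have h1 := fun b : ℕ → K => pexpCoeff_one b
    simp only [pexpCoeff] at h0 h1
    rw [PowerSeries.coeff_mul, add_zero, Finset.Nat.sum_antidiagonal_eq_sum_range_succ_mk]
    simp only [PowerSeries.coeff_rescale, Finset.sum_range_succ, Finset.sum_range_zero, h0, h1,
      Nat.sub_zero, Nat.sub_self, pow_zero, pow_one, map_add, map_mul]
    have : pvar K 1 = MvPolynomial.X 1 := pvar_coe 1
    rw [this]
    ring
  rw [hB] at h
  simp only [macOp_mul_X, LinearMap.map_sub, hC, PNat.one_coe, zero_add, pow_one] at h ⊢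
  have hc : (1 - q) * ((q - 1) * (1 - t) / (q - t) * q⁻¹ * (q * (1 - t⁻¹) + (1 - t))) =
      (1 - q) * (1 - t⁻¹) * ((1 - q⁻¹) * (1 - t)) := by
    have h1 : q - t ≠ 0 := sub_ne_zero.mpr hqt
    field_simp
    ring
  rw [← hc, MvPolynomial.smul_eq_C_mul]
  simp only [map_mul] at h ⊢
  linear_combination (MvPolynomial.C (1 - q)) * h

end Commutator

/-! ### A partial fraction identity -/

section PartialFractions

/-- Moving the s^N term to the left cancels the leading coefficients, leaving polynomials of degree
below N on both sides. They agree at the N distinct points 1/y_i. -/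
theorem prod_one_sub_partial_fractions {L : Type*} [Field L] {N : ℕ} (y : Fin N → L)
    (hy : Function.Injective y) (hy0 : ∀ i, y i ≠ 0) (s : L) (hs : s ≠ 0) :
    ∏ j, (1 - Polynomial.C (s * y j) * Polynomial.X) =
      Polynomial.C (s ^ N) * ∏ j, (1 - Polynomial.C (y j) * Polynomial.X) +
      ∑ i, Polynomial.C ((1 - s) * ∏ j ∈ Finset.univ.erase i, ((y i - s * y j) / (y i - y j))) *
        ∏ j ∈ Finset.univ.erase i, (1 - Polynomial.C (y j) * Polynomial.X) := by
  classical
  have hlin : ∀ c : L, c ≠ 0 → (1 - Polynomial.C c * Polynomial.X).degree = 1 ∧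
      (1 - Polynomial.C c * Polynomial.X).leadingCoeff = -c := by
    intro c hc
    have h : (1 - Polynomial.C c * Polynomial.X) =
        Polynomial.C (-c) * Polynomial.X + Polynomial.C 1 := by
      simp only [map_neg, map_one]; ring
    rw [h]
    exact ⟨Polynomial.degree_linear (neg_ne_zero.mpr hc),
      Polynomial.leadingCoeff_linear (neg_ne_zero.mpr hc)⟩
  have hsy : ∀ j, s * y j ≠ 0 := fun j => mul_ne_zero hs (hy0 j)
  have hsN : s ^ N ≠ 0 := pow_ne_zero N hs
  rw [← sub_eq_iff_eq_add']
  set p := ∏ j, (1 - Polynomial.C (s * y j) * Polynomial.X) with hp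
  have hpd : p.degree = N := by
    rw [hp, Polynomial.degree_prod, Finset.sum_congr rfl fun j _ => (hlin _ (hsy j)).1]
    simp
  have hpd' : (∏ j, (1 - Polynomial.C (y j) * Polynomial.X)).degree = (N : WithBot ℕ) := by
    rw [Polynomial.degree_prod, Finset.sum_congr rfl fun j _ => (hlin _ (hy0 j)).1]
    simp
  have hinv : Function.Injective fun i => (y i)⁻¹ := fun i j h => hy (inv_injective h)
  refine Polynomial.eq_of_degrees_lt_of_eval_index_eq Finset.univ (v := fun i => (y i)⁻¹)
    hinv.injOn ?_ ?_ ?_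
  · rw [Finset.card_univ, Fintype.card_fin, ← hpd]
    refine Polynomial.degree_sub_lt_left ?_ ?_ ?_
    · rw [hpd, Polynomial.degree_C_mul hsN, hpd']
    · intro h
      rw [h, Polynomial.degree_zero] at hpd
      exact absurd hpd (by simp)
    · rw [hp, Polynomial.leadingCoeff_mul, Polynomial.leadingCoeff_C, Polynomial.leadingCoeff_prod,
        Polynomial.leadingCoeff_prod, Finset.prod_congr rfl fun j _ => (hlin _ (hsy j)).2,
        Finset.prod_congr rfl fun j _ => (hlin _ (hy0 j)).2]
      have : s ^ N = ∏ _j : Fin N, s := by simp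
      rw [this, ← Finset.prod_mul_distrib]
      exact Finset.prod_congr rfl fun j _ => by ring
  · refine lt_of_le_of_lt (Polynomial.degree_sum_le _ _) ?_
    rw [Finset.sup_lt_iff (by rw [bot_lt_iff_ne_bot]; simp)]
    intro i _
    refine lt_of_le_of_lt ((Polynomial.degree_mul_le _ _).trans
      (add_le_of_nonpos_left Polynomial.degree_C_le)) ?_
    rw [Polynomial.degree_prod, Finset.sum_congr rfl fun j _ => (hlin _ (hy0 j)).1]
    simp only [Finset.sum_const, Finset.card_erase_of_mem (Finset.mem_univ i), Finset.card_univ,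
      Fintype.card_fin, nsmul_eq_mul, mul_one]
    have : N - 1 < N := by have := i.2; omega
    exact_mod_cast this
  · intro i _
    simp only [hp, Polynomial.eval_sub, Polynomial.eval_mul, Polynomial.eval_C,
      Polynomial.eval_prod, Polynomial.eval_finsetSum, Polynomial.eval_one, Polynomial.eval_X]
    have h0 : ∏ j, (1 - y j * (y i)⁻¹) = 0 :=
      Finset.prod_eq_zero (Finset.mem_univ i) (by rw [mul_inv_cancel₀ (hy0 i), sub_self])
    rw [h0, mul_zero, sub_zero, Finset.sum_eq_single i]
    · rw [← Finset.mul_prod_erase Finset.univ _ (Finset.mem_univ i), mul_assoc s,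
        mul_inv_cancel₀ (hy0 i), mul_one, mul_assoc, ← Finset.prod_mul_distrib]
      congr 1
      refine Finset.prod_congr rfl fun j hj => ?_
      have h1 := hy0 i
      have h2 : y i - y j ≠ 0 := sub_ne_zero.mpr fun h => Finset.ne_of_mem_erase hj (hy h).symm
      field_simp
    · intro j _ hj
      have h1 : ∏ x ∈ Finset.univ.erase j, (1 - y x * (y i)⁻¹) = 0 :=
        Finset.prod_eq_zero (Finset.mem_erase.mpr ⟨hj.symm, Finset.mem_univ i⟩)
          (by rw [mul_inv_cancel₀ (hy0 i), sub_self])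
      rw [h1, mul_zero]
    · intro h
      exact absurd (Finset.mem_univ i) h

end PartialFractions

/-! ### The Macdonald operator in finitely many variables -/

section FiniteVariables

variable {K : Type*} [Field K] [CharZero K]

/-- The evaluation of symmetric functions, as polynomials in power sums, at `N` variables. -/
def toVars (K : Type*) [CommRing K] (N : ℕ) : PowerSumPoly K →ₐ[K] MvPolynomial (Fin N) K :=
  MvPolynomial.aeval fun n => MvPolynomial.psum (Fin N) K n

theorem toVars_X (N : ℕ) (n : ℕ+) :
    toVars K N (MvPolynomial.X n) = ∑ i, MvPolynomial.X i ^ (n : ℕ) := by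
  rw [toVars, MvPolynomial.aeval_X, MvPolynomial.psum]

/-- The product `∏ a, ∏ b ≠ a, (x_a - c_a x_b)`. -/
def diffProd {N : ℕ} (c : Fin N → K) : MvPolynomial (Fin N) K :=
  ∏ a, ∏ b ∈ Finset.univ.erase a, (MvPolynomial.X a - MvPolynomial.C (c a) * MvPolynomial.X b)

/-- The coefficient, multiplied by the product of all differences, of the `q`-shift of `x_i` in the
Macdonald operator. -/
def macCoeff {N : ℕ} (s : K) (i : Fin N) : MvPolynomial (Fin N) K :=
  MvPolynomial.C (1 - s) * diffProd (Function.update 1 i s)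

/-- Divided by `diffProd 1`, `macCoeff s i` is Macdonald's coefficient (1-s)∏(x_i - s x_j)/(x_i -
x_j). Clearing this denominator keeps the operators inside the polynomial ring. -/
theorem algebraMap_macCoeff {N : ℕ} (s : K) (i : Fin N) (L : Type*) [Field L]
    [Algebra (MvPolynomial (Fin N) K) L] [FaithfulSMul (MvPolynomial (Fin N) K) L] :
    algebraMap (MvPolynomial (Fin N) K) L (macCoeff s i) = algebraMap (MvPolynomial (Fin N) K) L (diffProd (1 : Fin N → K)) *
      ((1 - algebraMap (MvPolynomial (Fin N) K) L (MvPolynomial.C s)) * ∏ j ∈ Finset.univ.erase i,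
        ((algebraMap (MvPolynomial (Fin N) K) L (MvPolynomial.X i) -
            algebraMap (MvPolynomial (Fin N) K) L (MvPolynomial.C s) * algebraMap (MvPolynomial (Fin N) K) L (MvPolynomial.X j)) /
          (algebraMap (MvPolynomial (Fin N) K) L (MvPolynomial.X i) - algebraMap (MvPolynomial (Fin N) K) L (MvPolynomial.X j)))) := by
  rw [macCoeff, diffProd, diffProd, ← Finset.mul_prod_erase Finset.univ _ (Finset.mem_univ i),
    ← Finset.mul_prod_erase Finset.univ _ (Finset.mem_univ i), Function.update_self]
  have h1 : ∏ a ∈ Finset.univ.erase i, ∏ b ∈ Finset.univ.erase a,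
      (MvPolynomial.X a - MvPolynomial.C ((Function.update 1 i s : Fin N → K) a) * MvPolynomial.X b) =
      ∏ a ∈ Finset.univ.erase i, ∏ b ∈ Finset.univ.erase a,
        (MvPolynomial.X a - MvPolynomial.C ((1 : Fin N → K) a) * MvPolynomial.X b) :=
    Finset.prod_congr rfl fun a ha => Finset.prod_congr rfl fun b _ => by
      rw [Function.update_of_ne (Finset.ne_of_mem_erase ha)]
  have h2 : ∏ b ∈ Finset.univ.erase i, (algebraMap (MvPolynomial (Fin N) K) L (MvPolynomial.X i) -
      algebraMap (MvPolynomial (Fin N) K) L (MvPolynomial.C s) * algebraMap (MvPolynomial (Fin N) K) L (MvPolynomial.X b)) =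
      (∏ b ∈ Finset.univ.erase i, (algebraMap (MvPolynomial (Fin N) K) L (MvPolynomial.X i) -
        algebraMap (MvPolynomial (Fin N) K) L (MvPolynomial.X b))) * ∏ j ∈ Finset.univ.erase i,
        ((algebraMap (MvPolynomial (Fin N) K) L (MvPolynomial.X i) -
            algebraMap (MvPolynomial (Fin N) K) L (MvPolynomial.C s) * algebraMap (MvPolynomial (Fin N) K) L (MvPolynomial.X j)) /
          (algebraMap (MvPolynomial (Fin N) K) L (MvPolynomial.X i) - algebraMap (MvPolynomial (Fin N) K) L (MvPolynomial.X j))) := by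
    rw [← Finset.prod_mul_distrib]
    refine Finset.prod_congr rfl fun b hb => (mul_div_cancel₀ _ ?_).symm
    rw [Ne, sub_eq_zero, (FaithfulSMul.algebraMap_injective _ L).eq_iff, MvPolynomial.X_inj]
    exact (Finset.ne_of_mem_erase hb).symm
  rw [h1]
  simp only [map_mul, map_prod, map_sub, map_one, Pi.one_apply, one_mul] at h2 ⊢
  rw [h2]
  ring

/-- In N variables the exponential is ∏ (1 - s x_j z)/(1 - x_j z). Its partial fractions have poles
at 1/x_i, contributing x_i^k, and the constant s^N, which is seen only at k = 0. -/
theorem diffProd_mul_toVars_pexpCoeff (N : ℕ) (s : K) (hs : s ≠ 0) (k : ℕ) :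
    diffProd 1 * toVars K N (pexpCoeff (fun n => 1 - s ^ n) k) =
      (∑ i, macCoeff s i * MvPolynomial.X i ^ k) +
        if k = 0 then MvPolynomial.C (s ^ N) * diffProd 1 else 0 := by
  set R := MvPolynomial (Fin N) K
  set L := FractionRing R
  set ι : R →+* L := algebraMap R L with hι
  have hinj : Function.Injective ι := FaithfulSMul.algebraMap_injective R L
  set y : Fin N → L := fun i => ι (MvPolynomial.X i) with hy
  have hyinj : Function.Injective y := hinj.comp (MvPolynomial.X_injective)
  have hy0 : ∀ i, y i ≠ 0 := fun i => by
    rw [hy]; simp only [Ne]; rw [map_eq_zero_iff ι hinj]; exact MvPolynomial.X_ne_zero i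
  set σ : L := ι (MvPolynomial.C s) with hσ
  have hσ0 : σ ≠ 0 := by
    rw [hσ, Ne, map_eq_zero_iff ι hinj, MvPolynomial.C_eq_zero]; exact hs
  set B : Fin N → L := fun i => (1 - σ) * ∏ j ∈ Finset.univ.erase i,
    ((y i - σ * y j) / (y i - y j)) with hB
  set F : PowerSeries L := PowerSeries.map (ι.comp (toVars K N).toRingHom)
    (pexp fun n => 1 - s ^ n) with hF
  set G : PowerSeries L := PowerSeries.C (σ ^ N) +
    ∑ i, PowerSeries.C (B i) * PowerSeries.mk fun n => y i ^ n with hG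
  have hone : ∀ c : L, Polynomial.coeToPowerSeries.ringHom (1 - Polynomial.C c * Polynomial.X) =
      1 - PowerSeries.C c * PowerSeries.X := by
    intro c
    rw [map_sub, map_one, map_mul]
    simp
  have hC : ∀ c : L, Polynomial.coeToPowerSeries.ringHom (Polynomial.C c) = PowerSeries.C c := by
    intro c; simp
  have hpf : ∏ j, (1 - PowerSeries.C (σ * y j) * PowerSeries.X) =
      PowerSeries.C (σ ^ N) * ∏ j, (1 - PowerSeries.C (y j) * PowerSeries.X) +
        ∑ i, PowerSeries.C (B i) *
          ∏ j ∈ Finset.univ.erase i, (1 - PowerSeries.C (y j) * PowerSeries.X) := by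
    have h := congrArg Polynomial.coeToPowerSeries.ringHom
      (prod_one_sub_partial_fractions y hyinj hy0 σ hσ0)
    rw [map_add, map_prod, map_mul, map_prod, map_sum, hC] at h
    refine (Finset.prod_congr rfl fun j _ => (hone _).symm).trans (h.trans ?_)
    congr 1
    · exact congrArg _ (Finset.prod_congr rfl fun j _ => hone _)
    · refine Finset.sum_congr rfl fun i _ => ?_
      rw [map_mul, hC, map_prod]
      exact congrArg _ (Finset.prod_congr rfl fun j _ => hone _)
  have hprod : (∏ j, (1 - PowerSeries.C (y j) * PowerSeries.X)) ≠ 0 :=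
    Finset.prod_ne_zero_iff.mpr fun j _ => left_ne_zero_of_mul_eq_one (one_sub_mul_mk_pow (y j))
  have hFG : F = G := by
    apply mul_left_cancel₀ hprod
    have h1 : (∏ j, (1 - PowerSeries.C (y j) * PowerSeries.X)) * G =
        ∏ j, (1 - PowerSeries.C (σ * y j) * PowerSeries.X) := by
      rw [hpf, hG, mul_add, Finset.mul_sum, mul_comm (PowerSeries.C (σ ^ N))]
      congr 1
      refine Finset.sum_congr rfl fun i _ => ?_
      rw [← Finset.mul_prod_erase Finset.univ _ (Finset.mem_univ i)]
      linear_combination (PowerSeries.C (B i)) * (∏ j ∈ Finset.univ.erase i,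
        (1 - PowerSeries.C (y j) * PowerSeries.X)) * one_sub_mul_mk_pow (y i)
    rw [h1]
    have e1 := (isExpSeries_prod Finset.univ _ _ fun j _ => isExpSeries_one_sub_mul (y j)).mul
      ((pexp_isExpSeries fun n => 1 - s ^ n).map (ι.comp (toVars K N).toRingHom))
    have e2 := isExpSeries_prod Finset.univ _ _ fun j (_ : j ∈ Finset.univ) =>
      isExpSeries_one_sub_mul (σ * y j)
    refine e1.unique K (e2.congr fun n hn => ?_)
    lift n to ℕ+ using hn
    have h3 : (ι.comp (toVars K N).toRingHom) (MvPolynomial.C (1 - s ^ (n : ℕ)) * pvar K n) =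
        (1 - σ ^ (n : ℕ)) * ∑ i, y i ^ (n : ℕ) := by
      rw [pvar_coe]
      change ι (toVars K N (MvPolynomial.C (1 - s ^ (n : ℕ)) * MvPolynomial.X n)) = _
      rw [map_mul, toVars_X, MvPolynomial.algHom_C, MvPolynomial.algebraMap_eq]
      simp [hσ, hy]
    rw [h3, Finset.mul_sum, ← Finset.sum_add_distrib]
    refine Finset.sum_congr rfl fun i _ => ?_
    rw [mul_pow]
    ring
  apply hinj
  have h4 := congrArg (PowerSeries.coeff k) hFG
  have h5 : PowerSeries.coeff k F = ι (toVars K N (pexpCoeff (fun n => 1 - s ^ n) k)) := by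
    rw [hF, PowerSeries.coeff_map]; rfl
  rw [map_mul, ← h5, h4, hG, map_add, map_sum, map_add, map_sum, mul_add, Finset.mul_sum, add_comm]
  congr 1
  · refine Finset.sum_congr rfl fun i _ => ?_
    rw [PowerSeries.coeff_C_mul, PowerSeries.coeff_mk, map_mul, map_pow, hι,
      algebraMap_macCoeff s i L, ← mul_assoc]
  · rw [PowerSeries.coeff_C]
    split_ifs
    · rw [map_mul, map_pow, map_pow, mul_comm]
    · simp

/-- The substitution `x_i ↦ Q * x_i`. -/
def scaleVar {N : ℕ} (Q : K) (i : Fin N) : MvPolynomial (Fin N) K →ₐ[K] MvPolynomial (Fin N) K :=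
  MvPolynomial.aeval (Function.update MvPolynomial.X i (MvPolynomial.C Q * MvPolynomial.X i))

/-- The Macdonald operator in finitely many variables, multiplied by the product of all
differences. -/
def macOpVars (N : ℕ) (Q s : K) (f : MvPolynomial (Fin N) K) : MvPolynomial (Fin N) K :=
  MvPolynomial.C (s ^ N) * diffProd 1 * f + ∑ i, macCoeff s i * scaleVar Q i f

/-- At y = x_i the translation p_n ↦ p_n - (1-Q^n) y^n is the substitution x_i ↦ Q x_i. So ∑ x_i^j
θ_j f is a Q-shift, and the coefficients E_j contribute exactly these powers of x_i. -/
theorem diffProd_mul_toVars_macOp (N : ℕ) (Q s : K) (hs : s ≠ 0) (f : PowerSumPoly K) :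
    diffProd 1 * toVars K N (macOp Q s 0 f) = macOpVars N Q s (toVars K N f) := by
  have h1 : ∀ i : Fin N, (((Polynomial.aeval (R := MvPolynomial (Fin N) K)
      (MvPolynomial.X i : MvPolynomial (Fin N) K)).restrictScalars K).comp
      (Polynomial.mapAlgHom (toVars K N))).comp (shiftHom fun n => -(1 - Q ^ n)) =
      (scaleVar Q i).comp (toVars K N) := by
    intro i
    refine MvPolynomial.algHom_ext fun n => ?_
    rw [AlgHom.comp_apply, AlgHom.comp_apply, AlgHom.comp_apply, shiftHom_X, toVars_X, map_sum,
      ← Finset.add_sum_erase Finset.univ _ (Finset.mem_univ i)]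
    have e : ∀ j ∈ Finset.univ.erase i, scaleVar Q i (MvPolynomial.X j ^ (n : ℕ)) =
        MvPolynomial.X j ^ (n : ℕ) := by
      intro j hj
      rw [map_pow, scaleVar, MvPolynomial.aeval_X,
        Function.update_of_ne (Finset.ne_of_mem_erase hj)]
    rw [Finset.sum_congr rfl e, map_pow, scaleVar, MvPolynomial.aeval_X, Function.update_self,
      map_add, Polynomial.coe_mapAlgHom, Polynomial.map_C, Polynomial.map_monomial]
    simp only [RingHom.coe_coe, toVars_X, MvPolynomial.algHom_C, map_add,
      AlgHom.restrictScalars_apply, Polynomial.aeval_C, Polynomial.aeval_monomial,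
      MvPolynomial.algebraMap_eq, Algebra.algebraMap_self_apply]
    rw [← Finset.add_sum_erase Finset.univ _ (Finset.mem_univ i)]
    simp only [map_neg, map_sub, map_one, map_pow]
    ring
  set M := (shiftHom (fun n => -(1 - Q ^ n)) f).natDegree + 1 with hM
  have h2 : ∀ i : Fin N, scaleVar Q i (toVars K N f) = ∑ j ∈ Finset.range M,
      MvPolynomial.X i ^ j * toVars K N (shiftCoeff (fun n => -(1 - Q ^ n)) j f) := by
    intro i
    have h := DFunLike.congr_fun (h1 i) f
    rw [AlgHom.comp_apply, AlgHom.comp_apply, AlgHom.comp_apply, AlgHom.restrictScalars_apply] at h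
    rw [← h, Polynomial.aeval_eq_sum_range' (n := M)]
    · refine Finset.sum_congr rfl fun j _ => ?_
      rw [Polynomial.coe_mapAlgHom, Polynomial.coeff_map, smul_eq_mul, mul_comm]
      rfl
    · exact lt_of_le_of_lt Polynomial.natDegree_map_le (by omega)
  rw [macOp, vertexOp_eq_sum _ _ _ _ M (by omega), map_sum, Finset.mul_sum, macOpVars]
  have h3 : ∀ j ∈ Finset.range M, diffProd 1 * toVars K N (pexpCoeff (fun n => 1 - s ^ n) (0 + j) *
      shiftCoeff (fun n => -(1 - Q ^ n)) j f) =
      (∑ i, macCoeff s i * (MvPolynomial.X i ^ j *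
        toVars K N (shiftCoeff (fun n => -(1 - Q ^ n)) j f))) +
      if j = 0 then MvPolynomial.C (s ^ N) * diffProd 1 * toVars K N f else 0 := by
    intro j _
    rw [map_mul, ← mul_assoc, zero_add, diffProd_mul_toVars_pexpCoeff N s hs, add_mul, Finset.sum_mul]
    congr 1
    · exact Finset.sum_congr rfl fun i _ => by ring
    · split_ifs with hj
      · rw [hj, shiftCoeff_zero]
      · rw [zero_mul]
  rw [Finset.sum_congr rfl h3, Finset.sum_add_distrib, Finset.sum_comm, add_comm]
  congr 1
  · simp [hM]
  · refine Finset.sum_congr rfl fun i _ => ?_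
    rw [h2, Finset.mul_sum]

end FiniteVariables

/-! ### Leading terms for the dominance order on exponents -/

section Dominance

variable {N : ℕ}

/-- The partial sum `e_0 + ... + e_{k-1}` of an exponent vector. -/
def partialSum (k : ℕ) (e : Fin N →₀ ℕ) : ℕ := ∑ i ∈ Finset.univ.filter fun i : Fin N => (i : ℕ) < k, e i

theorem partialSum_add (k : ℕ) (a b : Fin N →₀ ℕ) :
    partialSum k (a + b) = partialSum k a + partialSum k b :=
  Finset.sum_add_distrib

theorem partialSum_succ (i : Fin N) (e : Fin N →₀ ℕ) :
    partialSum (i + 1) e = partialSum i e + e i := by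
  have h : (Finset.univ.filter fun j : Fin N => (j : ℕ) < i + 1) =
      insert i (Finset.univ.filter fun j : Fin N => (j : ℕ) < i) := by
    ext j
    simp only [Finset.mem_filter, Finset.mem_univ, true_and, Finset.mem_insert, Fin.ext_iff]
    omega
  rw [partialSum, h, Finset.sum_insert (by simp), add_comm]
  rfl

theorem eq_of_partialSum {a b : Fin N →₀ ℕ} (h : ∀ k ≤ N, partialSum k a = partialSum k b) :
    a = b := by
  ext i
  have h1 := h (i + 1) i.2
  have h2 := h i i.2.le
  rw [partialSum_succ, partialSum_succ] at h1
  omega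

/-- The sum of all partial sums is strictly monotone for dominance, so an exponent maximising it is
maximal. -/
theorem exists_maximal_partialSum (s : Finset (Fin N →₀ ℕ)) (hs : s.Nonempty) :
    ∃ e ∈ s, ∀ b ∈ s, (∀ k, partialSum k e ≤ partialSum k b) → b = e := by
  obtain ⟨e, he, hmax⟩ := s.exists_max_image (fun e => ∑ k ∈ Finset.range (N + 1), partialSum k e) hs
  refine ⟨e, he, fun b hb hle => ?_⟩
  have h := (Finset.sum_eq_sum_iff_of_le fun k _ => hle k).mp
    (le_antisymm (Finset.sum_le_sum fun k _ => hle k) (hmax b hb))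
  exact (eq_of_partialSum fun k hk => h k (Finset.mem_range.mpr (by omega))).symm

variable {K : Type*} [Field K]

/-- All exponents of `f` are dominated by `κ`. -/
def DomBy (f : MvPolynomial (Fin N) K) (κ : Fin N →₀ ℕ) : Prop :=
  ∀ b ∈ f.support, ∀ k, partialSum k b ≤ partialSum k κ

/-- No exponent of `f` other than `e` dominates `e`. -/
def IsTop (f : MvPolynomial (Fin N) K) (e : Fin N →₀ ℕ) : Prop :=
  ∀ b ∈ f.support, (∀ k, partialSum k e ≤ partialSum k b) → b = e

theorem DomBy.isTop {f : MvPolynomial (Fin N) K} {κ : Fin N →₀ ℕ} (h : DomBy f κ) : IsTop f κ :=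
  fun b hb hle => eq_of_partialSum fun k _ => le_antisymm (h b hb k) (hle k)

theorem coeff_mul_of_isTop {f g : MvPolynomial (Fin N) K} {δ e : Fin N →₀ ℕ} (hf : DomBy f δ)
    (hg : IsTop g e) : (f * g).coeff (δ + e) = f.coeff δ * g.coeff e := by
  classical
  rw [MvPolynomial.coeff_mul, Finset.sum_eq_single (δ, e)]
  · intro x hx hne
    have hx' := Finset.HasAntidiagonal.mem_antidiagonal.mp hx
    by_contra h
    have h1 := hf x.1 (MvPolynomial.mem_support_iff.mpr (left_ne_zero_of_mul h))
    have h2 := hg x.2 (MvPolynomial.mem_support_iff.mpr (right_ne_zero_of_mul h)) fun k => by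
      have := congrArg (partialSum k) hx'
      rw [partialSum_add, partialSum_add] at this
      have := h1 k
      omega
    rw [h2] at hx'
    exact hne (Prod.ext (add_right_cancel hx') h2)
  · intro h
    exact absurd (by simp) h

theorem DomBy.mul {f g : MvPolynomial (Fin N) K} {δ κ : Fin N →₀ ℕ} (hf : DomBy f δ)
    (hg : DomBy g κ) : DomBy (f * g) (δ + κ) := by
  classical
  intro b hb k
  rw [MvPolynomial.mem_support_iff, MvPolynomial.coeff_mul] at hb
  obtain ⟨x, hx, hne⟩ := Finset.exists_ne_zero_of_sum_ne_zero hb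
  rw [← Finset.HasAntidiagonal.mem_antidiagonal.mp hx, partialSum_add, partialSum_add]
  exact add_le_add (hf _ (MvPolynomial.mem_support_iff.mpr (left_ne_zero_of_mul hne)) k)
    (hg _ (MvPolynomial.mem_support_iff.mpr (right_ne_zero_of_mul hne)) k)

theorem DomBy.add {f g : MvPolynomial (Fin N) K} {κ : Fin N →₀ ℕ} (hf : DomBy f κ)
    (hg : DomBy g κ) : DomBy (f + g) κ := by
  classical
  intro b hb
  rcases Finset.mem_union.mp (MvPolynomial.support_add hb) with h | h
  exacts [hf b h, hg b h]

theorem domBy_zero (κ : Fin N →₀ ℕ) : DomBy (0 : MvPolynomial (Fin N) K) κ := by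
  intro b hb
  simp at hb

theorem DomBy.sum {ι : Type*} (s : Finset ι) (f : ι → MvPolynomial (Fin N) K) {κ : Fin N →₀ ℕ}
    (h : ∀ i ∈ s, DomBy (f i) κ) : DomBy (∑ i ∈ s, f i) κ := by
  classical
  induction s using Finset.induction_on with
  | empty => exact domBy_zero κ
  | insert a s ha ih =>
    rw [Finset.sum_insert ha]
    exact (h a (Finset.mem_insert_self a s)).add (ih fun i hi => h i (Finset.mem_insert_of_mem hi))

theorem domBy_C (c : K) : DomBy (MvPolynomial.C c : MvPolynomial (Fin N) K) 0 := by
  classical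
  intro b hb k
  rw [MvPolynomial.mem_support_iff, MvPolynomial.coeff_C] at hb
  by_cases h : 0 = b
  · rw [h]
  · exact absurd (if_neg h) hb

theorem DomBy.prod {ι : Type*} (s : Finset ι) (f : ι → MvPolynomial (Fin N) K)
    (κ : ι → Fin N →₀ ℕ) (h : ∀ i ∈ s, DomBy (f i) (κ i)) :
    DomBy (∏ i ∈ s, f i) (∑ i ∈ s, κ i) ∧
      (∏ i ∈ s, f i).coeff (∑ i ∈ s, κ i) = ∏ i ∈ s, (f i).coeff (κ i) := by
  classical
  induction s using Finset.induction_on with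
  | empty =>
    rw [Finset.prod_empty, Finset.sum_empty, Finset.prod_empty]
    exact ⟨by simpa using domBy_C (N := N) (1 : K), by simp⟩
  | insert a s ha ih =>
    rw [Finset.prod_insert ha, Finset.sum_insert ha, Finset.prod_insert ha]
    have h1 := h a (Finset.mem_insert_self a s)
    obtain ⟨h2, h3⟩ := ih fun i hi => h i (Finset.mem_insert_of_mem hi)
    exact ⟨h1.mul h2, by rw [coeff_mul_of_isTop h1 h2.isTop, h3]⟩

/-- Among the exponents of g not dominated by κ a maximal one e is top in g, so δ + e cannot cancel
in the product. This is what permits dividing by `diffProd 1`. -/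
theorem DomBy.of_mul {f g : MvPolynomial (Fin N) K} {δ κ : Fin N →₀ ℕ} (hf : DomBy f δ)
    (hδ : f.coeff δ ≠ 0) (h : DomBy (f * g) (δ + κ)) : DomBy g κ := by
  classical
  by_contra hcon
  set s := g.support.filter fun b => ¬ ∀ k, partialSum k b ≤ partialSum k κ with hs
  have hne : s.Nonempty := by
    rw [DomBy] at hcon
    push Not at hcon
    obtain ⟨b, hb, k, hk⟩ := hcon
    exact ⟨b, Finset.mem_filter.mpr ⟨hb, fun h => absurd (h k) (by omega)⟩⟩
  obtain ⟨e, he, hmax⟩ := exists_maximal_partialSum s hne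
  rw [hs, Finset.mem_filter] at he
  have htop : IsTop g e := by
    intro b hb hle
    refine hmax b (Finset.mem_filter.mpr ⟨hb, fun h' => he.2 fun k => (hle k).trans (h' k)⟩) hle
  have h1 : (f * g).coeff (δ + e) ≠ 0 := by
    rw [coeff_mul_of_isTop hf htop]
    exact mul_ne_zero hδ (MvPolynomial.mem_support_iff.mp he.1)
  refine he.2 fun k => ?_
  have := h _ (MvPolynomial.mem_support_iff.mpr h1) k
  rw [partialSum_add, partialSum_add] at this
  omega

theorem partialSum_single (k : ℕ) (i : Fin N) :
    partialSum k (Finsupp.single i 1) = if (i : ℕ) < k then 1 else 0 := by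
  rw [partialSum]
  simp [Finsupp.single_apply]

theorem domBy_linear {a b : Fin N} (hab : a ≠ b) (c : K) :
    DomBy (MvPolynomial.X a - MvPolynomial.C c * MvPolynomial.X b : MvPolynomial (Fin N) K)
      (Finsupp.single (min a b) 1) ∧
    (MvPolynomial.X a - MvPolynomial.C c * MvPolynomial.X b : MvPolynomial (Fin N) K).coeff
      (Finsupp.single (min a b) 1) = if a < b then 1 else -c := by
  classical
  constructor
  · intro e he k
    have h : e = Finsupp.single a 1 ∨ e = Finsupp.single b 1 := by
      by_contra h
      push Not at h
      rw [MvPolynomial.mem_support_iff] at he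
      apply he
      rw [MvPolynomial.coeff_sub, MvPolynomial.coeff_C_mul, MvPolynomial.coeff_X, if_neg h.1.symm,
        MvPolynomial.coeff_X, if_neg h.2.symm]
      simp
    have h1 : ((min a b : Fin N) : ℕ) = min (a : ℕ) b := by
      rcases le_total a b with h | h
      · rw [min_eq_left h, min_eq_left (Fin.le_def.mp h)]
      · rw [min_eq_right h, min_eq_right (Fin.le_def.mp h)]
    rcases h with rfl | rfl <;> rw [partialSum_single, partialSum_single, h1] <;>
      split_ifs <;> omega
  · rw [MvPolynomial.coeff_sub, MvPolynomial.coeff_C_mul, MvPolynomial.coeff_X,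
      MvPolynomial.coeff_X]
    have hs : ∀ x y : Fin N, Finsupp.single x 1 = Finsupp.single y 1 ↔ x = y := fun x y =>
      Finsupp.single_left_inj one_ne_zero
    simp only [hs]
    rcases lt_or_gt_of_ne hab with h | h
    · rw [min_eq_left h.le, if_pos rfl, if_neg hab.symm, if_pos h]; ring
    · rw [min_eq_right h.le, if_neg hab, if_pos rfl, if_neg h.not_gt]; ring

/-- The leading exponent of the product of all differences. -/
def staircase (N : ℕ) : Fin N →₀ ℕ :=
  ∑ a : Fin N, ∑ b ∈ Finset.univ.erase a, Finsupp.single (min a b) 1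

theorem domBy_diffProd (c : Fin N → K) : DomBy (diffProd c) (staircase N) ∧
    (diffProd c).coeff (staircase N) =
      ∏ a, ∏ b ∈ Finset.univ.erase a, if a < b then 1 else -c a := by
  have h1 := fun a : Fin N => DomBy.prod (Finset.univ.erase a)
    (fun b => (MvPolynomial.X a - MvPolynomial.C (c a) * MvPolynomial.X b : MvPolynomial (Fin N) K))
    (fun b => Finsupp.single (min a b) 1)
    (fun b hb => (domBy_linear (Finset.ne_of_mem_erase hb).symm (c a)).1)
  have h2 := DomBy.prod Finset.univ _ _ fun a _ => (h1 a).1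
  refine ⟨h2.1, h2.2.trans (Finset.prod_congr rfl fun a _ => (h1 a).2.trans ?_)⟩
  exact Finset.prod_congr rfl fun b hb => (domBy_linear (Finset.ne_of_mem_erase hb).symm (c a)).2

/-- The leading coefficient of the product of all differences. -/
def staircaseCoeff (K : Type*) [Field K] (N : ℕ) : K :=
  (diffProd (1 : Fin N → K)).coeff (staircase N)

theorem staircaseCoeff_ne_zero : staircaseCoeff K N ≠ 0 := by
  rw [staircaseCoeff, (domBy_diffProd (1 : Fin N → K)).2]
  refine Finset.prod_ne_zero_iff.mpr fun a _ => Finset.prod_ne_zero_iff.mpr fun b _ => ?_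
  split_ifs <;> simp

/-- The leading monomial of x_i - s x_b is x_{min(i,b)}, so a factor s appears precisely for the i
indices b < i. -/
theorem domBy_macCoeff (s : K) (i : Fin N) : DomBy (macCoeff s i) (staircase N) ∧
    (macCoeff s i).coeff (staircase N) = staircaseCoeff K N * ((1 - s) * s ^ (i : ℕ)) := by
  have h := domBy_diffProd (Function.update 1 i s)
  constructor
  · have h1 := (domBy_C (1 - s)).mul h.1
    rwa [zero_add] at h1
  · rw [macCoeff, MvPolynomial.coeff_C_mul, h.2, staircaseCoeff, (domBy_diffProd 1).2,
      ← Finset.mul_prod_erase Finset.univ _ (Finset.mem_univ i),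
      ← Finset.mul_prod_erase Finset.univ _ (Finset.mem_univ i), Function.update_self]
    have h1 : ∏ a ∈ Finset.univ.erase i, ∏ b ∈ Finset.univ.erase a,
        (if a < b then 1 else -(Function.update 1 i s : Fin N → K) a) =
        ∏ a ∈ Finset.univ.erase i, ∏ b ∈ Finset.univ.erase a,
          (if a < b then 1 else -(1 : Fin N → K) a) :=
      Finset.prod_congr rfl fun a ha => by
        rw [Function.update_of_ne (Finset.ne_of_mem_erase ha)]
    have h2 : ∏ b ∈ Finset.univ.erase i, (if i < b then 1 else -s) = s ^ (i : ℕ) *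
        ∏ b ∈ Finset.univ.erase i, (if i < b then 1 else -(1 : Fin N → K) i) := by
      have h3 : s ^ (i : ℕ) = ∏ b ∈ Finset.univ.erase i, (if i < b then 1 else s) := by
        rw [Finset.prod_ite, Finset.prod_const_one, one_mul, Finset.prod_const]
        congr 1
        have : (Finset.univ.erase i).filter (fun b => ¬ i < b) = Finset.Iio i := by
          ext b
          simp only [Finset.mem_filter, Finset.mem_erase, Finset.mem_univ, Finset.mem_Iio, not_lt]
          exact ⟨fun h => lt_of_le_of_ne h.2 h.1.1, fun h => ⟨⟨h.ne, trivial⟩, h.le⟩⟩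
        rw [this, Fin.card_Iio]
      rw [h3, ← Finset.prod_mul_distrib]
      refine Finset.prod_congr rfl fun b _ => ?_
      split_ifs <;> simp
    rw [h1, h2]
    ring

theorem coeff_scaleVar (Q : K) (i : Fin N) (f : MvPolynomial (Fin N) K) (e : Fin N →₀ ℕ) :
    (scaleVar Q i f).coeff e = Q ^ e i * f.coeff e := by
  classical
  induction f using MvPolynomial.induction_on' with
  | add p r hp hr => rw [map_add, MvPolynomial.coeff_add, hp, hr, MvPolynomial.coeff_add, mul_add]
  | monomial m c =>
    have h : scaleVar Q i (MvPolynomial.monomial m c) =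
        MvPolynomial.C (Q ^ m i) * MvPolynomial.monomial m c := by
      rw [scaleVar, MvPolynomial.aeval_monomial, MvPolynomial.monomial_eq, Finsupp.prod_fintype,
        Finsupp.prod_fintype, ← Finset.mul_prod_erase Finset.univ _ (Finset.mem_univ i),
        ← Finset.mul_prod_erase Finset.univ (fun j => MvPolynomial.X j ^ m j) (Finset.mem_univ i),
        Function.update_self, mul_pow, MvPolynomial.algebraMap_eq, map_pow,
        Finset.prod_congr rfl fun j hj => by
          rw [Function.update_of_ne (Finset.ne_of_mem_erase hj)]]
      · ring
      · simp
      · simp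
    rw [h, MvPolynomial.coeff_C_mul, MvPolynomial.coeff_monomial]
    split_ifs with h
    · rw [h]
    · simp

/-- The eigenvalue of the Macdonald operator in `N` variables. -/
def macEigen (Q s : K) (e : Fin N →₀ ℕ) : K := s ^ N + (1 - s) * ∑ i : Fin N, s ^ (i : ℕ) * Q ^ e i

theorem support_scaleVar (Q : K) (i : Fin N) (f : MvPolynomial (Fin N) K) :
    (scaleVar Q i f).support ⊆ f.support := by
  intro b hb
  rw [MvPolynomial.mem_support_iff, coeff_scaleVar] at hb
  exact MvPolynomial.mem_support_iff.mpr (right_ne_zero_of_mul hb)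

theorem coeff_macOpVars (Q s : K) {f : MvPolynomial (Fin N) K} {e : Fin N →₀ ℕ} (h : IsTop f e) :
    (macOpVars N Q s f).coeff (staircase N + e) =
      staircaseCoeff K N * (macEigen Q s e * f.coeff e) := by
  have h1 : DomBy (MvPolynomial.C (s ^ N) * diffProd (1 : Fin N → K)) (staircase N) := by
    simpa using (domBy_C (s ^ N)).mul (domBy_diffProd (1 : Fin N → K)).1
  have h2 : ∀ i ∈ Finset.univ, (macCoeff s i * scaleVar Q i f).coeff (staircase N + e) =
      staircaseCoeff K N * ((1 - s) * (s ^ (i : ℕ) * Q ^ e i) * f.coeff e) := by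
    intro i _
    rw [coeff_mul_of_isTop (domBy_macCoeff s i).1 (fun b hb => h b (support_scaleVar Q i f hb)),
      (domBy_macCoeff s i).2, coeff_scaleVar]
    ring
  rw [macOpVars, MvPolynomial.coeff_add, coeff_mul_of_isTop h1 h, MvPolynomial.coeff_C_mul,
    MvPolynomial.coeff_sum, Finset.sum_congr rfl h2, ← Finset.mul_sum, ← Finset.sum_mul,
    ← Finset.mul_sum, macEigen, ← staircaseCoeff]
  ring

theorem DomBy.macOpVars {Q s : K} {f : MvPolynomial (Fin N) K} {κ : Fin N →₀ ℕ} (h : DomBy f κ) :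
    DomBy (macOpVars N Q s f) (staircase N + κ) := by
  have h1 : DomBy (MvPolynomial.C (s ^ N) * diffProd (1 : Fin N → K)) (staircase N) := by
    simpa using (domBy_C (s ^ N)).mul (domBy_diffProd (1 : Fin N → K)).1
  exact (h1.mul h).add (DomBy.sum _ _ fun i _ => (domBy_macCoeff s i).1.mul
    fun b hb => h b (support_scaleVar Q i f hb))

/-- Scaling a variable does not enlarge the support, and every coefficient of the operator has
leading exponent `staircase N`; dividing that leading term out leaves a triangular operator with
diagonal entries `macEigen`. -/
theorem domBy_of_diffProd_mul_eq_macOpVars {Q s : K} {f g : MvPolynomial (Fin N) K}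
    {κ : Fin N →₀ ℕ} (h : DomBy f κ) (hg : diffProd 1 * g = macOpVars N Q s f) :
    DomBy g κ ∧ g.coeff κ = macEigen Q s κ * f.coeff κ := by
  have h1 : DomBy g κ := (domBy_diffProd (1 : Fin N → K)).1.of_mul staircaseCoeff_ne_zero
    (hg ▸ h.macOpVars)
  refine ⟨h1, ?_⟩
  have h2 := coeff_macOpVars Q s h.isTop
  rw [← hg, coeff_mul_of_isTop (domBy_diffProd 1).1 h1.isTop] at h2
  exact mul_left_cancel₀ staircaseCoeff_ne_zero h2

/-- A top exponent of a nonzero f would have the eigenvalue of κ, hence equal κ, where f has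
coefficient 0. It gives uniqueness of eigenfunctions in a fixed number of variables. -/
theorem eq_zero_of_macOpVars_eq {Q s : K} {f : MvPolynomial (Fin N) K} {κ : Fin N →₀ ℕ}
    (h : macOpVars N Q s f = MvPolynomial.C (macEigen Q s κ) * (diffProd 1 * f))
    (hκ : f.coeff κ = 0) (hinj : ∀ e : Fin N →₀ ℕ, macEigen Q s e = macEigen Q s κ → e = κ) :
    f = 0 := by
  by_contra hf
  obtain ⟨e, he, htop⟩ := exists_maximal_partialSum f.support
    (MvPolynomial.support_nonempty.mpr hf)
  have h1 := coeff_macOpVars Q s (f := f) htop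
  rw [h, MvPolynomial.coeff_C_mul, coeff_mul_of_isTop (domBy_diffProd 1).1 htop,
    ← staircaseCoeff] at h1
  have hfe := MvPolynomial.mem_support_iff.mp he
  have h2 : macEigen Q s e = macEigen Q s κ := by
    have h3 : (macEigen Q s κ - macEigen Q s e) * (staircaseCoeff K N * f.coeff e) = 0 := by
      linear_combination h1
    exact (sub_eq_zero.mp ((mul_eq_zero.mp h3).resolve_right
      (mul_ne_zero staircaseCoeff_ne_zero hfe))).symm
  exact hfe (hinj e h2 ▸ hκ)

end Dominance

/-! ### Young diagrams, partitions and exponent vectors -/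

section Diagrams

theorem rowLen_ne_zero_iff (d : YoungDiagram) (i : ℕ) : d.rowLen i ≠ 0 ↔ i < d.colLen 0 := by
  rw [← YoungDiagram.mem_iff_lt_colLen, YoungDiagram.mem_iff_lt_rowLen, Nat.pos_iff_ne_zero]

theorem prod_cells {M : Type*} [CommMonoid M] (d : YoungDiagram) (N : ℕ) (hN : d.colLen 0 ≤ N)
    (F : ℕ × ℕ → M) : ∏ s ∈ d.cells, F s =
      ∏ i ∈ Finset.range N, ∏ j ∈ Finset.range (d.rowLen i), F (i, j) := by
  refine Finset.prod_finset_product _ _ _ fun p => ?_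
  rw [YoungDiagram.mem_cells, Finset.mem_range, Finset.mem_range, ← YoungDiagram.mem_iff_lt_rowLen]
  refine ⟨fun h => ⟨lt_of_lt_of_le ?_ hN, h⟩, fun h => h.2⟩
  rw [← YoungDiagram.mem_iff_lt_colLen]
  exact d.up_left_mem le_rfl (Nat.zero_le _) h

theorem sum_cells {M : Type*} [AddCommMonoid M] (d : YoungDiagram) (N : ℕ) (hN : d.colLen 0 ≤ N)
    (F : ℕ × ℕ → M) : ∑ s ∈ d.cells, F s =
      ∑ i ∈ Finset.range N, ∑ j ∈ Finset.range (d.rowLen i), F (i, j) :=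
  prod_cells (M := Multiplicative M) d N hN F

theorem sum_rowLen (d : YoungDiagram) (N : ℕ) (hN : d.colLen 0 ≤ N) :
    ∑ i ∈ Finset.range N, d.rowLen i = d.cells.card := by
  rw [Finset.card_eq_sum_ones, sum_cells d N hN]
  simp

theorem colLen_le_card (d : YoungDiagram) : d.colLen 0 ≤ d.cells.card := by
  rw [← sum_rowLen d _ le_rfl]
  calc d.colLen 0 = ∑ i ∈ Finset.range (d.colLen 0), 1 := by simp
    _ ≤ _ := Finset.sum_le_sum fun i hi => Nat.one_le_iff_ne_zero.mpr
      ((rowLen_ne_zero_iff d i).mpr (Finset.mem_range.mp hi))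

theorem youngDiagram_ext {d d' : YoungDiagram} (h : ∀ i, d.rowLen i = d'.rowLen i) : d = d' := by
  ext ⟨i, j⟩
  rw [YoungDiagram.mem_cells, YoungDiagram.mem_cells, YoungDiagram.mem_iff_lt_rowLen,
    YoungDiagram.mem_iff_lt_rowLen, h]

variable {n : ℕ}

theorem rowLens_diagram (lam : n.Partition) :
    (diagram lam).rowLens = lam.parts.sort (· ≥ ·) :=
  YoungDiagram.rowLens_ofRowLens_eq_self fun _ hx =>
    lam.parts_pos ((Multiset.mem_sort _).mp hx)

theorem parts_eq_rowLens (lam : n.Partition) : lam.parts = ((diagram lam).rowLens : Multiset ℕ) := by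
  rw [rowLens_diagram, Multiset.sort_eq]

theorem diagram_injective : Function.Injective (diagram (n := n)) := fun lam mu h =>
  Nat.Partition.ext (by rw [parts_eq_rowLens, parts_eq_rowLens, h])

theorem sum_rowLens (d : YoungDiagram) : (d.rowLens : Multiset ℕ).sum = d.cells.card := by
  rw [← sum_rowLen d _ le_rfl, Multiset.sum_coe, YoungDiagram.rowLens]
  rfl

theorem card_cells_diagram (lam : n.Partition) : (diagram lam).cells.card = n := by
  rw [← sum_rowLens, ← parts_eq_rowLens, lam.parts_sum]

theorem exists_diagram_eq (d : YoungDiagram) (h : d.cells.card = n) :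
    ∃ lam : n.Partition, diagram lam = d := by
  refine ⟨⟨d.rowLens, fun {i} hi => d.pos_of_mem_rowLens i hi, by rw [sum_rowLens, h]⟩, ?_⟩
  have h1 : (d.rowLens : Multiset ℕ).sort (· ≥ ·) = d.rowLens := by
    refine List.Perm.eq_of_sortedGE (Multiset.pairwise_sort _ _).sortedGE d.rowLens_sorted ?_
    exact Multiset.coe_eq_coe.mp (Multiset.sort_eq _ _)
  rw [diagram]
  simp only [h1]
  exact YoungDiagram.ofRowLens_to_rowLens_eq_self

/-- The row lengths of the diagram of a partition. -/
def rows (lam : n.Partition) : ℕ →₀ ℕ :=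
  Finsupp.onFinset (Finset.range ((diagram lam).colLen 0)) (diagram lam).rowLen fun i h =>
    Finset.mem_range.mpr ((rowLen_ne_zero_iff _ i).mp h)

theorem rows_apply (lam : n.Partition) (i : ℕ) : rows lam i = (diagram lam).rowLen i := rfl

theorem support_rows (lam : n.Partition) :
    (rows lam).support = Finset.range ((diagram lam).colLen 0) := by
  ext i
  rw [Finsupp.mem_support_iff, rows_apply, rowLen_ne_zero_iff, Finset.mem_range]

theorem map_rows (lam : n.Partition) : (rows lam).support.val.map (rows lam) = lam.parts := by
  rw [support_rows, parts_eq_rowLens]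
  rfl

theorem rows_injective : Function.Injective (rows (n := n)) := fun lam mu h =>
  Nat.Partition.ext (by rw [← map_rows, ← map_rows, h])

/-- Equal multisets give equal finite fibres over each nonzero value, and both fibres over 0 are
countably infinite; bijections of fibres glue to a permutation. -/
theorem exists_perm_of_map_eq {e e' : ℕ →₀ ℕ}
    (h : e.support.val.map e = e'.support.val.map e') :
    ∃ σ : Equiv.Perm ℕ, ∀ i, e' (σ i) = e i := by
  classical
  have hfin : ∀ (f : ℕ →₀ ℕ) (c : ℕ), c ≠ 0 → Finite {i // f i = c} := fun f c hc =>
    (f.support.finite_toSet.subset fun i (hi : f i = c) => by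
      rw [Finset.mem_coe, Finsupp.mem_support_iff, hi]; exact hc).to_subtype
  have hcard : ∀ (f : ℕ →₀ ℕ) (c : ℕ), c ≠ 0 →
      Nat.card {i // f i = c} = (f.support.val.map f).count c := by
    intro f c hc
    rw [Multiset.count_map, Nat.subtype_card (f.support.filter fun i => c = f i)]
    · rfl
    · intro i
      rw [Finset.mem_filter, Finsupp.mem_support_iff]
      exact ⟨fun h => h.2.symm, fun h => ⟨h ▸ hc, h.symm⟩⟩
  have hinf : ∀ f : ℕ →₀ ℕ, Infinite {i // f i = 0} := fun f => by
    have h0 : {i | f i = 0} = (f.support : Set ℕ)ᶜ := by ext i; simp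
    have h1 : {i | f i = 0}.Infinite := h0 ▸ f.support.finite_toSet.infinite_compl
    exact h1.to_subtype
  have hequiv : ∀ c, Nonempty ({i // e i = c} ≃ {i // e' i = c}) := by
    intro c
    by_cases hc : c = 0
    · subst hc
      have := hinf e
      have := hinf e'
      exact nonempty_equiv_of_countable
    · have := hfin e c hc
      have := hfin e' c hc
      exact Finite.card_eq.mp (by rw [hcard e c hc, hcard e' c hc, h])
  exact ⟨Equiv.ofFiberEquiv fun c => (hequiv c).some, fun i => Equiv.ofFiberEquiv_map _ i⟩

theorem sum_le_sum_range_of_antitone {f : ℕ → ℕ} (hf : Antitone f) (s : Finset ℕ) :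
    ∑ i ∈ s, f i ≤ ∑ i ∈ Finset.range s.card, f i := by
  induction s using Finset.induction_on_max with
  | empty => simp
  | insert a s ha ih =>
    have hnot : a ∉ s := fun h => (ha a h).false
    rw [Finset.sum_insert hnot, Finset.card_insert_of_notMem hnot, Finset.sum_range_succ, add_comm]
    refine add_le_add ih (hf ?_)
    calc s.card ≤ (Finset.range a).card :=
          Finset.card_le_card fun x hx => Finset.mem_range.mpr (ha x hx)
      _ = a := Finset.card_range a

/-- e is a rearrangement of the decreasing row lengths, and among index sets of a given size an
initial segment has the largest sum. This makes m_λ triangular for dominance on all exponents. -/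
theorem sum_le_sum_rowLen (lam : n.Partition) {e : ℕ →₀ ℕ}
    (h : e.support.val.map e = lam.parts) (s : Finset ℕ) :
    ∑ i ∈ s, e i ≤ ∑ i ∈ Finset.range s.card, (diagram lam).rowLen i := by
  obtain ⟨σ, hσ⟩ := exists_perm_of_map_eq (h.trans (map_rows lam).symm)
  have h1 := sum_le_sum_range_of_antitone (fun a b h => (diagram lam).rowLen_anti a b h)
    (s.map σ.toEmbedding)
  rw [Finset.sum_map, Finset.card_map] at h1
  refine le_trans (le_of_eq (Finset.sum_congr rfl fun i _ => ?_)) h1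
  exact (hσ i).symm

end Diagrams

/-! ### Expansion in monomial symmetric functions -/

section MonomialExpansion

variable {n : ℕ}

open Classical in
theorem coeff_msymm (R : Type*) [CommRing R] (lam : n.Partition) (e : ℕ →₀ ℕ) :
    MvPowerSeries.coeff e (msymm R lam : MvPowerSeries ℕ R) =
      if e.support.val.map e = lam.parts then 1 else 0 := rfl

theorem coeff_msymm_rows (R : Type*) [CommRing R] (lam mu : n.Partition) [Decidable (mu = lam)] :
    MvPowerSeries.coeff (rows mu) (msymm R lam : MvPowerSeries ℕ R) = if mu = lam then 1 else 0 := by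
  classical
  rw [coeff_msymm, map_rows]
  exact if_congr ⟨fun h => Nat.Partition.ext h, fun h => by rw [h]⟩ rfl rfl

variable {K : Type*} [Field K] [CharZero K]

theorem isHom_msymm (lam : n.Partition) : IsHom n (msymm K lam : MvPowerSeries ℕ K) := by
  classical
  intro e he
  rw [coeff_msymm] at he
  have h : e.support.val.map e = lam.parts := by
    by_contra h
    exact he (if_neg h)
  have := congrArg Multiset.sum h
  rw [lam.parts_sum] at this
  exact this

/-- Every exponent of degree n can be permuted to the row lengths of a partition, so symmetry
determines f by its coefficients there. -/
theorem eq_sum_msymm (f : SymFun K) (hf : IsHom n (f : MvPowerSeries ℕ K)) :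
    f = ∑ lam : n.Partition,
      MvPowerSeries.coeff (rows lam) (f : MvPowerSeries ℕ K) • msymm K lam := by
  classical
  apply Subtype.ext
  ext e
  rw [AddSubmonoidClass.coe_finsetSum, map_sum]
  have h1 : ∀ lam : n.Partition, MvPowerSeries.coeff e
      ((MvPowerSeries.coeff (rows lam) (f : MvPowerSeries ℕ K) • msymm K lam : SymFun K) :
        MvPowerSeries ℕ K) = MvPowerSeries.coeff (rows lam) (f : MvPowerSeries ℕ K) *
      if e.support.val.map e = lam.parts then 1 else 0 := by
    intro lam
    rw [← coeff_msymm, ← smul_eq_mul]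
    rfl
  rw [Finset.sum_congr rfl fun lam _ => h1 lam]
  by_cases he : e.degree = n
  · let mu : n.Partition := ⟨e.support.val.map e, fun {i} hi => by
      obtain ⟨x, hx, rfl⟩ := Multiset.mem_map.mp hi
      exact Nat.pos_of_ne_zero (Finsupp.mem_support_iff.mp hx), he⟩
    rw [Finset.sum_eq_single mu]
    · rw [if_pos rfl, mul_one]
      obtain ⟨σ, hσ⟩ := exists_perm_of_map_eq (map_rows mu : _ = e.support.val.map e)
      have h2 : (rows mu).embDomain σ.toEmbedding = e := by
        ext i
        obtain ⟨j, rfl⟩ := σ.surjective i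
        rw [hσ]
        exact Finsupp.embDomain_apply_self σ.toEmbedding _ j
      conv_lhs => rw [← h2]
      exact coeff_embDomain_of_mem_SymFun f.2 σ _
    · intro b _ hb
      rw [if_neg, mul_zero]
      intro h
      exact hb (Nat.Partition.ext h.symm)
    · intro h
      exact absurd (Finset.mem_univ _) h
  · rw [Finset.sum_eq_zero]
    · by_contra h
      exact he (hf e h)
    · intro lam _
      rw [if_neg, mul_zero]
      intro h
      have h2 := congrArg Multiset.sum h
      rw [lam.parts_sum] at h2
      exact he h2

theorem coeff_toVars (N : ℕ) (F : PowerSumPoly K) (e : Fin N →₀ ℕ) :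
    (toVars K N F).coeff e = MvPowerSeries.coeff (e.embDomain Fin.valEmbedding)
      (psumHom K F : MvPowerSeries ℕ K) := by
  have h : ((restr K N).comp (SymFun K).val).comp (psumHom K) =
      (MvPolynomial.coeToMvPowerSeries.algHom K).comp (toVars K N) := by
    refine MvPolynomial.algHom_ext fun m => ?_
    simp only [AlgHom.comp_apply, psumHom, MvPolynomial.aeval_X, toVars, Subalgebra.coe_val]
    rw [restr_psum]
    simp
  have h1 := congrArg (MvPowerSeries.coeff e) (DFunLike.congr_fun h F)
  simp only [AlgHom.comp_apply, Subalgebra.coe_val, restr, MvPowerSeries.coeff_killCompl] at h1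
  rw [h1]
  simp

/-- The row lengths of a partition as an exponent vector in `N` variables. -/
def rowsFin (N : ℕ) (lam : n.Partition) : Fin N →₀ ℕ :=
  Finsupp.equivFunOnFinite.symm fun i => (diagram lam).rowLen i

theorem rowsFin_apply (N : ℕ) (lam : n.Partition) (i : Fin N) :
    rowsFin N lam i = (diagram lam).rowLen i := rfl

theorem embDomain_rowsFin (N : ℕ) (lam : n.Partition) (h : (diagram lam).colLen 0 ≤ N) :
    (rowsFin N lam).embDomain Fin.valEmbedding = rows lam := by
  ext i
  by_cases hi : i < N
  · exact Finsupp.embDomain_apply_self Fin.valEmbedding (rowsFin N lam) ⟨i, hi⟩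
  · rw [Finsupp.embDomain_of_notMem_range]
    · by_contra h1
      exact hi (((rowLen_ne_zero_iff _ i).mp (Ne.symm h1)).trans_le h)
    · rintro ⟨j, rfl⟩
      exact hi j.2

theorem partialSum_eq_sum_range (N k : ℕ) (e : Fin N →₀ ℕ) :
    partialSum k e = ∑ i ∈ Finset.range (min k N), e.embDomain Fin.valEmbedding i := by
  have h : Finset.range (min k N) =
      (Finset.univ.filter fun i : Fin N => (i : ℕ) < k).map Fin.valEmbedding := by
    ext i
    simp only [Finset.mem_range, Finset.mem_map, Finset.mem_filter, Finset.mem_univ, true_and,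
      lt_min_iff]
    exact ⟨fun h => ⟨⟨i, h.2⟩, h.1, rfl⟩, by rintro ⟨j, hj, rfl⟩; exact ⟨hj, j.2⟩⟩
  rw [h, Finset.sum_map, partialSum]
  exact Finset.sum_congr rfl fun i _ => (Finsupp.embDomain_apply_self _ _ _).symm

theorem partialSum_rowsFin (N k : ℕ) (lam : n.Partition) :
    partialSum k (rowsFin N lam) = ∑ i ∈ Finset.range (min k N), (diagram lam).rowLen i := by
  rw [partialSum_eq_sum_range]
  refine Finset.sum_congr rfl fun i hi => ?_
  rw [Finset.mem_range, lt_min_iff] at hi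
  exact Finsupp.embDomain_apply_self Fin.valEmbedding (rowsFin N lam) ⟨i, hi.2⟩

theorem domLE_of_partialSum (N : ℕ) (hN : n ≤ N) (mu lam : n.Partition)
    (h : ∀ k, partialSum k (rowsFin N mu) ≤ partialSum k (rowsFin N lam)) : DomLE mu lam := by
  intro k
  have h1 : ∀ nu : n.Partition, ∑ i ∈ Finset.range k, (diagram nu).rowLen i =
      partialSum k (rowsFin N nu) := by
    intro nu
    rw [partialSum_rowsFin]
    rcases le_total k N with hk | hk
    · rw [min_eq_left hk]
    · rw [min_eq_right hk]
      have hc : (diagram nu).colLen 0 ≤ N :=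
        (colLen_le_card _).trans ((card_cells_diagram nu).le.trans hN)
      rw [sum_rowLen _ k (hc.trans hk), sum_rowLen _ N hc]
  rw [h1, h1]
  exact h k

/-- The monomial symmetric function as a polynomial in the power sums. -/
def pmono (K : Type*) [Field K] [CharZero K] (lam : n.Partition) : PowerSumPoly K :=
  (psumEquiv K).symm (msymm K lam)

theorem psumHom_pmono (lam : n.Partition) : psumHom K (pmono K lam) = msymm K lam :=
  (psumEquiv K).apply_symm_apply _

theorem domBy_toVars_pmono (N : ℕ) (lam : n.Partition) :
    DomBy (toVars K N (pmono K lam)) (rowsFin N lam) := by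
  classical
  intro b hb k
  rw [MvPolynomial.mem_support_iff, coeff_toVars, psumHom_pmono, coeff_msymm] at hb
  have h : (b.embDomain Fin.valEmbedding).support.val.map (b.embDomain Fin.valEmbedding) =
      lam.parts := by
    by_contra h
    exact hb (if_neg h)
  rw [partialSum_eq_sum_range, partialSum_rowsFin]
  have := sum_le_sum_rowLen lam h (Finset.range (min k N))
  rwa [Finset.card_range] at this

theorem coeff_toVars_pmono (N : ℕ) (lam mu : n.Partition) [Decidable (mu = lam)]
    (h : (diagram mu).colLen 0 ≤ N) :
    (toVars K N (pmono K lam)).coeff (rowsFin N mu) = if mu = lam then 1 else 0 := by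
  rw [coeff_toVars, psumHom_pmono, embDomain_rowsFin N mu h, coeff_msymm_rows]

end MonomialExpansion

/-! ### Gradings by degree and by weight -/

section Homogeneity

variable {K : Type*} [Field K] [CharZero K] {n : ℕ}

theorem weight_pweight (m : ℕ+ →₀ ℕ) :
    Finsupp.weight pweight m = m.sum fun n k => k * (n : ℕ) := by
  rw [Finsupp.weight_apply]
  rfl

theorem isHom_psumHom {F : PowerSumPoly K} (hF : F.IsWeightedHomogeneous pweight n) :
    IsHom n (psumHom K F : MvPowerSeries ℕ K) := by
  intro e he
  rw [F.as_sum, map_sum, AddSubmonoidClass.coe_finsetSum, map_sum] at he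
  obtain ⟨m, hm, hne⟩ := Finset.exists_ne_zero_of_sum_ne_zero he
  rw [isHom_monomial m _ e hne, ← weight_pweight]
  exact hF (MvPolynomial.mem_support_iff.mp hm)

theorem coeff_psumHom_weightedHomogeneousComponent (F : PowerSumPoly K) (e : ℕ →₀ ℕ) :
    MvPowerSeries.coeff e (psumHom K
      (MvPolynomial.weightedHomogeneousComponent pweight e.degree F) : MvPowerSeries ℕ K) =
      MvPowerSeries.coeff e (psumHom K F : MvPowerSeries ℕ K) := by
  classical
  induction F using MvPolynomial.induction_on' with
  | add p r hp hr => simp only [map_add, AddMemClass.coe_add, hp, hr]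
  | monomial m c =>
    by_cases h : Finsupp.weight pweight m = e.degree
    · rw [MvPolynomial.IsWeightedHomogeneous.weightedHomogeneousComponent_same
        (MvPolynomial.isWeightedHomogeneous_monomial _ _ _ h)]
    · rw [MvPolynomial.IsWeightedHomogeneous.weightedHomogeneousComponent_ne e.degree
        (MvPolynomial.isWeightedHomogeneous_monomial _ _ _ rfl) (fun h' => h h'.symm)]
      rw [map_zero, ZeroMemClass.coe_zero, map_zero]
      by_contra h'
      exact h ((weight_pweight m).trans (isHom_monomial m c e (Ne.symm h')).symm)

/-- The power sum map carries weight to degree, so F and its weight n component have the same image;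
the map is injective. -/
theorem isWeightedHomogeneous_of_isHom {F : PowerSumPoly K}
    (hF : IsHom n (psumHom K F : MvPowerSeries ℕ K)) : F.IsWeightedHomogeneous pweight n := by
  have h : F = MvPolynomial.weightedHomogeneousComponent pweight n F := by
    apply psumHom_injective
    apply Subtype.ext
    ext e
    by_cases he : e.degree = n
    · rw [← he, coeff_psumHom_weightedHomogeneousComponent]
    · have h1 : MvPowerSeries.coeff e (psumHom K F : MvPowerSeries ℕ K) = 0 := by
        by_contra h
        exact he (hF e h)
      have h2 := isHom_psumHom (MvPolynomial.weightedHomogeneousComponent_isWeightedHomogeneous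
        (w := pweight) n F)
      rw [h1]
      by_contra h
      exact he (h2 e (Ne.symm h))
  rw [h]
  exact MvPolynomial.weightedHomogeneousComponent_isWeightedHomogeneous (w := pweight) n F

theorem isWeightedHomogeneous_pmono (lam : n.Partition) :
    (pmono K lam).IsWeightedHomogeneous pweight n :=
  isWeightedHomogeneous_of_isHom (by rw [psumHom_pmono]; exact isHom_msymm lam)

theorem eq_sum_pmono {F : PowerSumPoly K} (hF : F.IsWeightedHomogeneous pweight n) :
    F = ∑ lam : n.Partition,
      MvPowerSeries.coeff (rows lam) (psumHom K F : MvPowerSeries ℕ K) • pmono K lam := by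
  apply psumHom_injective
  rw [map_sum]
  simp only [map_smul, psumHom_pmono]
  exact eq_sum_msymm _ (isHom_psumHom hF)

theorem isWeightedHomogeneous_pvar (n : ℕ) :
    (pvar K (n + 1)).IsWeightedHomogeneous pweight (n + 1) := by
  have h := MvPolynomial.isWeightedHomogeneous_X K pweight n.succPNat
  rw [pvar]
  exact h

theorem isWeightedHomogeneous_pexpCoeff (b : ℕ → K) (n : ℕ) :
    (pexpCoeff b n).IsWeightedHomogeneous pweight n := by
  induction n using Nat.strong_induction_on with
  | _ n ih =>
  rcases n with _ | n
  · rw [pexpCoeff_zero]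
    exact MvPolynomial.isWeightedHomogeneous_one K pweight
  · have h0 : (n + 1 : K) ≠ 0 := Nat.cast_add_one_ne_zero n
    have h : pexpCoeff b (n + 1) = MvPolynomial.C ((n + 1 : K)⁻¹) *
        (((n : PowerSumPoly K) + 1) * pexpCoeff b (n + 1)) := by
      have h1 : ((n : PowerSumPoly K) + 1) = MvPolynomial.C (n + 1 : K) := by simp
      rw [h1, ← mul_assoc, ← map_mul, inv_mul_cancel₀ h0, map_one, one_mul]
    rw [h, pexpCoeff_step, ← zero_add (n + 1)]
    refine (MvPolynomial.isWeightedHomogeneous_C _ _).mul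
      (MvPolynomial.IsWeightedHomogeneous.sum _ _ _ fun x hx => ?_)
    have hx' := Finset.HasAntidiagonal.mem_antidiagonal.mp hx
    have h2 : n + 1 = 0 + (x.1 + 1) + x.2 := by omega
    rw [h2]
    exact ((MvPolynomial.isWeightedHomogeneous_C _ _).mul (isWeightedHomogeneous_pvar x.1)).mul
      (ih x.2 (by omega))

theorem isWeightedHomogeneous_mul_X {F : PowerSumPoly K}
    (hF : F.IsWeightedHomogeneous pweight n) (j : ℕ+) :
    (F * MvPolynomial.X j).IsWeightedHomogeneous pweight (n + j) :=
  hF.mul (MvPolynomial.isWeightedHomogeneous_X K pweight j)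

theorem isWeightedHomogeneous_macOp (Q s : K) (k : ℕ) {F : PowerSumPoly K}
    (hF : F.IsWeightedHomogeneous pweight n) :
    (macOp Q s k F).IsWeightedHomogeneous pweight (k + n) := by
  -- All modes k are treated at once, because adding a factor p_j brings in the mode k + j.
  have key : ∀ (m : ℕ+ →₀ ℕ) (a : K), ∃ N,
      (MvPolynomial.monomial m a).IsWeightedHomogeneous pweight N ∧
      ∀ k, (macOp Q s k (MvPolynomial.monomial m a)).IsWeightedHomogeneous pweight (k + N) := by
    intro m a
    refine MvPolynomial.induction_on_monomial (motive := fun p : PowerSumPoly K =>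
      ∃ N, p.IsWeightedHomogeneous pweight N ∧
        ∀ k, (macOp Q s k p).IsWeightedHomogeneous pweight (k + N)) (fun a => ?_)
      (fun p j hp => ?_) m a
    · refine ⟨0, MvPolynomial.isWeightedHomogeneous_C _ _, fun k => ?_⟩
      rw [← mul_one (MvPolynomial.C a), macOp, vertexOp_C_mul, vertexOp_one, add_comm]
      exact (MvPolynomial.isWeightedHomogeneous_C _ _).mul (isWeightedHomogeneous_pexpCoeff _ k)
    · obtain ⟨N, h1, h2⟩ := hp
      refine ⟨N + j, isWeightedHomogeneous_mul_X h1 j, fun k => ?_⟩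
      rw [macOp_mul_X, sub_eq_add_neg, ← neg_mul, ← map_neg]
      refine MvPolynomial.IsWeightedHomogeneous.add ?_ ?_
      · rw [← add_assoc]
        exact isWeightedHomogeneous_mul_X (h2 k) j
      · have := (MvPolynomial.isWeightedHomogeneous_C pweight (-(1 - Q ^ (j : ℕ)))).mul (h2 (k + j))
        rwa [zero_add, add_right_comm, add_assoc] at this
  rw [F.as_sum, map_sum]
  refine MvPolynomial.IsWeightedHomogeneous.sum _ _ _ fun m hm => ?_
  obtain ⟨N, h1, h2⟩ := key m (F.coeff m)
  have hc := MvPolynomial.mem_support_iff.mp hm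
  have : N = n := by
    rw [← hF hc]
    exact (h1 (d := m) (by rwa [MvPolynomial.coeff_monomial, if_pos rfl])).symm
  exact this ▸ h2 k

theorem isWeightedHomogeneous_macOp_zero (Q s : K) {F : PowerSumPoly K}
    (hF : F.IsWeightedHomogeneous pweight n) :
    (macOp Q s 0 F).IsWeightedHomogeneous pweight n := by
  simpa using isWeightedHomogeneous_macOp Q s 0 hF

end Homogeneity

/-! ### Triangularity of the Macdonald operator -/

section Triangularity

variable {n : ℕ}

/-- The strict dominance order. -/
def DomLT (mu lam : n.Partition) : Prop := DomLE mu lam ∧ mu ≠ lam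

theorem DomLE.trans {a b c : n.Partition} (h : DomLE a b) (h' : DomLE b c) : DomLE a c :=
  fun k => (h k).trans (h' k)

theorem DomLE.antisymm {a b : n.Partition} (h : DomLE a b) (h' : DomLE b a) : a = b := by
  apply diagram_injective
  apply youngDiagram_ext
  intro i
  have h1 := le_antisymm (h i) (h' i)
  have h2 := le_antisymm (h (i + 1)) (h' (i + 1))
  rw [Finset.sum_range_succ, Finset.sum_range_succ] at h2
  omega

theorem DomLT.trans {a b c : n.Partition} (h : DomLT a b) (h' : DomLT b c) : DomLT a c :=
  ⟨h.1.trans h'.1, fun hac => h.2 (h.1.antisymm (hac ▸ h'.1))⟩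

theorem wellFounded_domLT : WellFounded (DomLT (n := n)) :=
  haveI : IsTrans n.Partition DomLT := ⟨fun _ _ _ => DomLT.trans⟩
  haveI : Std.Irrefl (DomLT (n := n)) := ⟨fun _ h => h.2 rfl⟩
  Finite.wellFounded_of_trans_of_irrefl _

/-- T - e_i maps the span U of the lower vectors onto U, because its diagonal entries e_j - e_i
there are nonzero. Subtracting from m_i a preimage of (T - e_i) m_i ∈ U gives the eigenvector. -/
theorem exists_eigenvector_of_triangular {K V ι : Type*} [Field K] [AddCommGroup V] [Module K V]
    {r : ι → ι → Prop} (hwf : WellFounded r) (htrans : ∀ {a b c}, r a b → r b c → r a c)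
    (m : ι → V) (e : ι → K) (T : V →ₗ[K] V)
    (hT : ∀ i, T (m i) - e i • m i ∈ Submodule.span K (m '' {j | r j i})) (i : ι)
    (he : ∀ j, r j i → e j ≠ e i) :
    ∃ p, p - m i ∈ Submodule.span K (m '' {j | r j i}) ∧ T p = e i • p := by
  set U := Submodule.span K (m '' {j | r j i}) with hU
  have key : ∀ j, r j i → ∃ z ∈ U, T z - e i • z = m j := by
    intro j
    induction j using hwf.induction with
    | _ j ih =>
    intro hj
    have h1 : ∀ y ∈ Submodule.span K (m '' {k | r k j}), ∃ z ∈ U, T z - e i • z = y := by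
      intro y hy
      induction hy using Submodule.span_induction with
      | mem x hx =>
        obtain ⟨k, hk, rfl⟩ := hx
        exact ih k hk (htrans hk hj)
      | zero => exact ⟨0, U.zero_mem, by simp⟩
      | add x y _ _ hx hy =>
        obtain ⟨a, ha, rfl⟩ := hx
        obtain ⟨b, hb, rfl⟩ := hy
        exact ⟨a + b, U.add_mem ha hb, by rw [map_add, smul_add]; abel⟩
      | smul c x _ hx =>
        obtain ⟨a, ha, rfl⟩ := hx
        exact ⟨c • a, U.smul_mem c ha, by rw [map_smul, smul_sub, smul_comm c]⟩
    obtain ⟨z, hz, hz'⟩ := h1 _ (hT j)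
    have hne : e j - e i ≠ 0 := sub_ne_zero.mpr (he j hj)
    refine ⟨(e j - e i)⁻¹ • (m j - z), U.smul_mem _ (U.sub_mem
      (Submodule.subset_span ⟨j, hj, rfl⟩) hz), ?_⟩
    have h2 : T (m j - z) - e i • (m j - z) = (e j - e i) • m j := by
      rw [map_sub, smul_sub, sub_smul, sub_sub_sub_comm, hz']
      abel
    rw [map_smul, smul_comm (e i), ← smul_sub, h2, smul_smul, inv_mul_cancel₀ hne, one_smul]
  have key2 : ∀ y ∈ U, ∃ z ∈ U, T z - e i • z = y := by
    intro y hy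
    induction hy using Submodule.span_induction with
    | mem x hx =>
      obtain ⟨k, hk, rfl⟩ := hx
      exact key k hk
    | zero => exact ⟨0, U.zero_mem, by simp⟩
    | add x y _ _ hx hy =>
      obtain ⟨a, ha, rfl⟩ := hx
      obtain ⟨b, hb, rfl⟩ := hy
      exact ⟨a + b, U.add_mem ha hb, by rw [map_add, smul_add]; abel⟩
    | smul c x _ hx =>
      obtain ⟨a, ha, rfl⟩ := hx
      exact ⟨c • a, U.smul_mem c ha, by rw [map_smul, smul_sub, smul_comm c]⟩
  obtain ⟨z, hz, hz'⟩ := key2 _ (hT i)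
  refine ⟨m i - z, by simpa using hz, ?_⟩
  rw [map_sub, smul_sub, sub_eq_sub_iff_sub_eq_sub, ← hz']

variable {K : Type*} [Field K] [CharZero K]

/-- The span of the monomial functions below `lam` in the dominance order. -/
def lowerSpan (K : Type*) [Field K] [CharZero K] (lam : n.Partition) :
    Submodule K (PowerSumPoly K) :=
  Submodule.span K (pmono K '' {mu | DomLT mu lam})

theorem colLen_diagram_le (lam : n.Partition) : (diagram lam).colLen 0 ≤ n :=
  (colLen_le_card _).trans (card_cells_diagram lam).le

/-- The eigenvalue of the Macdonald operator on the Macdonald function of `lam`. -/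
def eigenvalue (Q s : K) (d : YoungDiagram) : K :=
  1 - (1 - Q) * (1 - s) * ∑ c ∈ d.cells, Q ^ c.2 * s ^ c.1

/-- Summing the geometric series along rows and over the row index shows that the eigenvalue in N
variables does not depend on N. -/
theorem macEigen_rowsFin (Q s : K) (N : ℕ) (lam : n.Partition)
    (hN : (diagram lam).colLen 0 ≤ N) :
    macEigen Q s (rowsFin N lam) = eigenvalue Q s (diagram lam) := by
  have h1 : ∑ i : Fin N, s ^ (i : ℕ) * Q ^ rowsFin N lam i =
      ∑ i ∈ Finset.range N, s ^ i * Q ^ (diagram lam).rowLen i :=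
    Fin.sum_univ_eq_sum_range (fun i => s ^ i * Q ^ (diagram lam).rowLen i) N
  rw [macEigen, eigenvalue, h1, sum_cells _ N hN]
  have h2 : ∀ i, (1 - Q) * ∑ j ∈ Finset.range ((diagram lam).rowLen i), Q ^ j * s ^ i =
      s ^ i - s ^ i * Q ^ (diagram lam).rowLen i := fun i => by
    rw [← Finset.sum_mul, ← mul_assoc, mul_comm (1 - Q), geom_sum_mul_neg]
    ring
  have h3 : (1 - s) * ∑ i ∈ Finset.range N, s ^ i = 1 - s ^ N := by
    rw [mul_comm, geom_sum_mul_neg]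
  have h4 : (1 - Q) * ∑ i ∈ Finset.range N, ∑ j ∈ Finset.range ((diagram lam).rowLen i),
      Q ^ j * s ^ i = ∑ i ∈ Finset.range N, s ^ i -
        ∑ i ∈ Finset.range N, s ^ i * Q ^ (diagram lam).rowLen i := by
    rw [Finset.mul_sum, Finset.sum_congr rfl fun i _ => h2 i, Finset.sum_sub_distrib]
  linear_combination (1 - s) * h4 + h3

/-- n variables suffice: partitions of n have at most n rows, so the coefficients in the monomial
basis can be read off after restriction. -/
theorem macOp_pmono_sub_mem (Q s : K) (hs : s ≠ 0) (lam : n.Partition) :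
    macOp Q s 0 (pmono K lam) - eigenvalue Q s (diagram lam) • pmono K lam ∈ lowerSpan K lam := by
  classical
  set g := macOp Q s 0 (pmono K lam) with hg
  have hdom := domBy_of_diffProd_mul_eq_macOpVars (domBy_toVars_pmono n lam)
    (diffProd_mul_toVars_macOp n Q s hs (pmono K lam))
  rw [← hg, macEigen_rowsFin Q s n lam (colLen_diagram_le lam),
    coeff_toVars_pmono n lam lam (colLen_diagram_le lam), if_pos rfl, mul_one] at hdom
  have hcoeff : ∀ mu : n.Partition, MvPowerSeries.coeff (rows mu)
      (psumHom K g : MvPowerSeries ℕ K) = (toVars K n g).coeff (rowsFin n mu) := fun mu => by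
    rw [coeff_toVars, embDomain_rowsFin n mu (colLen_diagram_le mu)]
  have hsum := eq_sum_pmono (isWeightedHomogeneous_macOp_zero Q s (isWeightedHomogeneous_pmono lam))
  rw [← hg] at hsum
  rw [hsum, ← Finset.add_sum_erase _ _ (Finset.mem_univ lam), hcoeff, hdom.2, add_sub_cancel_left]
  refine Submodule.sum_mem _ fun mu hmu => ?_
  by_cases h : (toVars K n g).coeff (rowsFin n mu) = 0
  · rw [hcoeff, h, zero_smul]
    exact Submodule.zero_mem _
  · refine Submodule.smul_mem _ _ (Submodule.subset_span ⟨mu, ⟨?_, Finset.ne_of_mem_erase hmu⟩, rfl⟩)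
    exact domLE_of_partialSum n le_rfl mu lam fun k =>
      hdom.1 _ (MvPolynomial.mem_support_iff.mpr h) k

end Triangularity

/-! ### Distinctness of the eigenvalues -/

section Independence

/-- Comparison of the coefficients of q^a t^b, available in the fraction field once negative
exponents have been cleared. -/
theorem sum_coeff_eq {ι : Type*} (S : Finset ι) (c : ι → ℤ) (f g : ι → ℕ) (d : ℤ) (a b : ℕ)
    (h : ∑ i ∈ S, (c i : QT) * (q ^ f i * t ^ g i) = d * (q ^ a * t ^ b)) :
    ∑ i ∈ S, (if f i = a ∧ g i = b then c i else 0) = d := by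
  have h0 : ∀ (m : ℤ) (x y : ℕ), (m : QT) * (q ^ x * t ^ y) =
      algebraMap (MvPolynomial (Fin 2) ℚ) QT (MvPolynomial.monomial
        (Finsupp.single 0 x + Finsupp.single 1 y) (m : ℚ)) := by
    intro m x y
    rw [show MvPolynomial.monomial (Finsupp.single 0 x + Finsupp.single 1 y) (m : ℚ) =
      (m : MvPolynomial (Fin 2) ℚ) * (MvPolynomial.X 0 ^ x * MvPolynomial.X 1 ^ y) by
        rw [MvPolynomial.X_pow_eq_monomial, MvPolynomial.X_pow_eq_monomial,
          MvPolynomial.monomial_mul, one_mul, ← map_intCast (MvPolynomial.C (R := ℚ) (σ := Fin 2)) m,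
          MvPolynomial.C_mul_monomial, mul_one]]
    simp [q, t]
  rw [Finset.sum_congr rfl fun i _ => h0 _ _ _, h0, ← map_sum,
    (FaithfulSMul.algebraMap_injective (MvPolynomial (Fin 2) ℚ) QT).eq_iff] at h
  have h2 := congrArg (MvPolynomial.coeff (Finsupp.single 0 a + Finsupp.single 1 b)) h
  rw [MvPolynomial.coeff_sum] at h2
  have h3 : ∀ x y, (Finsupp.single (0 : Fin 2) x + Finsupp.single 1 y =
      Finsupp.single 0 a + Finsupp.single 1 b) ↔ (x = a ∧ y = b) := by
    refine fun x y => ⟨fun h => ⟨?_, ?_⟩, fun h => by rw [h.1, h.2]⟩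
    · simpa using DFunLike.congr_fun h 0
    · simpa using DFunLike.congr_fun h 1
  simp only [MvPolynomial.coeff_monomial, h3, if_true] at h2
  exact_mod_cast h2

theorem one_sub_inv_t_ne_zero : 1 - t⁻¹ ≠ 0 := by
  have h := one_sub_t_pow_ne_zero 1 one_ne_zero
  rw [pow_one] at h
  intro h'
  apply h
  rw [sub_eq_zero, eq_comm, inv_eq_one] at h'
  rw [h', sub_self]

theorem one_sub_inv_q_ne_zero : 1 - q⁻¹ ≠ 0 := by
  have h := one_sub_q_pow_ne_zero 1 one_ne_zero
  rw [pow_one] at h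
  intro h'
  apply h
  rw [sub_eq_zero, eq_comm, inv_eq_one] at h'
  rw [h', sub_self]

/-- The powers t^{-i} separate the entries, so each q^{e_i} can be read off. The exponents need not
be decreasing, which `eq_zero_of_macOpVars_eq` requires. -/
theorem macEigen_injective {N : ℕ} {e κ : Fin N →₀ ℕ}
    (h : macEigen q t⁻¹ e = macEigen q t⁻¹ κ) : e = κ := by
  rw [macEigen, macEigen, add_right_inj, mul_right_inj' one_sub_inv_t_ne_zero] at h
  have ht : ∀ (i : Fin N) (a : ℕ), t ^ N * (t⁻¹ ^ (i : ℕ) * q ^ a) = q ^ a * t ^ (N - i) := by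
    intro i a
    rw [← mul_assoc, inv_pow, ← pow_sub₀ _ t_ne_zero i.2.le, mul_comm]
  let c : Fin N ⊕ Fin N → ℤ := Sum.elim (fun _ => 1) (fun _ => -1)
  let f : Fin N ⊕ Fin N → ℕ := Sum.elim e κ
  let g : Fin N ⊕ Fin N → ℕ := Sum.elim (fun i => N - i.val) (fun i => N - i.val)
  have h1 : ∀ a b, ∑ x ∈ Finset.univ, (c x : QT) * (q ^ f x * t ^ g x) =
      ((0 : ℤ) : QT) * (q ^ a * t ^ b) := by
    intro a b
    rw [Fintype.sum_sum_type]
    simp only [c, f, g, Sum.elim_inl, Sum.elim_inr, ← ht, Int.cast_one, one_mul, Int.cast_neg,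
      neg_mul, Finset.sum_neg_distrib]
    rw [← Finset.mul_sum, ← Finset.mul_sum, h, add_neg_cancel, Int.cast_zero,
      zero_mul]
  ext i
  have h2 : (∑ j : Fin N, if e j = e i ∧ N - j.val = N - i.val then (1 : ℤ) else 0) +
      ∑ j : Fin N, (if κ j = e i ∧ N - j.val = N - i.val then (-1 : ℤ) else 0) = 0 := by
    have h3 := sum_coeff_eq _ _ _ _ _ _ _ (h1 (e i) (N - i))
    rw [Fintype.sum_sum_type] at h3
    exact h3
  rw [Finset.sum_eq_single i, Finset.sum_eq_single i] at h2
  · simp only [and_true, if_true] at h2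
    by_contra hne
    rw [if_neg (Ne.symm hne)] at h2
    exact absurd h2 (by norm_num)
  · intro j _ hj
    rw [if_neg]
    rintro ⟨-, h'⟩
    exact hj (Fin.ext (by omega))
  · simp
  · intro j _ hj
    rw [if_neg]
    rintro ⟨-, h'⟩
    exact hj (Fin.ext (by omega))
  · simp

theorem eigenvalue_injective {n : ℕ} {lam mu : n.Partition}
    (h : eigenvalue q t⁻¹ (diagram lam) = eigenvalue q t⁻¹ (diagram mu)) : lam = mu := by
  rw [← macEigen_rowsFin q t⁻¹ n lam (colLen_diagram_le lam),
    ← macEigen_rowsFin q t⁻¹ n mu (colLen_diagram_le mu)] at h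
  apply rows_injective
  rw [← embDomain_rowsFin n lam (colLen_diagram_le lam), macEigen_injective h,
    embDomain_rowsFin n mu (colLen_diagram_le mu)]

theorem eigenvalue_ne_one {n : ℕ} (hn : n ≠ 0) (lam : n.Partition) :
    eigenvalue q t⁻¹ (diagram lam) ≠ 1 := by
  intro h
  have h0 : macEigen q t⁻¹ (0 : Fin n →₀ ℕ) = 1 := by
    rw [macEigen]
    simp only [Finsupp.coe_zero, Pi.zero_apply, pow_zero, mul_one]
    rw [Fin.sum_univ_eq_sum_range (fun i => t⁻¹ ^ i) n, mul_comm, geom_sum_mul_neg]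
    ring
  have h1 : rowsFin n lam = 0 := macEigen_injective (by
    rw [macEigen_rowsFin q t⁻¹ n lam (colLen_diagram_le lam), h, h0])
  have h2 := sum_rowLen (diagram lam) n (colLen_diagram_le lam)
  rw [card_cells_diagram, ← Fin.sum_univ_eq_sum_range] at h2
  apply hn
  rw [← h2]
  exact Finset.sum_eq_zero fun i _ => DFunLike.congr_fun h1 i

end Independence

/-! ### The Macdonald basis and its eigenvector property -/

section MacdonaldBasis

variable {n : ℕ}

theorem coeff_rows_of_mem_lowerSpan {K : Type*} [Field K] [CharZero K] {lam : n.Partition}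
    {f : PowerSumPoly K} (hf : f ∈ lowerSpan K lam) :
    MvPowerSeries.coeff (rows lam) (psumHom K f : MvPowerSeries ℕ K) = 0 := by
  classical
  induction hf using Submodule.span_induction with
  | mem x hx =>
    obtain ⟨mu, hmu, rfl⟩ := hx
    rw [psumHom_pmono, coeff_msymm_rows, if_neg (Ne.symm hmu.2)]
  | zero => simp
  | add x y _ _ hx hy => rw [map_add, AddMemClass.coe_add, map_add, hx, hy, add_zero]
  | smul c x _ hx =>
    rw [map_smul]
    change MvPowerSeries.coeff (rows lam) (c • (psumHom K x : MvPowerSeries ℕ K)) = 0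
    rw [map_smul, hx, smul_zero]

theorem isWeightedHomogeneous_of_mem_lowerSpan {K : Type*} [Field K] [CharZero K]
    {lam : n.Partition} {f : PowerSumPoly K} (hf : f ∈ lowerSpan K lam) :
    f.IsWeightedHomogeneous pweight n := by
  have h : lowerSpan K lam ≤ MvPolynomial.weightedHomogeneousSubmodule K pweight n := by
    refine Submodule.span_le.mpr ?_
    rintro _ ⟨mu, -, rfl⟩
    exact isWeightedHomogeneous_pmono mu
  exact h hf

/-- A family of polynomials in the power sums that is triangular over the monomial functions and
orthogonal. -/
structure IsMacdonaldPoly (n : ℕ) (p : n.Partition → PowerSumPoly QT) : Prop where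
  triangular : ∀ lam, p lam - pmono QT lam ∈ lowerSpan QT lam
  orthogonal : ∀ lam mu, lam ≠ mu → pform (p lam) (p mu) = 0

theorem map_lowerSpan (lam : n.Partition) :
    (lowerSpan QT lam).map (psumEquiv QT).toLinearMap =
      Submodule.span QT {f : Sym | ∃ mu, DomLE mu lam ∧ mu ≠ lam ∧ f = msymm QT mu} := by
  rw [lowerSpan, Submodule.map_span]
  congr 1
  ext f
  constructor
  · rintro ⟨_, ⟨mu, hmu, rfl⟩, rfl⟩
    exact ⟨mu, hmu.1, hmu.2, (psumEquiv QT).apply_symm_apply _⟩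
  · rintro ⟨mu, h1, h2, rfl⟩
    exact ⟨_, ⟨mu, ⟨h1, h2⟩, rfl⟩, (psumEquiv QT).apply_symm_apply _⟩

theorem isMacdonald_iff (P : n.Partition → Sym) :
    IsMacdonald n P ↔ IsMacdonaldPoly n fun lam => (psumEquiv QT).symm (P lam) := by
  have key : ∀ lam, P lam - msymm QT lam ∈
      Submodule.span QT {f : Sym | ∃ mu, DomLE mu lam ∧ mu ≠ lam ∧ f = msymm QT mu} ↔
      (psumEquiv QT).symm (P lam) - pmono QT lam ∈ lowerSpan QT lam := by
    intro lam
    have h : P lam - msymm QT lam = (psumEquiv QT).toLinearMap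
        ((psumEquiv QT).symm (P lam) - pmono QT lam) := by
      simp [pmono]
    rw [← map_lowerSpan, h, Submodule.mem_map]
    exact ⟨fun ⟨y, hy, h⟩ => (psumEquiv QT).injective h ▸ hy, fun h => ⟨_, h, rfl⟩⟩
  exact ⟨fun h => ⟨fun lam => (key lam).mp (h.triangular lam), h.orthogonal⟩,
    fun h => ⟨fun lam => (key lam).mpr (h.triangular lam), h.orthogonal⟩⟩

/-- Take the triangular eigenvectors of D_0; a self-adjoint operator has orthogonal eigenvectors for
distinct eigenvalues. Existence is what gives the `Classical.epsilon` in `macdonaldP` its defining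
properties. -/
theorem exists_isMacdonaldPoly (n : ℕ) : ∃ p, IsMacdonaldPoly n p := by
  have h := fun lam : n.Partition => exists_eigenvector_of_triangular wellFounded_domLT DomLT.trans
    (pmono QT) (fun mu => eigenvalue q t⁻¹ (diagram mu)) (macOp q t⁻¹ 0)
    (macOp_pmono_sub_mem q t⁻¹ (inv_ne_zero t_ne_zero)) lam
    (fun mu hmu h => hmu.2 (eigenvalue_injective h))
  choose p hp hT using h
  refine ⟨p, hp, fun lam mu hne => ?_⟩
  have h1 := pform_macOp (p lam) (p mu)
  rw [hT, hT, map_smul, map_smul, LinearMap.smul_apply, smul_eq_mul, smul_eq_mul] at h1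
  by_contra h
  exact hne (eigenvalue_injective (mul_right_cancel₀ h h1))

/-- The Macdonald function of `lam` as a polynomial in the power sums. -/
def macPoly (lam : n.Partition) : PowerSumPoly QT := (psumEquiv QT).symm (macdonaldP n lam)

theorem isMacdonald_macdonaldP (n : ℕ) : IsMacdonald n (macdonaldP n) := by
  apply Classical.epsilon_spec (p := IsMacdonald n)
  obtain ⟨p, hp⟩ := exists_isMacdonaldPoly n
  refine ⟨fun lam => psumEquiv QT (p lam), (isMacdonald_iff _).mpr ?_⟩
  simpa using hp

theorem isMacdonaldPoly_macPoly (n : ℕ) : IsMacdonaldPoly n (macPoly (n := n)) :=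
  (isMacdonald_iff _).mp (isMacdonald_macdonaldP n)

theorem coeff_rows_macPoly (lam : n.Partition) :
    MvPowerSeries.coeff (rows lam) (psumHom QT (macPoly lam) : MvPowerSeries ℕ QT) = 1 := by
  classical
  have h := coeff_rows_of_mem_lowerSpan ((isMacdonaldPoly_macPoly n).triangular lam)
  rwa [map_sub, AddSubgroupClass.coe_sub, map_sub, psumHom_pmono, coeff_msymm_rows, if_pos rfl,
    sub_eq_zero] at h

theorem macPoly_ne_zero (lam : n.Partition) : macPoly lam ≠ 0 := by
  intro h
  have h1 := coeff_rows_macPoly lam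
  rw [h, map_zero] at h1
  simp at h1

theorem isWeightedHomogeneous_macPoly (lam : n.Partition) :
    (macPoly lam).IsWeightedHomogeneous pweight n := by
  have h := (isWeightedHomogeneous_of_mem_lowerSpan
    ((isMacdonaldPoly_macPoly n).triangular lam)).add (isWeightedHomogeneous_pmono lam)
  rwa [sub_add_cancel] at h

theorem pmono_mem_span_macPoly (lam : n.Partition) :
    pmono QT lam ∈ Submodule.span QT (macPoly '' {mu | DomLE mu lam}) := by
  induction lam using wellFounded_domLT.induction with
  | _ lam ih =>
  have h : pmono QT lam = macPoly lam - (macPoly lam - pmono QT lam) := by abel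
  rw [h]
  refine Submodule.sub_mem _ (Submodule.subset_span ⟨lam, fun _ => le_rfl, rfl⟩) ?_
  have h1 : lowerSpan QT lam ≤ Submodule.span QT (macPoly '' {mu | DomLE mu lam}) := by
    refine Submodule.span_le.mpr ?_
    rintro _ ⟨mu, hmu, rfl⟩
    exact Submodule.span_mono (Set.image_mono fun nu hnu => DomLE.trans hnu hmu.1) (ih mu hmu)
  exact h1 ((isMacdonaldPoly_macPoly n).triangular lam)

theorem lowerSpan_le_span_macPoly (lam : n.Partition) :
    lowerSpan QT lam ≤ Submodule.span QT (macPoly '' {mu | DomLT mu lam}) := by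
  refine Submodule.span_le.mpr ?_
  rintro _ ⟨mu, hmu, rfl⟩
  refine Submodule.span_mono (Set.image_mono fun nu hnu => ?_) (pmono_mem_span_macPoly mu)
  exact ⟨DomLE.trans hnu hmu.1, fun h => hmu.2 (hmu.1.antisymm (h ▸ hnu))⟩

theorem pform_eq_zero_of_mem_lowerSpan {lam mu : n.Partition} (h : ¬ DomLT mu lam)
    {f : PowerSumPoly QT} (hf : f ∈ lowerSpan QT lam) : pform f (macPoly mu) = 0 := by
  have hf' := lowerSpan_le_span_macPoly lam hf
  clear hf
  induction hf' using Submodule.span_induction with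
  | mem x hx =>
    obtain ⟨nu, hnu, rfl⟩ := hx
    exact (isMacdonaldPoly_macPoly n).orthogonal nu mu fun h' => h (h' ▸ hnu)
  | zero => simp
  | add x y _ _ hx hy => rw [map_add, LinearMap.add_apply, hx, hy, add_zero]
  | smul c x _ hx => rw [map_smul, LinearMap.smul_apply, hx, smul_zero]

theorem mem_span_macPoly {f : PowerSumPoly QT} (hf : f.IsWeightedHomogeneous pweight n) :
    f ∈ Submodule.span QT (Set.range (macPoly (n := n))) := by
  rw [eq_sum_pmono hf]
  refine Submodule.sum_mem _ fun lam _ => Submodule.smul_mem _ _ ?_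
  exact Submodule.span_mono (Set.image_subset_range _ _) (pmono_mem_span_macPoly lam)

/-- The P_λ span the weight n part, so f is orthogonal to every p_λ of that weight, and the form is
diagonal with nonzero entries in the power sum basis. -/
theorem eq_zero_of_pform_eq_zero {f : PowerSumPoly QT} (hf : f.IsWeightedHomogeneous pweight n)
    (h : ∀ lam : n.Partition, pform f (macPoly lam) = 0) : f = 0 := by
  have h1 : ∀ g ∈ Submodule.span QT (Set.range (macPoly (n := n))), pform f g = 0 := by
    intro g hg
    induction hg using Submodule.span_induction with
    | mem x hx =>
      obtain ⟨lam, rfl⟩ := hx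
      exact h lam
    | zero => simp
    | add x y _ _ hx hy => rw [map_add, hx, hy, add_zero]
    | smul c x _ hx => rw [map_smul, hx, smul_zero]
  ext m
  rw [MvPolynomial.coeff_zero]
  by_contra hm
  have h2 := h1 (MvPolynomial.monomial m 1) (mem_span_macPoly
    (MvPolynomial.isWeightedHomogeneous_monomial _ _ _ (hf hm)))
  rw [pform_symm, pform_monomial, mul_one] at h2
  exact (mul_ne_zero (zqt_ne_zero m) hm) h2

/-- The squared norm of the Macdonald function of `lam`. -/
def macNorm (lam : n.Partition) : QT := pform (macPoly lam) (macPoly lam)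

theorem macNorm_ne_zero (lam : n.Partition) : macNorm lam ≠ 0 := by
  intro h
  refine macPoly_ne_zero lam (eq_zero_of_pform_eq_zero (isWeightedHomogeneous_macPoly lam)
    fun mu => ?_)
  by_cases hmu : lam = mu
  · subst hmu
    exact h
  · exact (isMacdonaldPoly_macPoly n).orthogonal lam mu hmu

theorem eq_sum_macPoly {f : PowerSumPoly QT} (hf : f.IsWeightedHomogeneous pweight n) :
    f = ∑ lam : n.Partition, (pform f (macPoly lam) / macNorm lam) • macPoly lam := by
  rw [← sub_eq_zero]
  refine eq_zero_of_pform_eq_zero (n := n) ?_ fun mu => ?_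
  · rw [sub_eq_add_neg, ← neg_one_smul QT]
    have h1 : ∑ lam : n.Partition, (pform f (macPoly lam) / macNorm lam) • macPoly lam ∈
        MvPolynomial.weightedHomogeneousSubmodule QT pweight n :=
      Submodule.sum_mem _ fun lam _ => Submodule.smul_mem _ _ (isWeightedHomogeneous_macPoly lam)
    exact (MvPolynomial.weightedHomogeneousSubmodule QT pweight n).add_mem hf
      (Submodule.smul_mem _ _ h1)
  · rw [map_sub, LinearMap.sub_apply, map_sum, LinearMap.sum_apply, Finset.sum_eq_single mu]
    · rw [map_smul, LinearMap.smul_apply, smul_eq_mul, ← macNorm,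
        div_mul_cancel₀ _ (macNorm_ne_zero mu), sub_self]
    · intro lam _ hne
      rw [map_smul, LinearMap.smul_apply, (isMacdonaldPoly_macPoly n).orthogonal lam mu hne,
        smul_zero]
    · simp

/-- T P_λ - e_λ P_λ lies in the span of lower monomials, hence of lower P_μ. For μ < λ symmetry
turns ⟨T P_λ, P_μ⟩ into ⟨P_λ, T P_μ⟩, which vanishes by triangularity. Distinct eigenvalues play no
role, so the argument covers D_0 and D*_0 alike. -/
theorem eigenvector_macPoly (Q s : QT) (hs : s ≠ 0)
    (hsymm : ∀ f g, pform (macOp Q s 0 f) g = pform f (macOp Q s 0 g)) (lam : n.Partition) :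
    macOp Q s 0 (macPoly lam) = eigenvalue Q s (diagram lam) • macPoly lam := by
  set e := fun mu : n.Partition => eigenvalue Q s (diagram mu) with he
  have hlow : ∀ mu : n.Partition, ∀ f ∈ lowerSpan QT mu, macOp Q s 0 f ∈ lowerSpan QT mu := by
    intro mu f hf
    induction hf using Submodule.span_induction with
    | mem x hx =>
      obtain ⟨nu, hnu, rfl⟩ := hx
      have h1 := macOp_pmono_sub_mem Q s hs nu
      have h2 : lowerSpan QT nu ≤ lowerSpan QT mu :=
        Submodule.span_mono (Set.image_mono fun κ hκ => DomLT.trans hκ hnu)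
      have h3 := Submodule.add_mem _ (h2 h1) (Submodule.smul_mem _ (e nu)
        (Submodule.subset_span ⟨nu, hnu, rfl⟩ : pmono QT nu ∈ lowerSpan QT mu))
      rwa [sub_add_cancel] at h3
    | zero => simp
    | add x y _ _ hx hy => rw [map_add]; exact Submodule.add_mem _ hx hy
    | smul c x _ hx => rw [map_smul]; exact Submodule.smul_mem _ _ hx
  have hmem : ∀ mu : n.Partition, macOp Q s 0 (macPoly mu) - e mu • macPoly mu ∈
      lowerSpan QT mu := by
    intro mu
    have h1 := (isMacdonaldPoly_macPoly n).triangular mu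
    have h2 : macOp Q s 0 (macPoly mu) - e mu • macPoly mu =
        (macOp Q s 0 (pmono QT mu) - e mu • pmono QT mu) +
          (macOp Q s 0 (macPoly mu - pmono QT mu) - e mu • (macPoly mu - pmono QT mu)) := by
      rw [map_sub, smul_sub]
      abel
    rw [h2]
    exact Submodule.add_mem _ (macOp_pmono_sub_mem Q s hs mu)
      (Submodule.sub_mem _ (hlow mu _ h1) (Submodule.smul_mem _ _ h1))
  rw [← sub_eq_zero]
  refine eq_zero_of_pform_eq_zero (isWeightedHomogeneous_of_mem_lowerSpan (hmem lam)) fun mu => ?_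
  by_cases hmu : DomLT mu lam
  · have h1 : ∀ f ∈ lowerSpan QT mu, pform (macPoly lam) f = 0 := fun f hf => by
      rw [pform_symm]
      exact pform_eq_zero_of_mem_lowerSpan (fun h => hmu.2 (hmu.1.antisymm h.1)) hf
    have h2 := h1 _ (hmem mu)
    have h3 := (isMacdonaldPoly_macPoly n).orthogonal lam mu (Ne.symm hmu.2)
    rw [map_sub, map_smul, h3, smul_zero, sub_zero] at h2
    rw [map_sub, LinearMap.sub_apply, hsymm, h2, map_smul, LinearMap.smul_apply, h3, smul_zero,
      sub_zero]
  · exact pform_eq_zero_of_mem_lowerSpan hmu (hmem lam)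

theorem macOp_macPoly (lam : n.Partition) :
    macOp q t⁻¹ 0 (macPoly lam) = eigenvalue q t⁻¹ (diagram lam) • macPoly lam :=
  eigenvector_macPoly q t⁻¹ (inv_ne_zero t_ne_zero) pform_macOp lam

theorem macOp_inv_macPoly (lam : n.Partition) :
    macOp q⁻¹ t 0 (macPoly lam) = eigenvalue q⁻¹ t (diagram lam) • macPoly lam :=
  eigenvector_macPoly q⁻¹ t t_ne_zero pform_macOp_inv lam

end MacdonaldBasis

/-! ### The support of multiplication by p_1 -/

section Pieri

/-- The character `q ^ (j - 1) * t ^ (1 - i)` of a box `(i, j)`. -/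
def content (c : ℕ × ℕ) : QT := q ^ c.2 * t⁻¹ ^ c.1

/-- With ε the difference of the indicator functions, the coefficient of q^0 t^0 in the product is ∑
ε², so ∑ ε² = 1. The cardinalities give ∑ ε = 1; hence ∑ (ε² - ε) = 0 with nonnegative terms, and ε
never equals -1. -/
theorem sub_subset_of_mul_eq_one (A B : Finset (ℕ × ℕ)) (hcard : B.card + 1 = A.card)
    (h : (∑ c ∈ A, q ^ c.2 * t⁻¹ ^ c.1 - ∑ c ∈ B, q ^ c.2 * t⁻¹ ^ c.1) *
      (∑ c ∈ A, q⁻¹ ^ c.2 * t ^ c.1 - ∑ c ∈ B, q⁻¹ ^ c.2 * t ^ c.1) = 1) : B ⊆ A := by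
  classical
  set S := A ∪ B with hS
  let ε : ℕ × ℕ → ℤ := fun c => (if c ∈ A then 1 else 0) - (if c ∈ B then 1 else 0)
  have hε : ∀ F : ℕ × ℕ → QT, ∑ c ∈ A, F c - ∑ c ∈ B, F c = ∑ c ∈ S, (ε c : QT) * F c := by
    intro F
    simp only [ε, Int.cast_sub, Int.cast_ite, Int.cast_one, Int.cast_zero, sub_mul, ite_mul,
      one_mul, zero_mul, Finset.sum_sub_distrib, Finset.sum_ite_mem]
    rw [Finset.inter_eq_right.mpr Finset.subset_union_left,
      Finset.inter_eq_right.mpr Finset.subset_union_right]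
  have hεZ : ∑ c ∈ S, ε c = 1 := by
    simp only [ε, Finset.sum_sub_distrib, Finset.sum_ite_mem]
    rw [Finset.inter_eq_right.mpr Finset.subset_union_left,
      Finset.inter_eq_right.mpr Finset.subset_union_right]
    simp only [Finset.sum_const, nsmul_eq_mul, mul_one, ← hcard]
    push_cast
    ring
  obtain ⟨M, hM⟩ : ∃ M : ℕ, ∀ c ∈ S, c.1 ≤ M ∧ c.2 ≤ M :=
    ⟨S.sup fun c => max c.1 c.2, fun c hc =>
      ⟨(le_max_left _ _).trans (Finset.le_sup (f := fun c : ℕ × ℕ => max c.1 c.2) hc),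
        (le_max_right _ _).trans (Finset.le_sup (f := fun c : ℕ × ℕ => max c.1 c.2) hc)⟩⟩
  -- Multiplication by q^M t^M makes all exponents nonnegative; the diagonal pairs then sit exactly
  -- at q^M t^M.
  have h1 : ∑ x ∈ S ×ˢ S, ((ε x.1 * ε x.2 : ℤ) : QT) *
      (q ^ (x.1.2 + (M - x.2.2)) * t ^ (x.2.1 + (M - x.1.1))) =
      ((1 : ℤ) : QT) * (q ^ M * t ^ M) := by
    rw [Int.cast_one, ← h, hε, hε, Finset.sum_mul_sum, ← Finset.sum_product', Finset.sum_mul]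
    refine Finset.sum_congr rfl fun x hx => ?_
    rw [Finset.mem_product] at hx
    rw [pow_add, pow_add, pow_sub₀ _ q_ne_zero (hM _ hx.2).2, pow_sub₀ _ t_ne_zero (hM _ hx.1).1,
      inv_pow, inv_pow]
    push_cast
    ring
  have h2 := sum_coeff_eq _ _ _ _ _ _ _ h1
  rw [Finset.sum_product] at h2
  have h3 : ∑ c ∈ S, ε c * ε c = 1 := by
    rw [← h2]
    refine Finset.sum_congr rfl fun c hc => ?_
    rw [Finset.sum_eq_single c]
    · have := hM c hc
      rw [if_pos (by constructor <;> dsimp only <;> omega)]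
    · intro b hb hne
      have h4 := hM c hc
      have h5 := hM b hb
      rw [if_neg]
      rintro ⟨h6, h7⟩
      exact hne (Prod.ext (by simp only at h6 h7; omega) (by simp only at h6 h7; omega))
    · exact fun h' => absurd hc h'
  have h4 : ∑ c ∈ S, (ε c * ε c - ε c) = 0 := by
    rw [Finset.sum_sub_distrib, h3, hεZ, sub_self]
  have hcases : ∀ c, ε c = 1 ∨ ε c = 0 ∨ ε c = -1 := by
    intro c
    simp only [ε]
    split_ifs <;> simp
  rw [Finset.sum_eq_zero_iff_of_nonneg (fun c _ => by
    rcases hcases c with h | h | h <;> rw [h] <;> norm_num)] at h4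
  intro c hc
  by_contra hA
  have h5 := h4 c (Finset.mem_union_right _ hc)
  have h6 : ε c = -1 := by
    simp only [ε]
    rw [if_neg hA, if_pos hc]
    norm_num
  rw [h6] at h5
  norm_num at h5

variable {n : ℕ}

theorem eigenvalue_sub (Q s : QT) (d d' : YoungDiagram) :
    eigenvalue Q s d - eigenvalue Q s d' = -((1 - Q) * (1 - s)) *
      (∑ c ∈ d.cells, Q ^ c.2 * s ^ c.1 - ∑ c ∈ d'.cells, Q ^ c.2 * s ^ c.1) := by
  rw [eigenvalue, eigenvalue]
  ring

theorem q_ne_t : q ≠ t := by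
  intro h
  have h1 : ∑ _i ∈ ({()} : Finset Unit), ((1 : ℤ) : QT) * (q ^ 1 * t ^ 0) =
      ((1 : ℤ) : QT) * (q ^ 0 * t ^ 1) := by
    simpa using h
  have h2 := sum_coeff_eq _ (fun _ => 1) (fun _ => 1) (fun _ => 0) _ _ _ h1
  simp at h2

/-- Pairing the double commutator relation, applied to P_μ, with P_λ gives (E_λ - E_μ)(E*_λ - E*_μ)
= const whenever the pairing is nonzero. In terms of the box sums this is the product equal to 1
treated in `sub_subset_of_mul_eq_one`. -/
theorem exists_cells_eq_insert {lam : (n + 1).Partition} {mu : n.Partition}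
    (h : pform (macPoly mu * MvPolynomial.X 1) (macPoly lam) ≠ 0) :
    ∃ s ∉ (diagram mu).cells, insert s (diagram mu).cells = (diagram lam).cells := by
  rw [Finset.exists_eq_insert_iff]
  have hcard : (diagram mu).cells.card + 1 = (diagram lam).cells.card := by
    rw [card_cells_diagram, card_cells_diagram]
  refine ⟨sub_subset_of_mul_eq_one _ _ hcard ?_, hcard⟩
  have h1 := congrArg (fun F => pform F (macPoly lam))
    (double_commutator_macOp q t q_ne_zero t_ne_zero q_ne_t (macPoly mu))
  simp only [macOp_macPoly, macOp_inv_macPoly, smul_mul_assoc, map_sub, map_smul,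
    LinearMap.sub_apply, LinearMap.smul_apply, pform_macOp, pform_macOp_inv, smul_eq_mul] at h1
  have h2 : (eigenvalue q t⁻¹ (diagram lam) - eigenvalue q t⁻¹ (diagram mu)) *
      (eigenvalue q⁻¹ t (diagram lam) - eigenvalue q⁻¹ t (diagram mu)) =
      (1 - q) * (1 - t⁻¹) * ((1 - q⁻¹) * (1 - t)) := by
    apply mul_right_cancel₀ h
    linear_combination h1
  rw [eigenvalue_sub, eigenvalue_sub] at h2
  have h3 : (1 - q) * (1 - t⁻¹) * ((1 - q⁻¹) * (1 - t)) ≠ 0 := by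
    have h4 := one_sub_q_pow_ne_zero 1 one_ne_zero
    have h5 := one_sub_t_pow_ne_zero 1 one_ne_zero
    rw [pow_one] at h4 h5
    exact mul_ne_zero (mul_ne_zero h4 one_sub_inv_t_ne_zero) (mul_ne_zero one_sub_inv_q_ne_zero h5)
  apply mul_right_cancel₀ h3
  linear_combination h2

end Pieri

/-! ### The kernel and its pairing with Macdonald functions -/

section Kernel

/-- The coefficients of `exp (∑ n > 0, (α ^ n - β ^ n) / (1 - q ^ n) * p_n * z ^ n / n)`. -/
def kernelCoeff (α β : QT) (n : ℕ) : PowerSumPoly QT :=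
  pexpCoeff (fun n => (α ^ n - β ^ n) / (1 - q ^ n)) n

/-- The denominators 1 - q^n cancel and the series is (1 - αz)/(1 - βz), so its coefficients are
geometric up to a correction at the first step. -/
theorem coeff_shiftFactor_kernel (α β : QT) (j : ℕ) :
    PowerSeries.coeff (j + 1) (shiftFactor (fun n => (α ^ n - β ^ n) / (1 - q ^ n))
      (fun n => -(1 - q ^ n))) = β * PowerSeries.coeff j (shiftFactor
        (fun n => (α ^ n - β ^ n) / (1 - q ^ n)) (fun n => -(1 - q ^ n))) -
          α * (if j = 0 then 1 else 0) := by
  set ρ := shiftFactor (fun n => (α ^ n - β ^ n) / (1 - q ^ n)) (fun n => -(1 - q ^ n)) with hρ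
  have h1 : (1 - PowerSeries.C β * PowerSeries.X) * ρ = 1 - PowerSeries.C α * PowerSeries.X := by
    refine IsExpSeries.unique QT ((isExpSeries_one_sub_mul β).mul (expSeries_isExpSeries _))
      ((isExpSeries_one_sub_mul α).congr fun n hn => ?_)
    have := one_sub_q_pow_ne_zero n hn.ne'
    field_simp
    ring
  have h2 := congrArg (PowerSeries.coeff (j + 1)) h1
  rw [sub_mul, one_mul, mul_assoc, map_sub, map_sub, PowerSeries.coeff_C_mul,
    PowerSeries.coeff_succ_X_mul, PowerSeries.coeff_C_mul, PowerSeries.coeff_X,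
    PowerSeries.coeff_one, if_neg (Nat.succ_ne_zero j)] at h2
  have h3 : (if j + 1 = 1 then (1 : QT) else 0) = if j = 0 then 1 else 0 := by simp
  rw [h3] at h2
  linear_combination h2

/-- Lowering j by one in the normal-ordered sum for D_0 k_{n+1} produces β times the sum for D_1
k_n; the correction at j = 0 is the p_1 term, and the unshifted j = 0 term is k_{n+1} itself. -/
theorem macOp_kernelCoeff (α β : QT) (n : ℕ) :
    macOp q t⁻¹ 0 (kernelCoeff α β (n + 1)) - kernelCoeff α β (n + 1) =
      MvPolynomial.C β * macOp q t⁻¹ 1 (kernelCoeff α β n) -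
        MvPolynomial.C (α * (1 - t⁻¹)) * (kernelCoeff α β n * MvPolynomial.X 1) := by
  simp only [macOp, kernelCoeff, vertexOp_pexpCoeff]
  set ρ := shiftFactor (fun n => (α ^ n - β ^ n) / (1 - q ^ n)) (fun n => -(1 - q ^ n)) with hρ
  set G := pexpCoeff (fun n => 1 - t⁻¹ ^ n) with hG
  set k := pexpCoeff (fun n => (α ^ n - β ^ n) / (1 - q ^ n)) with hk
  have h0 : PowerSeries.coeff 0 ρ = 1 := (expSeries_isExpSeries (K := QT) _).const
  have hG0 : G 0 = 1 := pexpCoeff_zero _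
  have hG1 : G 1 = MvPolynomial.C (1 - t⁻¹) * MvPolynomial.X 1 := by
    rw [hG, pexpCoeff_one, pow_one]
    rfl
  rw [Finset.sum_range_succ']
  have h1 : ∑ j ∈ Finset.range (n + 1), MvPolynomial.C (PowerSeries.coeff (j + 1) ρ) *
      (G (0 + (j + 1)) * k (n + 1 - (j + 1))) =
      MvPolynomial.C β * (∑ j ∈ Finset.range (n + 1), MvPolynomial.C (PowerSeries.coeff j ρ) *
        (G (1 + j) * k (n - j))) - MvPolynomial.C α * (G 1 * k n) := by
    have h2 : MvPolynomial.C α * (G 1 * k n) = ∑ j ∈ Finset.range (n + 1),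
        MvPolynomial.C (α * if j = 0 then 1 else 0) * (G (1 + j) * k (n - j)) := by
      rw [Finset.sum_range_succ', Finset.sum_eq_zero]
      · simp
      · intro j _
        simp
    rw [h2, Finset.mul_sum, ← Finset.sum_sub_distrib]
    refine Finset.sum_congr rfl fun j _ => ?_
    rw [coeff_shiftFactor_kernel, zero_add, Nat.add_sub_add_right, add_comm 1 j]
    simp only [map_sub, map_mul]
    ring
  rw [h1, h0, hG0, hG1]
  simp only [map_one, map_mul, map_sub, Nat.sub_zero]
  ring

theorem isWeightedHomogeneous_kernelCoeff (α β : QT) (n : ℕ) :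
    (kernelCoeff α β n).IsWeightedHomogeneous pweight n :=
  isWeightedHomogeneous_pexpCoeff _ n

theorem one_sub_q_mul_macOp_one (f : PowerSumPoly QT) :
    (1 - q) • macOp q t⁻¹ 1 f =
      macOp q t⁻¹ 0 f * MvPolynomial.X 1 - macOp q t⁻¹ 0 (f * MvPolynomial.X 1) := by
  rw [macOp_mul_X, MvPolynomial.smul_eq_C_mul, PNat.one_coe, pow_one, zero_add]
  ring

/-- Pairing `macOp_kernelCoeff` with P_λ and eliminating D_1 expresses the pairing at λ through
those at partitions μ of n. Each contributing μ is λ minus one box, and that box supplies the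
missing factor of the product. -/
theorem exists_pform_kernelCoeff (n : ℕ) : ∃ Y : n.Partition → QT, ∀ α β lam,
    pform (kernelCoeff α β n) (macPoly lam) =
      Y lam * ∏ c ∈ (diagram lam).cells, (α - β * content c) := by
  induction n with
  | zero =>
    refine ⟨fun lam => pform 1 (macPoly lam), fun α β lam => ?_⟩
    rw [kernelCoeff, pexpCoeff_zero, Finset.card_eq_zero.mp (card_cells_diagram lam),
      Finset.prod_empty, mul_one]
  | succ n ih =>
    obtain ⟨Y, hY⟩ := ih
    set ψ : n.Partition → (n + 1).Partition → QT := fun mu lam =>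
      pform (macPoly mu * MvPolynomial.X 1) (macPoly lam) with hψ
    refine ⟨fun lam => -((1 - t⁻¹) / (eigenvalue q t⁻¹ (diagram lam) - 1)) *
      ∑ mu, Y mu / macNorm mu * ψ mu lam, fun α β lam => ?_⟩
    set k := kernelCoeff α β n with hk
    set e := eigenvalue q t⁻¹ (diagram lam) with he
    have hq : (1 - q : QT) ≠ 0 := by simpa using one_sub_q_pow_ne_zero 1 one_ne_zero
    have hsum := eq_sum_macPoly (isWeightedHomogeneous_kernelCoeff α β n)
    rw [← hk] at hsum
    have hX : pform (k * MvPolynomial.X 1) (macPoly lam) =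
        ∑ mu, pform k (macPoly mu) / macNorm mu * ψ mu lam := by
      conv_lhs => rw [hsum]
      rw [Finset.sum_mul, map_sum, LinearMap.sum_apply]
      simp only [smul_mul_assoc, map_smul, LinearMap.smul_apply, smul_eq_mul, hψ]
    have hDX : pform (macOp q t⁻¹ 0 k * MvPolynomial.X 1) (macPoly lam) =
        ∑ mu, pform k (macPoly mu) / macNorm mu * eigenvalue q t⁻¹ (diagram mu) * ψ mu lam := by
      conv_lhs => rw [hsum]
      rw [map_sum, Finset.sum_mul, map_sum, LinearMap.sum_apply]
      simp only [smul_mul_assoc, map_smul, LinearMap.smul_apply, smul_eq_mul, hψ, macOp_macPoly,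
        mul_assoc]
    have h1 := congrArg (fun F => pform F (macPoly lam)) (one_sub_q_mul_macOp_one k)
    simp only [map_smul, map_sub, LinearMap.smul_apply, LinearMap.sub_apply, smul_eq_mul,
      pform_macOp, macOp_macPoly, ← he] at h1
    have h2 := congrArg (fun F => pform F (macPoly lam)) (macOp_kernelCoeff α β n)
    simp only [← MvPolynomial.smul_eq_C_mul, map_smul, map_sub, LinearMap.smul_apply,
      LinearMap.sub_apply, smul_eq_mul, pform_macOp, macOp_macPoly, ← he, ← hk] at h2
    -- If λ = μ ∪ {s}, then E_μ - E_λ = (1-q)(1-t⁻¹) content(s), so the bracket is -(1-q)(1-t⁻¹)(α -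
    -- β content(s)) and completes the product over μ to the one over λ.
    have h3 : ∀ mu, pform k (macPoly mu) / macNorm mu * ψ mu lam *
        (β * (eigenvalue q t⁻¹ (diagram mu) - e) - α * ((1 - q) * (1 - t⁻¹))) =
        -((1 - q) * (1 - t⁻¹)) * (Y mu / macNorm mu * ψ mu lam *
          ∏ c ∈ (diagram lam).cells, (α - β * content c)) := by
      intro mu
      by_cases h : ψ mu lam = 0
      · rw [h]
        ring
      · obtain ⟨s, hs, hins⟩ := exists_cells_eq_insert h
        have h4 : eigenvalue q t⁻¹ (diagram mu) - e = (1 - q) * (1 - t⁻¹) * content s := by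
          rw [he, eigenvalue_sub, ← hins, Finset.sum_insert hs, content]
          ring
        rw [h4, ← hins, Finset.prod_insert hs, hY]
        ring
    have h4 : (1 - q) * ((e - 1) * pform (kernelCoeff α β (n + 1)) (macPoly lam)) =
        ∑ mu, pform k (macPoly mu) / macNorm mu * ψ mu lam *
          (β * (eigenvalue q t⁻¹ (diagram mu) - e) - α * ((1 - q) * (1 - t⁻¹))) := by
      have h5 : ∑ mu, pform k (macPoly mu) / macNorm mu * ψ mu lam *
          (β * (eigenvalue q t⁻¹ (diagram mu) - e) - α * ((1 - q) * (1 - t⁻¹))) =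
          β * ∑ mu, pform k (macPoly mu) / macNorm mu * eigenvalue q t⁻¹ (diagram mu) * ψ mu lam -
          (β * e + α * ((1 - q) * (1 - t⁻¹))) *
            ∑ mu, pform k (macPoly mu) / macNorm mu * ψ mu lam := by
        rw [Finset.mul_sum, Finset.mul_sum, ← Finset.sum_sub_distrib]
        exact Finset.sum_congr rfl fun mu _ => by ring
      rw [h5, ← hDX, ← hX]
      linear_combination (1 - q) * h2 + β * h1
    rw [Finset.sum_congr rfl fun mu _ => h3 mu, ← Finset.mul_sum, ← Finset.sum_mul] at h4
    -- The recursion can be solved for the pairing at λ because the eigenvalue 1 belongs only to the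
    -- empty partition.
    have hne : e - 1 ≠ 0 := sub_ne_zero.mpr (eigenvalue_ne_one (Nat.succ_ne_zero n) lam)
    have h5 : (e - 1) * pform (kernelCoeff α β (n + 1)) (macPoly lam) =
        -(1 - t⁻¹) * ((∑ mu, Y mu / macNorm mu * ψ mu lam) *
          ∏ c ∈ (diagram lam).cells, (α - β * content c)) := by
      apply mul_left_cancel₀ hq
      linear_combination h4
    apply mul_left_cancel₀ hne
    rw [h5]
    simp only [← he]
    field_simp

end Kernel

/-! ### Removing the first column of a diagram -/

section RemoveColumn

/-- The Young diagram obtained by removing the first column. -/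
def removeColumn (d : YoungDiagram) : YoungDiagram where
  cells := (d.cells.filter fun c => c.2 ≠ 0).image fun c => (c.1, c.2 - 1)
  isLowerSet := by
    rintro ⟨i, j⟩ ⟨k, l⟩ hab ha
    simp only [Finset.mem_coe, Finset.mem_image, Finset.mem_filter, YoungDiagram.mem_cells,
      Prod.mk.injEq, Prod.exists] at ha ⊢
    obtain ⟨a, b, ⟨h1, h2⟩, rfl, rfl⟩ := ha
    refine ⟨k, l + 1, ⟨d.up_left_mem hab.1 ?_ h1, Nat.succ_ne_zero l⟩, rfl, rfl⟩
    have := hab.2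
    simp only at this
    omega

theorem mem_removeColumn (d : YoungDiagram) (i j : ℕ) :
    (i, j) ∈ removeColumn d ↔ (i, j + 1) ∈ d := by
  rw [← YoungDiagram.mem_cells, removeColumn]
  simp only [Finset.mem_image, Finset.mem_filter, YoungDiagram.mem_cells, Prod.mk.injEq,
    Prod.exists]
  constructor
  · rintro ⟨a, b, ⟨h1, h2⟩, rfl, rfl⟩
    rwa [Nat.sub_add_cancel (Nat.one_le_iff_ne_zero.mpr h2)]
  · exact fun h => ⟨i, j + 1, ⟨h, Nat.succ_ne_zero j⟩, rfl, rfl⟩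

theorem rowLen_removeColumn (d : YoungDiagram) (i : ℕ) :
    (removeColumn d).rowLen i = d.rowLen i - 1 := by
  have h : ∀ j, j < (removeColumn d).rowLen i ↔ j < d.rowLen i - 1 := fun j => by
    rw [← YoungDiagram.mem_iff_lt_rowLen, mem_removeColumn, YoungDiagram.mem_iff_lt_rowLen]
    omega
  have h1 := h (d.rowLen i - 1)
  have h2 := h ((removeColumn d).rowLen i)
  omega

theorem colLen_removeColumn (d : YoungDiagram) (j : ℕ) :
    (removeColumn d).colLen j = d.colLen (j + 1) := by
  have h : ∀ i, i < (removeColumn d).colLen j ↔ i < d.colLen (j + 1) := fun i => by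
    rw [← YoungDiagram.mem_iff_lt_colLen, mem_removeColumn, YoungDiagram.mem_iff_lt_colLen]
  have h1 := h (d.colLen (j + 1))
  have h2 := h ((removeColumn d).colLen j)
  omega

theorem colLen_removeColumn_le (d : YoungDiagram) : (removeColumn d).colLen 0 ≤ d.colLen 0 := by
  rw [colLen_removeColumn]
  exact d.colLen_anti _ _ (Nat.zero_le _)

theorem rowLen_eq_succ (d : YoungDiagram) {i : ℕ} (hi : i < d.colLen 0) :
    d.rowLen i = (removeColumn d).rowLen i + 1 := by
  have := (rowLen_ne_zero_iff d i).mpr hi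
  rw [rowLen_removeColumn]
  omega

theorem prod_cells_removeColumn {M : Type*} [CommMonoid M] (d : YoungDiagram) (F : ℕ × ℕ → M) :
    ∏ c ∈ d.cells, F c = (∏ i ∈ Finset.range (d.colLen 0), F (i, 0)) *
      ∏ c ∈ (removeColumn d).cells, F (c.1, c.2 + 1) := by
  rw [prod_cells d _ le_rfl, prod_cells (removeColumn d) _ (colLen_removeColumn_le d),
    ← Finset.prod_mul_distrib]
  refine Finset.prod_congr rfl fun i hi => ?_
  rw [rowLen_eq_succ d (Finset.mem_range.mp hi), Finset.prod_range_succ', mul_comm]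

theorem card_removeColumn_lt (d : YoungDiagram) (h : d.cells.card ≠ 0) :
    (removeColumn d).cells.card < d.cells.card := by
  have h1 := prod_cells_removeColumn (M := Multiplicative ℕ) d fun _ => Multiplicative.ofAdd 1
  have h2 : d.cells.card = d.colLen 0 + (removeColumn d).cells.card := by
    simpa [← ofAdd_nsmul, ← ofAdd_add] using h1
  have h3 : d.colLen 0 ≠ 0 := by
    intro h0
    rw [← sum_rowLen d _ le_rfl, h0] at h
    exact h rfl
  omega

/-- A first-column box in row i (from 0) has the reduced row length as arm and N - i as leg plus
one, N being the number of rows; other boxes keep arm and leg. -/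
theorem cCoeff_removeColumn (d : YoungDiagram) : cCoeff d =
    (∏ i ∈ Finset.range (d.colLen 0), (1 - q ^ (removeColumn d).rowLen i * t ^ (d.colLen 0 - i))) *
      cCoeff (removeColumn d) := by
  rw [cCoeff, prod_cells_removeColumn, cCoeff]
  congr 1
  · refine Finset.prod_congr rfl fun i hi => ?_
    have hi' := Finset.mem_range.mp hi
    rw [arm, leg, rowLen_eq_succ d hi']
    simp only [zero_add, Nat.add_sub_cancel]
    congr 3
    omega
  · refine Finset.prod_congr rfl fun c _ => ?_
    have h1 : arm d (c.1, c.2 + 1) = arm (removeColumn d) c := by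
      simp only [arm, rowLen_removeColumn]
      omega
    have h2 : leg d (c.1, c.2 + 1) = leg (removeColumn d) c := by
      simp only [leg, colLen_removeColumn]
    rw [h1, h2]

theorem t_pow_mul_content {N : ℕ} {c : ℕ × ℕ} (h : c.1 ≤ N) :
    t ^ N * content c = q ^ c.2 * t ^ (N - c.1) := by
  rw [content, pow_sub₀ _ t_ne_zero h, inv_pow]
  ring

theorem fst_lt_colLen {d : YoungDiagram} {c : ℕ × ℕ} (hc : c ∈ d.cells) : c.1 < d.colLen 0 := by
  rw [← YoungDiagram.mem_iff_lt_colLen]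
  exact d.up_left_mem le_rfl (Nat.zero_le _) ((YoungDiagram.mem_cells c).mp hc)

theorem prod_content_ne_zero {d : YoungDiagram} {N : ℕ} (hN : d.colLen 0 ≤ N) :
    ∏ c ∈ d.cells, (1 - t ^ N * content c) ≠ 0 := by
  refine Finset.prod_ne_zero_iff.mpr fun c hc => ?_
  have h := (fst_lt_colLen hc).trans_le hN
  rw [t_pow_mul_content h.le]
  exact one_sub_monomial_ne_zero _ _ (by omega)

/-- Row by row, the larger diagram has one more box, at the end of the row of the reduced diagram;
its factor is the one occurring in `cCoeff_removeColumn`. -/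
theorem prod_content_removeColumn (d : YoungDiagram) :
    (∏ c ∈ (removeColumn d).cells, (1 - t ^ d.colLen 0 * content c)) *
      ∏ i ∈ Finset.range (d.colLen 0), (1 - q ^ (removeColumn d).rowLen i * t ^ (d.colLen 0 - i)) =
      ∏ c ∈ d.cells, (1 - t ^ d.colLen 0 * content c) := by
  rw [prod_cells (removeColumn d) _ (colLen_removeColumn_le d), prod_cells d _ le_rfl,
    ← Finset.prod_mul_distrib]
  refine Finset.prod_congr rfl fun i hi => ?_
  have hi' := Finset.mem_range.mp hi
  rw [rowLen_eq_succ d hi', Finset.prod_range_succ, t_pow_mul_content hi'.le]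

end RemoveColumn

/-! ### Principal specialisation and the value of the kernel factor -/

section Specialization

theorem macOpVars_sub {K : Type*} [Field K] {N : ℕ} (Q s : K) (f g : MvPolynomial (Fin N) K) :
    macOpVars N Q s (f - g) = macOpVars N Q s f - macOpVars N Q s g := by
  simp only [macOpVars, map_sub, mul_sub, Finset.sum_sub_distrib]
  ring

theorem scaleVar_prod_X {K : Type*} [Field K] {N : ℕ} (Q : K) (i : Fin N) :
    scaleVar Q i (∏ j, MvPolynomial.X j) = MvPolynomial.C Q * ∏ j, MvPolynomial.X j := by
  rw [map_prod, ← Finset.mul_prod_erase Finset.univ _ (Finset.mem_univ i),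
    ← Finset.mul_prod_erase Finset.univ (fun j => MvPolynomial.X j) (Finset.mem_univ i),
    Finset.prod_congr rfl fun j hj => by
      rw [scaleVar, MvPolynomial.aeval_X, Function.update_of_ne (Finset.ne_of_mem_erase hj)],
    scaleVar, MvPolynomial.aeval_X, Function.update_self, mul_assoc]

theorem macOpVars_prod_X_mul {K : Type*} [Field K] {N : ℕ} (Q s : K)
    (f : MvPolynomial (Fin N) K) : macOpVars N Q s ((∏ j, MvPolynomial.X j) * f) =
      (∏ j, MvPolynomial.X j) * (MvPolynomial.C Q * macOpVars N Q s f +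
        MvPolynomial.C (s ^ N * (1 - Q)) * (diffProd 1 * f)) := by
  simp only [macOpVars, map_mul (scaleVar Q _), scaleVar_prod_X]
  rw [Finset.sum_congr rfl fun i _ => show macCoeff s i * ((MvPolynomial.C Q *
      ∏ j, MvPolynomial.X j) * scaleVar Q i f) = (MvPolynomial.C Q * ∏ j, MvPolynomial.X j) *
        (macCoeff s i * scaleVar Q i f) by ring, ← Finset.mul_sum]
  simp only [map_mul, map_sub, map_one]
  ring

variable {n n' : ℕ}

theorem macOpVars_toVars_macPoly (N : ℕ) (lam : n.Partition) (hN : (diagram lam).colLen 0 ≤ N) :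
    macOpVars N q t⁻¹ (toVars QT N (macPoly lam)) =
      MvPolynomial.C (macEigen q t⁻¹ (rowsFin N lam)) *
        (diffProd 1 * toVars QT N (macPoly lam)) := by
  rw [← diffProd_mul_toVars_macOp N q t⁻¹ (inv_ne_zero t_ne_zero), macOp_macPoly, map_smul,
    MvPolynomial.smul_eq_C_mul, macEigen_rowsFin q t⁻¹ N lam hN]
  ring

theorem coeff_toVars_macPoly (N : ℕ) (lam : n.Partition) (hN : (diagram lam).colLen 0 ≤ N) :
    (toVars QT N (macPoly lam)).coeff (rowsFin N lam) = 1 := by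
  rw [coeff_toVars, embDomain_rowsFin N lam hN, coeff_rows_macPoly]

/-- With N the number of rows of λ, multiplication by x_1⋯x_N sends the eigenfunction of μ to one
whose exponent vector is that of λ. Both sides thus have the same eigenvalue and leading coefficient
1, and their difference vanishes by `eq_zero_of_macOpVars_eq`. -/
theorem toVars_macPoly_eq (lam : n.Partition) (mu : n'.Partition)
    (h : diagram mu = removeColumn (diagram lam)) :
    toVars QT ((diagram lam).colLen 0) (macPoly lam) =
      (∏ j, MvPolynomial.X j) * toVars QT ((diagram lam).colLen 0) (macPoly mu) := by
  set N := (diagram lam).colLen 0 with hN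
  have hmu : (diagram mu).colLen 0 ≤ N := h ▸ colLen_removeColumn_le _
  have hrows : ∀ i : Fin N, rowsFin N lam i = rowsFin N mu i + 1 := fun i => by
    rw [rowsFin_apply, rowsFin_apply, h]
    exact rowLen_eq_succ _ i.2
  have hE : macEigen q t⁻¹ (rowsFin N lam) =
      q * macEigen q t⁻¹ (rowsFin N mu) + t⁻¹ ^ N * (1 - q) := by
    simp only [macEigen, hrows, pow_succ, mul_add, ← mul_assoc]
    rw [← Finset.sum_mul]
    ring
  rw [← sub_eq_zero]
  refine eq_zero_of_macOpVars_eq (Q := q) (s := t⁻¹) (κ := rowsFin N lam) ?_ ?_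
    (fun e he => macEigen_injective he)
  · rw [macOpVars_sub, macOpVars_prod_X_mul, macOpVars_toVars_macPoly N lam le_rfl,
      macOpVars_toVars_macPoly N mu hmu, hE]
    simp only [map_add, map_mul]
    ring
  · have h1 : (∏ j : Fin N, MvPolynomial.X j : MvPolynomial (Fin N) QT) =
        MvPolynomial.monomial (∑ j : Fin N, Finsupp.single j 1) 1 := by
      rw [MvPolynomial.monomial_sum_one]
      rfl
    have h2 : rowsFin N lam = (∑ j : Fin N, Finsupp.single j 1) + rowsFin N mu := by
      ext i
      rw [hrows, Finsupp.add_apply, Finsupp.finsetSum_apply, add_comm]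
      simp [Finsupp.single_apply]
    rw [MvPolynomial.coeff_sub, coeff_toVars_macPoly N lam le_rfl, h1, h2,
      MvPolynomial.coeff_monomial_mul, one_mul, coeff_toVars_macPoly N mu hmu, sub_self]

/-- The factor of `⟨exp (∑ n, (α ^ n - β ^ n) / (1 - q ^ n) * p_n / n), P_λ⟩` that does not depend
on `α` and `β`. -/
def kernelFactor (lam : n.Partition) : QT := (exists_pform_kernelCoeff n).choose lam

theorem pform_kernelCoeff (α β : QT) (lam : n.Partition) :
    pform (kernelCoeff α β n) (macPoly lam) =
      kernelFactor lam * ∏ c ∈ (diagram lam).cells, (α - β * content c) :=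
  (exists_pform_kernelCoeff n).choose_spec α β lam

/-- For α = 1, β = t^N the reproducing property evaluates p_j at (1 - t^{Nj})/(1 - t^j), the power
sum of 1, t, ..., t^{N-1}. -/
theorem aeval_toVars_macPoly (N : ℕ) (lam : n.Partition) :
    MvPolynomial.aeval (fun i : Fin N => t ^ (i : ℕ)) (toVars QT N (macPoly lam)) =
      kernelFactor lam * ∏ c ∈ (diagram lam).cells, (1 - t ^ N * content c) := by
  rw [← pform_kernelCoeff, kernelCoeff, pform_pexpCoeff _
    (fun j => (1 - (t ^ N) ^ j) / (1 - t ^ j)) ?_ n _ (isWeightedHomogeneous_macPoly lam)]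
  · have h : (MvPolynomial.aeval (fun i : Fin N => t ^ (i : ℕ))).comp (toVars QT N) =
        MvPolynomial.aeval (fun j : ℕ+ => (1 - (t ^ N) ^ (j : ℕ)) / (1 - t ^ (j : ℕ))) := by
      refine MvPolynomial.algHom_ext fun j => ?_
      have hj := one_sub_t_pow_ne_zero j j.ne_zero
      rw [AlgHom.comp_apply, toVars, MvPolynomial.aeval_X, MvPolynomial.aeval_X,
        MvPolynomial.psum, map_sum, eq_div_iff hj]
      simp only [map_pow, MvPolynomial.aeval_X]
      rw [Finset.sum_congr rfl fun (i : Fin N) _ => show (t ^ (i : ℕ)) ^ (j : ℕ) = (t ^ (j : ℕ)) ^ (i : ℕ) by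
        rw [← pow_mul, ← pow_mul, mul_comm], Fin.sum_univ_eq_sum_range (fun i => (t ^ (j : ℕ)) ^ i) N,
        geom_sum_mul_neg, ← pow_mul, ← pow_mul, mul_comm]
    exact DFunLike.congr_fun h _
  · intro j hj
    have h1 := one_sub_q_pow_ne_zero j hj.ne'
    rw [qtRatio, one_pow, div_mul_div_cancel₀ h1]

/-- Induction on columns: specialising `toVars_macPoly_eq` at 1, t, ..., t^{N-1} relates Y_λ to Y_μ,
the first-column factors of c_λ cancel those of the content product, and what remains is ∏ t^i over
the first column. -/
theorem kernelFactor_mul_cCoeff (lam : n.Partition) :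
    kernelFactor lam * cCoeff (diagram lam) = ∏ c ∈ (diagram lam).cells, t ^ c.1 := by
  induction n using Nat.strong_induction_on with
  | _ n ih =>
  rcases Nat.eq_zero_or_pos n with rfl | hn
  · have h0 : (diagram lam).cells = ∅ := Finset.card_eq_zero.mp (card_cells_diagram lam)
    have hN : (diagram lam).colLen 0 ≤ 0 := colLen_diagram_le lam
    have h1 := aeval_toVars_macPoly 0 lam
    have h2 := coeff_toVars_macPoly 0 lam hN
    rw [h0, Finset.prod_empty, mul_one] at h1
    rw [cCoeff, h0, Finset.prod_empty, Finset.prod_empty, mul_one, ← h1,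
      MvPolynomial.eq_C_of_isEmpty (toVars QT 0 (macPoly lam)), MvPolynomial.aeval_C]
    rw [← h2]
    exact congrArg (fun e => MvPolynomial.coeff e (toVars QT 0 (macPoly lam))) (Subsingleton.elim _ _)
  · obtain ⟨mu, hmu⟩ := exists_diagram_eq (removeColumn (diagram lam)) rfl
    have hlt : (removeColumn (diagram lam)).cells.card < n := by
      have h1 := card_removeColumn_lt (diagram lam) (by rw [card_cells_diagram]; omega)
      rwa [card_cells_diagram] at h1
    have hmu1 := ih _ hlt mu
    set N := (diagram lam).colLen 0 with hN
    have h1 := congrArg (MvPolynomial.aeval (fun i : Fin N => t ^ (i : ℕ)))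
      (toVars_macPoly_eq lam mu hmu)
    rw [map_mul, aeval_toVars_macPoly, aeval_toVars_macPoly, map_prod,
      ← prod_content_removeColumn, hmu] at h1
    simp only [MvPolynomial.aeval_X] at h1
    rw [Fin.prod_univ_eq_prod_range (fun i => t ^ i) N] at h1
    -- Every box has row index below N, so t^N content(c) still carries a positive power of t and
    -- the common factor may be cancelled.
    have hD : ∏ c ∈ (removeColumn (diagram lam)).cells, (1 - t ^ N * content c) ≠ 0 :=
      prod_content_ne_zero (colLen_removeColumn_le _)
    rw [cCoeff_removeColumn, prod_cells_removeColumn, ← hmu, ← hmu1, hmu]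
    apply mul_left_cancel₀ hD
    linear_combination cCoeff (removeColumn (diagram lam)) * h1

end Specialization

/-! ### The generating function -/

section GeneratingFunction

variable {n : ℕ}

theorem nStat_transpose (d : YoungDiagram) : nStat d.transpose = ∑ c ∈ d.cells, c.2 := by
  have h1 : nStat d.transpose = ∑ c ∈ d.transpose.cells, c.1 := by
    rw [nStat, sum_cells _ _ le_rfl]
    refine Finset.sum_congr rfl fun i _ => ?_
    rw [Finset.sum_const, Finset.card_range, smul_eq_mul, mul_comm]
  rw [h1]
  refine Finset.sum_nbij' Prod.swap Prod.swap ?_ ?_ ?_ ?_ ?_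
  · intro c hc
    rwa [YoungDiagram.mem_cells, YoungDiagram.mem_transpose] at hc
  · intro c hc
    rw [YoungDiagram.mem_cells, YoungDiagram.mem_transpose, Prod.swap_swap]
    exact (YoungDiagram.mem_cells c).mp hc
  · exact fun c _ => Prod.swap_swap c
  · exact fun c _ => Prod.swap_swap c
  · exact fun c _ => rfl

theorem hB_zero (d : YoungDiagram) : hB 0 d = 1 := by
  rw [hB, MvPolynomial.hsymm_zero, map_one]

theorem cCoeff_ne_zero (d : YoungDiagram) : cCoeff d ≠ 0 :=
  Finset.prod_ne_zero_iff.mpr fun c _ => one_sub_monomial_ne_zero _ _ (by omega)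

theorem innerQT_macdonaldJ (lam : n.Partition) : innerQT (macdonaldJ lam) (macdonaldJ lam) =
    cCoeff (diagram lam) ^ 2 * macNorm lam := by
  rw [innerQT_eq, ← pform_apply, macdonaldJ, map_smul, ← macPoly, map_smul, map_smul,
    LinearMap.smul_apply, smul_eq_mul, smul_eq_mul, macNorm]
  ring

/-- The case α = 0, β = 1: the product of the contents is q^{n(λ')} t^{-n(λ)}, and its power of t
cancels the numerator of Y_λ. -/
theorem kernelFactor_mul_prod_content (lam : n.Partition) :
    kernelFactor lam * ∏ c ∈ (diagram lam).cells, (0 - 1 * content c) =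
      (-1) ^ n * q ^ nStat (diagram lam).transpose / cCoeff (diagram lam) := by
  have h1 : ∏ c ∈ (diagram lam).cells, (0 - 1 * content c) =
      (-1) ^ n * (q ^ nStat (diagram lam).transpose * ∏ c ∈ (diagram lam).cells, t⁻¹ ^ c.1) := by
    have h2 : ∀ c : ℕ × ℕ, 0 - 1 * content c = -1 * (q ^ c.2 * t⁻¹ ^ c.1) := fun c => by
      rw [content]
      ring
    rw [Finset.prod_congr rfl fun c _ => h2 c, Finset.prod_mul_distrib, Finset.prod_const,
      card_cells_diagram, Finset.prod_mul_distrib, nStat_transpose, Finset.prod_pow_eq_pow_sum]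
  have h3 : (∏ c ∈ (diagram lam).cells, t ^ c.1) * ∏ c ∈ (diagram lam).cells, t⁻¹ ^ c.1 = 1 := by
    rw [← Finset.prod_mul_distrib]
    refine Finset.prod_eq_one fun c _ => ?_
    rw [inv_pow, mul_inv_cancel₀ (pow_ne_zero _ t_ne_zero)]
  rw [eq_div_iff (cCoeff_ne_zero _), mul_right_comm, kernelFactor_mul_cCoeff, h1]
  linear_combination (-1) ^ n * q ^ nStat (diagram lam).transpose * h3

/-- Expansion in the orthogonal basis P_λ. Passing to J_λ = c_λ P_λ divides by c_λ² in the norm and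
multiplies by c_λ in the vector, which leaves the 1/c_λ of the pairing. -/
theorem psumHom_kernelCoeff (n : ℕ) : psumHom QT (kernelCoeff 0 1 n) = (-1) ^ n * v 0 n := by
  have h0 : ((-1) ^ n : Sym) = algebraMap QT Sym ((-1) ^ n) := by simp
  rw [eq_sum_macPoly (isWeightedHomogeneous_kernelCoeff 0 1 n), map_sum, v, h0,
    ← Algebra.smul_def, Finset.smul_sum]
  refine Finset.sum_congr rfl fun lam _ => ?_
  have hP : psumHom QT (macPoly lam) = macdonaldP n lam := (psumEquiv QT).apply_symm_apply _
  rw [map_smul, hP, pform_kernelCoeff, kernelFactor_mul_prod_content, innerQT_macdonaldJ, hB_zero,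
    mul_one, macdonaldJ, smul_smul, smul_smul]
  congr 1
  have h1 := cCoeff_ne_zero (diagram lam)
  have h2 := macNorm_ne_zero lam
  field_simp

theorem isExpSeries_vZero : IsExpSeries vZero fun n =>
    psumHom QT (MvPolynomial.C ((0 ^ n - 1 ^ n) / (1 - q ^ n)) * pvar QT n) := by
  have h : vZero = PowerSeries.map (psumHom QT).toRingHom
      (pexp fun n => (0 ^ n - 1 ^ n) / (1 - q ^ n)) := by
    ext1 n
    rw [vZero, PowerSeries.coeff_mk, PowerSeries.coeff_map, ← psumHom_kernelCoeff]
    rfl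
  rw [h]
  exact (pexp_isExpSeries _).map _

theorem isExpSeries_exp_powerSumSeries :
    IsExpSeries ((PowerSeries.exp QT).subst (-powerSumSeries)) fun n =>
      if h : 0 < n then -((1 / (1 - q ^ n)) • psum QT ⟨n, h⟩) else 0 := by
  set g : ℕ → Sym := fun n => if h : 0 < n then -((1 / (1 - q ^ n)) • psum QT ⟨n, h⟩) else 0 with hg
  have h : -powerSumSeries = PowerSeries.mk fun n => (n : QT)⁻¹ • g n := by
    ext1 n
    rw [map_neg, powerSumSeries, PowerSeries.coeff_mk, PowerSeries.coeff_mk, hg]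
    dsimp only
    split_ifs with hn
    · rw [smul_neg, smul_smul, one_div (n : QT), mul_comm]
    · rw [smul_zero, neg_zero]
  rw [h]
  exact expSeries_isExpSeries g

end GeneratingFunction
end Macdonald
end

theorem mainTheorem5 :
    Macdonald.vZero =
      (PowerSeries.exp Macdonald.QT).subst (-Macdonald.powerSumSeries) := by
  refine Macdonald.IsExpSeries.unique Macdonald.QT (Macdonald.isExpSeries_vZero.congr
    fun n hn => ?_) Macdonald.isExpSeries_exp_powerSumSeries
  rw [dif_pos hn, map_mul, MvPolynomial.algHom_C, ← Algebra.smul_def, ← neg_smul]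
  lift n to ℕ+ using hn
  -- For n > 0 the coefficient (0^n - 1^n)/(1 - q^n) is -1/(1 - q^n); at n = 0 the two logarithms
  -- need not be compared.
  rw [Macdonald.pvar_coe, Macdonald.psumHom, MvPolynomial.aeval_X, zero_pow n.ne_zero, one_pow,
    zero_sub, neg_div]
  rfl
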